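/- Let $\mathbb S^1=\mathbb R/2\pi\mathbb Z$ with its quotient distance $d$, $\mathbb T^2=\mathbb S^1\times\mathbb S^1$, and let $f_1,f_2:\mathbb S^1\to\mathbb R$ be non-constant real-analytic functions such that (H1) for $i=1,2$ there is no $z\in\mathbb S^1$ with $f_i(z)=0$ and $f_i'(z)=0$. Let $C_{f_i}=\{z\in\mathbb S^1: f_i(z)=0\}$ and $\mathcal O=\mathbb T^2\setminus\{(q,p): f_1(p)=0\text{ and }f_2(q)=0\}$. For $\tau_1,\tau_2\ge 0$ let $\Phi_{\tau_1,\tau_2}=\varphi^{(2)}_{\tau_2}\circ\varphi^{(1)}_{\tau_1}:\mathcal O\to\mathcal O$, where $\varphi^{(1)}_\tau(q,p)=(q+\tau f_1(p),p)$ and $\varphi^{(2)}_\tau(q,p)=(q,p+\tau f_2(q))$. Let $P\mathcal O$ be the projective bundle of $\mathcal O$, whose points are the pairs $(x,[u])$ with $x\in\mathcal O$ and $[u]$ the line spanned by $0\neq u\in T_x\mathcal O=\mathbb R^2$, and let $\check\Phi_{\tau_1,\tau_2}(x,[u])=(\Phi_{\tau_1,\tau_2}(x),[D_x\Phi_{\tau_1,\tau_2}u])$.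 For $T>0$ the projective chain is the Markov chain on $P\mathcal O$ with transition kernel $\check P_T(y,A)=\mathbb P(\check\Phi_{\tau_1,\tau_2}(y)\in A)$, where $\tau_1,\tau_2$ are independent and uniformly distributed on $[0,T]$. For $\beta,b>0$ put $$V(q,p)=\max\bigl(d(q,C_{f_2}),d(p,C_{f_1})\bigr)^{-\beta}+b,\qquad (q,p)\in\mathcal O,$$ with the conventions $d(\cdot,\emptyset)=\infty$ and $\infty^{-\beta}=0$, and $\check V(q,p,[u])=V(q,p)$. Then there are $\beta>0$ and $b>0$ such that $V$ is continuous with $V\ge 1$, and $T_0>0$ such that for every $T\ge T_0$ the kernel $\check P_T$ is $\check V$-uniformly geometrically ergodic: $\check P_T$ has exactly one stationary probability measure $\mu$ on $P\mathcal O$, and there are constants $C>0$ and $\gamma\in(0,1)$ such that every measurable $g:P\mathcal O\to\mathbb R$ with $\|g\|_{\check V}=\sup_{y}|g(y)|/\check V(y)<\infty$ is integrable with respect to $\mu$ and to all $\check P_T^m(y,\cdot)$, and $$\Bigl|\check P_T^m g(y)-\int g\,d\mu\Bigr|\le C\,\check V(y)\,\|g\|_{\check V}\,\gamma^m\qquad\text{for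 all } y\in P\mathcal O,\ m\ge 0.$$ -/

import Mathlib

open MeasureTheory ProbabilityTheory Set
open scoped LinearAlgebra.Projectivization ENNReal

noncomputable section

namespace HamiltonianShear

/-- The circle `ℝ / 2πℤ`, with its quotient metric. -/
abbrev Circ : Type := AddCircle (2 * Real.pi)

/-- Real-analytic functions on the circle: functions whose `2π`-periodic lift to `ℝ` is
real-analytic. -/
structure AnalyticFun where
  toFun : Circ → ℝ
  analytic' : AnalyticOnNhd ℝ (fun t : ℝ => toFun (t : Circ)) univ

instance : CoeFun AnalyticFun (fun _ => Circ → ℝ) := ⟨AnalyticFun.toFun⟩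

namespace AnalyticFun

/-- The derivative of a function on the circle. -/
def deriv (f : AnalyticFun) (z : Circ) : ℝ := _root_.deriv (fun t : ℝ => f (z + (t : Circ))) 0

/-- The zero set of a function on the circle. -/
def zeros (f : AnalyticFun) : Set Circ := {z | f z = 0}

/-- The function has no degenerate zero: `f` and `f'` do not vanish simultaneously. -/
def NoDegenerateZero (f : AnalyticFun) : Prop := f.zeros ∩ {z | f.deriv z = 0} = ∅

theorem deriv_coe (f : AnalyticFun) (x : ℝ) :
    f.deriv (x : Circ) = _root_.deriv (fun t : ℝ => f (t : Circ)) x := by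
  have h := deriv_comp_const_add (f := fun t : ℝ => f (t : Circ)) x 0
  simpa [deriv, AddCircle.coe_add] using h

theorem hasDerivAt (f : AnalyticFun) (x : ℝ) :
    HasDerivAt (fun t : ℝ => f (t : Circ)) (f.deriv (x : Circ)) x := by
  rw [deriv_coe]
  exact (f.analytic' x (mem_univ x)).differentiableAt.hasDerivAt

theorem continuous (f : AnalyticFun) : Continuous f := by
  refine (QuotientAddGroup.isQuotientMap_mk (AddSubgroup.zmultiples (2 * Real.pi))).continuous_iff.2 ?_
  exact continuousOn_univ.1 f.analytic'.continuousOn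

theorem continuous_deriv (f : AnalyticFun) : Continuous f.deriv := by
  refine (QuotientAddGroup.isQuotientMap_mk (AddSubgroup.zmultiples (2 * Real.pi))).continuous_iff.2 ?_
  have h : (f.deriv ∘ fun t : ℝ => (t : Circ)) = _root_.deriv (fun t : ℝ => f (t : Circ)) :=
    funext fun x => f.deriv_coe x
  exact h ▸ continuousOn_univ.1 f.analytic'.deriv.continuousOn

end AnalyticFun

/-! ### The real projective line with its quotient topology and Borel sigma-algebra -/

/-- The space of lines through the origin in `ℝ²`. -/
abbrev Line : Type := ℙ ℝ (ℝ × ℝ)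

instance : TopologicalSpace Line :=
  inferInstanceAs (TopologicalSpace (Quotient (projectivizationSetoid ℝ (ℝ × ℝ))))

instance : MeasurableSpace Line := borel Line

instance : BorelSpace Line := ⟨rfl⟩

theorem isOpenQuotientMap_mk :
    IsOpenQuotientMap (Projectivization.mk' ℝ : {v : ℝ × ℝ // v ≠ 0} → Line) := by
  refine ⟨Quotient.mk_surjective, continuous_quot_mk, fun U hU => ?_⟩
  have key : (Projectivization.mk' ℝ : {v : ℝ × ℝ // v ≠ 0} → Line) ⁻¹'
      (Projectivization.mk' ℝ '' U) =
      ⋃ a : ℝˣ, (fun v : {v : ℝ × ℝ // v ≠ 0} =>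
        (⟨a • v.1, (smul_ne_zero_iff_ne a).2 v.2⟩ : {v : ℝ × ℝ // v ≠ 0})) ⁻¹' U := by
    ext v
    simp only [mem_preimage, mem_image, mem_iUnion]
    constructor
    · rintro ⟨w, hw, hwv⟩
      obtain ⟨a, ha⟩ := (Projectivization.mk_eq_mk_iff ℝ w.1 v.1 w.2 v.2).1 hwv
      refine ⟨a, ?_⟩
      have : (⟨a • v.1, (smul_ne_zero_iff_ne a).2 v.2⟩ : {v : ℝ × ℝ // v ≠ 0}) = w :=
        Subtype.ext ha
      rwa [this]
    · rintro ⟨a, ha⟩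
      exact ⟨_, ha, (Projectivization.mk_eq_mk_iff ℝ _ _ _ _).2 ⟨a, rfl⟩⟩
  change IsOpen ((Projectivization.mk' ℝ : {v : ℝ × ℝ // v ≠ 0} → Line) ⁻¹' _)
  rw [key]
  refine isOpen_iUnion fun a => hU.preimage ?_
  exact Continuous.subtype_mk (continuous_subtype_val.const_smul a) _

instance : SecondCountableTopology Line :=
  isOpenQuotientMap_mk.isQuotientMap.secondCountableTopology isOpenQuotientMap_mk.isOpenMap

/-! ### The shears and the one-point dynamics -/

/-- The phase space `𝕋² ∖ F`, where `F` is the set of `(q, p)` with `f₁ p = 0` and `f₂ q = 0`. -/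
abbrev Phase (f₁ f₂ : AnalyticFun) : Type :=
  {x : Circ × Circ // ¬ (f₁ x.2 = 0 ∧ f₂ x.1 = 0)}

variable {f₁ f₂ : AnalyticFun}

/-- The horizontal shear `(q, p) ↦ (q + τ f₁(p), p)`. -/
def shear₁ (τ : ℝ) (x : Phase f₁ f₂) : Phase f₁ f₂ :=
  ⟨(x.1.1 + ((τ * f₁ x.1.2 : ℝ) : Circ), x.1.2), by
    rintro ⟨h1, h2⟩
    simp only at h1 h2
    exact x.2 ⟨h1, by simpa [h1] using h2⟩⟩

/-- The vertical shear `(q, p) ↦ (q, p + τ f₂(q))`. -/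
def shear₂ (τ : ℝ) (x : Phase f₁ f₂) : Phase f₁ f₂ :=
  ⟨(x.1.1, x.1.2 + ((τ * f₂ x.1.1 : ℝ) : Circ)), by
    rintro ⟨h1, h2⟩
    simp only at h1 h2
    exact x.2 ⟨by simpa [h2] using h1, h2⟩⟩

/-! ### Derivatives and the projective dynamics -/

/-- The linear map `(u₁, u₂) ↦ (u₁ + a u₂, u₂)`. -/
def upper (a : ℝ) : (ℝ × ℝ) ≃ₗ[ℝ] (ℝ × ℝ) where
  toFun u := (u.1 + a * u.2, u.2)
  invFun u := (u.1 - a * u.2, u.2)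
  map_add' u v := by ext <;> simp; ring
  map_smul' c u := by ext <;> simp; ring
  left_inv u := by ext <;> simp
  right_inv u := by ext <;> simp

/-- The linear map `(u₁, u₂) ↦ (u₁, u₂ + a u₁)`. -/
def lower (a : ℝ) : (ℝ × ℝ) ≃ₗ[ℝ] (ℝ × ℝ) where
  toFun u := (u.1, u.2 + a * u.1)
  invFun u := (u.1, u.2 - a * u.1)
  map_add' u v := by ext <;> simp; ring
  map_smul' c u := by ext <;> simp; ring
  left_inv u := by ext <;> simp
  right_inv u := by ext <;> simp

/-- The derivative of `shear₁ τ` at `x`; the tangent spaces of the torus are identified with `ℝ²`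
by translation. -/
def dShear₁ (τ : ℝ) (x : Phase f₁ f₂) : (ℝ × ℝ) ≃ₗ[ℝ] (ℝ × ℝ) := upper (τ * f₁.deriv x.1.2)

/-- The derivative of `shear₂ τ` at `x`. -/
def dShear₂ (τ : ℝ) (x : Phase f₁ f₂) : (ℝ × ℝ) ≃ₗ[ℝ] (ℝ × ℝ) := lower (τ * f₂.deriv x.1.1)

/-- `dShear₁` is the Fréchet derivative of the lift of `shear₁` to `ℝ²`. -/
theorem hasFDerivAt_lift_shear₁ (τ : ℝ) (v : ℝ × ℝ)
    (hv : ¬ (f₁ (v.2 : Circ) = 0 ∧ f₂ (v.1 : Circ) = 0)) :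
    HasFDerivAt (fun w : ℝ × ℝ => (w.1 + τ * f₁ (w.2 : Circ), w.2))
      (LinearMap.toContinuousLinearMap
        (dShear₁ τ (⟨((v.1 : Circ), (v.2 : Circ)), hv⟩ : Phase f₁ f₂) :
          (ℝ × ℝ) →ₗ[ℝ] (ℝ × ℝ))) v := by
  have h2 : HasFDerivAt (fun w : ℝ × ℝ => f₁ (w.2 : Circ))
      (f₁.deriv (v.2 : Circ) • ContinuousLinearMap.snd ℝ ℝ ℝ) v :=
    (f₁.hasDerivAt v.2).comp_hasFDerivAt v hasFDerivAt_snd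
  have h3 := ((hasFDerivAt_fst (𝕜 := ℝ) (p := v)).add (h2.const_mul τ)).prodMk
    (hasFDerivAt_snd (𝕜 := ℝ) (p := v))
  refine h3.congr_fderiv ?_
  ext <;> simp [dShear₁, upper]

/-- `dShear₂` is the Fréchet derivative of the lift of `shear₂` to `ℝ²`. -/
theorem hasFDerivAt_lift_shear₂ (τ : ℝ) (v : ℝ × ℝ)
    (hv : ¬ (f₁ (v.2 : Circ) = 0 ∧ f₂ (v.1 : Circ) = 0)) :
    HasFDerivAt (fun w : ℝ × ℝ => (w.1, w.2 + τ * f₂ (w.1 : Circ)))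
      (LinearMap.toContinuousLinearMap
        (dShear₂ τ (⟨((v.1 : Circ), (v.2 : Circ)), hv⟩ : Phase f₁ f₂) :
          (ℝ × ℝ) →ₗ[ℝ] (ℝ × ℝ))) v := by
  have h2 : HasFDerivAt (fun w : ℝ × ℝ => f₂ (w.1 : Circ))
      (f₂.deriv (v.1 : Circ) • ContinuousLinearMap.fst ℝ ℝ ℝ) v :=
    (f₂.hasDerivAt v.1).comp_hasFDerivAt v hasFDerivAt_fst
  have h3 := (hasFDerivAt_fst (𝕜 := ℝ) (p := v)).prodMk
    ((hasFDerivAt_snd (𝕜 := ℝ) (p := v)).add (h2.const_mul τ))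
  refine h3.congr_fderiv ?_
  ext <;> simp [dShear₂, lower]

/-- The projective bundle of the phase space (the tangent bundle of the torus is trivial). -/
abbrev PBundle (f₁ f₂ : AnalyticFun) : Type := Phase f₁ f₂ × Line

/-- The action of an invertible linear map on lines, `[u] ↦ [A u]`. -/
def lineMap (A : (ℝ × ℝ) ≃ₗ[ℝ] (ℝ × ℝ)) : Line → Line :=
  Projectivization.map (A : (ℝ × ℝ) →ₗ[ℝ] (ℝ × ℝ)) A.injective

/-- The map induced by `shear₁ τ` on the projective bundle. -/
def pShear₁ (τ : ℝ) (y : PBundle f₁ f₂) : PBundle f₁ f₂ :=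
  (shear₁ τ y.1, lineMap (dShear₁ τ y.1) y.2)

/-- The map induced by `shear₂ τ` on the projective bundle. -/
def pShear₂ (τ : ℝ) (y : PBundle f₁ f₂) : PBundle f₁ f₂ :=
  (shear₂ τ y.1, lineMap (dShear₂ τ y.1) y.2)

/-- One step of the projective dynamics with shearing times `(τ₁, τ₂)`. By the chain rule it sends
`(x, [u])` to `(Φ x, [D_xΦ u])`, where `Φ = shear₂ τ₂ ∘ shear₁ τ₁`. -/
def pStep (τ : ℝ × ℝ) (y : PBundle f₁ f₂) : PBundle f₁ f₂ :=
  pShear₂ τ.2 (pShear₁ τ.1 y)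

theorem continuous_lineMap_family (L : ℝ → (ℝ × ℝ) ≃ₗ[ℝ] (ℝ × ℝ))
    (hL : Continuous fun z : ℝ × (ℝ × ℝ) => L z.1 z.2) :
    Continuous fun z : ℝ × Line => lineMap (L z.1) z.2 := by
  have hq := (IsOpenQuotientMap.id (X := ℝ)).prodMap isOpenQuotientMap_mk
  refine hq.isQuotientMap.continuous_iff.2 ?_
  have h : Continuous fun z : ℝ × {v : ℝ × ℝ // v ≠ 0} =>
      (⟨L z.1 z.2.1, (L z.1).map_ne_zero_iff.2 z.2.2⟩ : {v : ℝ × ℝ // v ≠ 0}) :=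
    Continuous.subtype_mk
      (hL.comp (continuous_fst.prodMk (continuous_subtype_val.comp continuous_snd))) _
  exact isOpenQuotientMap_mk.continuous.comp h

theorem continuous_pShear₁ :
    Continuous fun z : ℝ × PBundle f₁ f₂ => pShear₁ z.1 z.2 := by
  have hf := f₁.continuous
  have hf' := f₁.continuous_deriv
  have h1 : Continuous fun z : ℝ × PBundle f₁ f₂ => shear₁ z.1 z.2.1 := by
    refine Continuous.subtype_mk ?_ _
    refine Continuous.prodMk (Continuous.add (by fun_prop) ?_) (by fun_prop)
    exact (AddCircle.continuous_mk' (2 * Real.pi)).comp (by fun_prop)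
  have h2 : Continuous fun z : ℝ × Line => lineMap (upper z.1) z.2 :=
    continuous_lineMap_family upper (by
      change Continuous fun z : ℝ × (ℝ × ℝ) => (z.2.1 + z.1 * z.2.2, z.2.2)
      fun_prop)
  have h3 : Continuous fun z : ℝ × PBundle f₁ f₂ =>
      ((z.1 * f₁.deriv z.2.1.1.2, z.2.2) : ℝ × Line) := by fun_prop
  exact h1.prodMk (h2.comp h3)

theorem continuous_pShear₂ :
    Continuous fun z : ℝ × PBundle f₁ f₂ => pShear₂ z.1 z.2 := by
  have hf := f₂.continuous
  have hf' := f₂.continuous_deriv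
  have h1 : Continuous fun z : ℝ × PBundle f₁ f₂ => shear₂ z.1 z.2.1 := by
    refine Continuous.subtype_mk ?_ _
    refine Continuous.prodMk (by fun_prop) (Continuous.add (by fun_prop) ?_)
    exact (AddCircle.continuous_mk' (2 * Real.pi)).comp (by fun_prop)
  have h2 : Continuous fun z : ℝ × Line => lineMap (lower z.1) z.2 :=
    continuous_lineMap_family lower (by
      change Continuous fun z : ℝ × (ℝ × ℝ) => (z.2.1, z.2.2 + z.1 * z.2.1)
      fun_prop)
  have h3 : Continuous fun z : ℝ × PBundle f₁ f₂ =>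
      ((z.1 * f₂.deriv z.2.1.1.1, z.2.2) : ℝ × Line) := by fun_prop
  exact h1.prodMk (h2.comp h3)

theorem continuous_pStep :
    Continuous fun z : PBundle f₁ f₂ × (ℝ × ℝ) => pStep z.2 z.1 := by
  have h1 : Continuous fun z : PBundle f₁ f₂ × (ℝ × ℝ) => pShear₁ z.2.1 z.1 :=
    continuous_pShear₁.comp (f := fun z : PBundle f₁ f₂ × (ℝ × ℝ) => (z.2.1, z.1)) (by fun_prop)
  have h2 : Continuous fun z : PBundle f₁ f₂ × (ℝ × ℝ) => (z.2.2, pShear₁ z.2.1 z.1) :=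
    (by fun_prop : Continuous fun z : PBundle f₁ f₂ × (ℝ × ℝ) => z.2.2).prodMk h1
  exact continuous_pShear₂.comp h2

/-! ### The Markov chain -/

/-- The law of `(τ₁, τ₂)`: two independent uniform variables on `[0, T]`. -/
def timeLaw (T : ℝ) : Measure (ℝ × ℝ) :=
  (cond volume (Icc 0 T)).prod (cond volume (Icc 0 T))

instance (T : ℝ) : SFinite (timeLaw T) := by unfold timeLaw; infer_instance

variable (f₁ f₂) in
/-- The transition kernel of the projective chain: `y` is sent to the law of `pStep (τ₁, τ₂) y`,
with `τ₁, τ₂` independent and uniform on `[0, T]`. -/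
def projKernel (T : ℝ) : Kernel (PBundle f₁ f₂) (PBundle f₁ f₂) where
  toFun y := (timeLaw T).map (fun τ => pStep τ y)
  measurable' := by
    have hm : Measurable fun z : PBundle f₁ f₂ × (ℝ × ℝ) => pStep z.2 z.1 :=
      continuous_pStep.measurable
    refine Measure.measurable_of_measurable_coe _ fun s hs => ?_
    have he : ∀ y : PBundle f₁ f₂, (timeLaw T).map (fun τ => pStep τ y) s =
        timeLaw T (Prod.mk y ⁻¹' ((fun z : PBundle f₁ f₂ × (ℝ × ℝ) => pStep z.2 z.1) ⁻¹' s)) :=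
      fun y => Measure.map_apply (hm.comp measurable_prodMk_left) hs
    simp_rw [he]
    exact measurable_measure_prodMk_left (hm hs)

/-! ### Uniform geometric ergodicity -/

section Ergodicity

variable {M : Type*}

/-- The weighted supremum norm `sup |g| / V`. -/
def weightedNorm (V g : M → ℝ) : ℝ := ⨆ x, |g x| / V x

/-- Measurable functions whose weighted supremum norm is finite. -/
def MemWeighted [MeasurableSpace M] (V g : M → ℝ) : Prop :=
  Measurable g ∧ BddAbove (range fun x => |g x| / V x)

/-- `V`-uniform geometric ergodicity of a transition kernel `Q`: there is exactly one stationary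
probability measure `μ`, and `|Qᵐ g (x) - ∫ g dμ| ≤ C V(x) ‖g‖_V γᵐ` for all `m`, `x` and all `g`
of finite weighted norm, where all the integrals that occur converge. -/
def UniformlyGeometricallyErgodic [MeasurableSpace M] (Q : Kernel M M) (V : M → ℝ) : Prop :=
  ∃ μ : Measure M,
    (IsProbabilityMeasure μ ∧ Q.Invariant μ) ∧
    (∀ ν : Measure M, IsProbabilityMeasure ν → Q.Invariant ν → ν = μ) ∧
    ∃ C γ : ℝ, 0 < C ∧ 0 < γ ∧ γ < 1 ∧
      ∀ g : M → ℝ, MemWeighted V g →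
        Integrable g μ ∧
        ∀ (m : ℕ) (x : M), Integrable g ((Q ^ m) x) ∧
          |∫ y, g y ∂((Q ^ m) x) - ∫ y, g y ∂μ| ≤ C * V x * weightedNorm V g * γ ^ m

end Ergodicity

variable (f₁ f₂) in
/-- The function `V(q, p) = max(d(q, C_{f₂}), d(p, C_{f₁}))^{-β} + b` on the phase space, with the
conventions `d(·, ∅) = ∞` and `∞^{-β} = 0`. -/
def lyapunov (β b : ℝ) (x : Phase f₁ f₂) : ℝ :=
  ((max (Metric.infEDist x.1.1 f₂.zeros) (Metric.infEDist x.1.2 f₁.zeros)) ^ (-β)).toReal + b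

end HamiltonianShear

end

/-! Two ingredients feed Harris' theorem: a drift towards a compact set and a minorization on
compact sets.

Drift. `V` blows up only at the deleted points, where both shears stop. Because zeros are
nondegenerate, `|f|` is comparable to the distance to its zero set, and that set is finite. Moving
at speed `v` during a uniform time in `[0, T]`, the mean of `dist^(-1/2)` to a finite set is at most
a constant times `(T|v|)^(-1/2)` plus a bounded term, with a constant independent of `T`
(`exists_lintegral_cond_infEDist_le`). Averaging over the vertical time replaces `V` by a multiple
of order `T^(-1/2)` of `dist(q', C₂)^(-1/2)`, where `q'` is the position after the horizontal shear
and `Cᵢ` is the zero set of `fᵢ`. If `dist(p, C₁)` is much smaller than `dist(q, C₂)`, the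
horizontal shear barely moves `q` and this factor suffices. Otherwise a second average gains another
`T^(-1/2)`, at the price of a factor `√T` for comparing the two distances. In both cases the factor
is at most `1/2` for large `T` (`lintegral_lyap_le`). The fibre of lines is compact and plays no
role here.

Minorization. Three shears with free times have a three-dimensional parameter, as has the projective
bundle. Where `f₁, f₁', f₂, f₂'` are all nonzero, a middle time `b` for which the horizontal shear
winds back to its starting point makes the Jacobian in the times a nonzero multiple of an expression
affine and nonconstant in `b`; it is nonzero for one of two periods (`surjective_fderiv_chartWord`,
`exists_period_det_ne_zero`). A parametrized submersion then gives a common minorizing measure for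
all nearby starting points (`exists_local_minorization`).

Transport to compact sets. Shears reach any base point, and long vertical shears with `f₂' ≠ 0` turn
every line towards the vertical one, so the good open set is reachable from everywhere
(`iUnion_reach_eq_univ`). Compactness makes the number of steps and the probability uniform.
Sublevel sets of `V` are compact, so the contraction of Hairer and Mattingly applies to some iterate
(`exists_contraction`, `uniformlyGeometricallyErgodic_of_drift`). -/

open Filter Topology

namespace HamiltonianShear

/-! ### Harris' theorem -/

section Harris

variable {M : Type*} [MeasurableSpace M]

/-- The drift condition `Q V ≤ θ V + K`. -/
structure Drift (Q : Kernel M M) (V : M → ℝ) (θ K : ℝ) : Prop where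
  integrable : ∀ x, Integrable V (Q x)
  le : ∀ x, ∫ y, V y ∂(Q x) ≤ θ * V x + K

instance isMarkovKernel_pow (Q : Kernel M M) [IsMarkovKernel Q] (n : ℕ) :
    IsMarkovKernel (Q ^ n) := by
  induction n with
  | zero => rw [pow_zero]; exact inferInstanceAs (IsMarkovKernel Kernel.id)
  | succ n ih => rw [pow_succ]; exact inferInstanceAs (IsMarkovKernel ((Q ^ n) ∘ₖ Q))

theorem stronglyMeasurable_integral (Q : Kernel M M) [IsMarkovKernel Q] {g : M → ℝ}
    (hg : Measurable g) : StronglyMeasurable fun x => ∫ y, g y ∂(Q x) :=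
  (hg.stronglyMeasurable.comp_measurable measurable_snd).integral_kernel_prod_right'
    (κ := Q) (f := fun p : M × M => g p.2)

variable {Q : Kernel M M} {V : M → ℝ} {θ K : ℝ}

theorem Drift.integrable_of_le (h : Drift Q V θ K) {g : M → ℝ} (hg : Measurable g) {N : ℝ}
    (hN : ∀ x, |g x| ≤ N * V x) (x : M) : Integrable g (Q x) :=
  ((h.integrable x).const_mul N).mono' hg.aestronglyMeasurable (ae_of_all _ hN)

theorem Drift.abs_integral_le (h : Drift Q V θ K) {g : M → ℝ} (hg : Measurable g) {N : ℝ}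
    (hN0 : 0 ≤ N) (hN : ∀ x, |g x| ≤ N * V x) (x : M) :
    |∫ y, g y ∂(Q x)| ≤ N * (θ * V x + K) := by
  calc |∫ y, g y ∂(Q x)| ≤ ∫ y, |g y| ∂(Q x) := abs_integral_le_integral_abs
    _ ≤ ∫ y, N * V y ∂(Q x) :=
        integral_mono (h.integrable_of_le hg hN x).abs ((h.integrable x).const_mul N) hN
    _ = N * ∫ y, V y ∂(Q x) := integral_const_mul _ _
    _ ≤ _ := mul_le_mul_of_nonneg_left (h.le x) hN0

variable [IsMarkovKernel Q]

theorem Drift.comp {Q' : Kernel M M} [IsMarkovKernel Q'] {θ' K' : ℝ} (h : Drift Q V θ K)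
    (h' : Drift Q' V θ' K') (hV : Measurable V) (hV0 : ∀ x, 0 ≤ V x) (hθ : 0 ≤ θ) :
    Drift (Q * Q') V (θ * θ') (θ * K' + K) := by
  have hm : StronglyMeasurable fun x => ∫ y, V y ∂(Q x) := stronglyMeasurable_integral Q hV
  have hint : ∀ x, Integrable (fun y => ∫ z, V z ∂(Q y)) (Q' x) := fun x => by
    refine (((h'.integrable x).const_mul θ).add (integrable_const K)).mono'
      hm.aestronglyMeasurable (ae_of_all _ fun y => ?_)
    rw [Real.norm_of_nonneg (integral_nonneg hV0)]
    exact h.le y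
  have hi : ∀ x, Integrable V ((Q ∘ₖ Q') x) := fun x => by
    rw [integrable_comp_iff hV.aestronglyMeasurable]
    refine ⟨ae_of_all _ h.integrable, ?_⟩
    simpa only [Real.norm_of_nonneg (hV0 _)] using hint x
  refine ⟨hi, fun x => ?_⟩
  change ∫ y, V y ∂((Q ∘ₖ Q') x) ≤ _
  rw [Kernel.integral_comp (hi x)]
  calc ∫ y, ∫ z, V z ∂(Q y) ∂(Q' x) ≤ ∫ y, (θ * V y + K) ∂(Q' x) :=
        integral_mono (hint x) (((h'.integrable x).const_mul θ).add (integrable_const K)) h.le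
    _ = θ * ∫ y, V y ∂(Q' x) + K := by
        rw [integral_add ((h'.integrable x).const_mul θ) (integrable_const K),
          integral_const_mul]
        simp
    _ ≤ θ * (θ' * V x + K') + K := by gcongr; exact h'.le x
    _ = _ := by ring

theorem Drift.pow (h : Drift Q V θ K) (hV : Measurable V) (hV0 : ∀ x, 0 ≤ V x) (hθ : 0 ≤ θ)
    (hθ1 : θ < 1) (hK : 0 ≤ K) (n : ℕ) : Drift (Q ^ n) V (θ ^ n) (K / (1 - θ)) := by
  have h1 : 0 < 1 - θ := by linarith
  induction n with
  | zero =>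
    have : ∀ x, (Q ^ 0) x = Measure.dirac x := fun x => by
      rw [pow_zero]; exact Kernel.id_apply x
    refine ⟨fun x => ?_, fun x => ?_⟩
    · rw [this]
      exact integrable_dirac' hV.stronglyMeasurable (by simp)
    · rw [this, integral_dirac' _ _ hV.stronglyMeasurable]
      have : 0 ≤ K / (1 - θ) := by positivity
      simpa using this
  | succ n ih =>
    have := h.comp ih hV hV0 hθ
    rw [pow_succ', pow_succ']
    convert this using 1
    field_simp
    ring

theorem integral_pow_add (h : Drift Q V θ K) (hV : Measurable V) (hV0 : ∀ x, 0 ≤ V x)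
    (hθ : 0 ≤ θ) (hθ1 : θ < 1) (hK : 0 ≤ K) {g : M → ℝ} (hg : Measurable g) {N : ℝ}
    (hN : ∀ x, |g x| ≤ N * V x) (m n : ℕ) (x : M) :
    ∫ y, g y ∂((Q ^ (m + n)) x) = ∫ y, ∫ z, g z ∂((Q ^ m) y) ∂((Q ^ n) x) := by
  have hi := (h.pow hV hV0 hθ hθ1 hK (m + n)).integrable_of_le hg hN x
  rw [Kernel.pow_add] at hi ⊢
  exact Kernel.integral_comp hi

/-- This is integration of the pointwise bound against `m₁ ⊗ m₂`, one variable at a time, divided by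
the common mass; mass zero is separate. -/
theorem integral_sub_integral_le {m₁ m₂ : Measure M} [IsFiniteMeasure m₁] [IsFiniteMeasure m₂]
    (hm : m₁.real univ = m₂.real univ) {φ w : M → ℝ} (hφ₁ : Integrable φ m₁)
    (hφ₂ : Integrable φ m₂) (hw₁ : Integrable w m₁) (hw₂ : Integrable w m₂)
    (h : ∀ x y, φ x - φ y ≤ w x + w y) :
    ∫ x, φ x ∂m₁ - ∫ x, φ x ∂m₂ ≤ ∫ x, w x ∂m₁ + ∫ x, w x ∂m₂ := by
  rcases (measureReal_nonneg (μ := m₁) (s := univ)).eq_or_lt with h0 | h0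
  · have h1 : m₁ = 0 := by
      rwa [eq_comm, measureReal_eq_zero_iff, Measure.measure_univ_eq_zero] at h0
    have h2 : m₂ = 0 := by
      rw [hm] at h0
      rwa [eq_comm, measureReal_eq_zero_iff, Measure.measure_univ_eq_zero] at h0
    simp [h1, h2]
  have h1 : ∀ y, ∫ x, φ x ∂m₁ - ∫ x, w x ∂m₁ ≤ m₁.real univ * (φ y + w y) := fun y => by
    rw [← integral_sub hφ₁ hw₁]
    calc ∫ x, (φ x - w x) ∂m₁ ≤ ∫ _, (φ y + w y) ∂m₁ :=
          integral_mono (hφ₁.sub hw₁) (integrable_const _) fun x => by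
            simp only; linarith [h x y]
      _ = _ := by simp
  have h2 : m₁.real univ * (∫ x, φ x ∂m₁ - ∫ x, w x ∂m₁) ≤
      m₁.real univ * (∫ x, φ x ∂m₂ + ∫ x, w x ∂m₂) := by
    rw [← integral_add hφ₂ hw₂, ← integral_const_mul]
    calc m₁.real univ * (∫ x, φ x ∂m₁ - ∫ x, w x ∂m₁)
        = ∫ _, (∫ x, φ x ∂m₁ - ∫ x, w x ∂m₁) ∂m₂ := by rw [hm]; simp
      _ ≤ _ := integral_mono (integrable_const _) ((hφ₂.add hw₂).const_mul _) h1
  have h3 := le_of_mul_le_mul_left h2 h0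
  linarith

/-- The common part `ν` cancels in the difference. The remainders have mass `1 - ν(M)`, which
shrinks the constant `2`, while the integrals of `v ≥ 0` only decrease. -/
theorem integral_sub_integral_le_of_minorization {m₁ m₂ ν : Measure M} [IsProbabilityMeasure m₁]
    [IsProbabilityMeasure m₂] (h₁ : ν ≤ m₁) (h₂ : ν ≤ m₂) {φ v : M → ℝ}
    (hφ₁ : Integrable φ m₁) (hφ₂ : Integrable φ m₂) (hv₁ : Integrable v m₁)
    (hv₂ : Integrable v m₂) (hv : ∀ x, 0 ≤ v x) {L : ℝ} (hL : 0 ≤ L)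
    (h : ∀ x y, φ x - φ y ≤ L * (2 + v x + v y)) :
    ∫ x, φ x ∂m₁ - ∫ x, φ x ∂m₂ ≤
      L * (2 * (1 - ν.real univ) + ∫ x, v x ∂m₁ + ∫ x, v x ∂m₂) := by
  have : IsFiniteMeasure ν := isFiniteMeasure_of_le m₁ h₁
  have key : ∀ m : Measure M, IsProbabilityMeasure m → ν ≤ m → ∃ m' : Measure M,
      IsFiniteMeasure m' ∧ m = m' + ν ∧ m'.real univ = 1 - ν.real univ := fun m _ hm => by
    have h1 : m = (m - ν) + ν := (Measure.sub_add_cancel_of_le hm).symm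
    refine ⟨m - ν, inferInstance, h1, ?_⟩
    have h2 : m.real univ = (m - ν).real univ + ν.real univ := by
      conv_lhs => rw [h1]
      exact measureReal_add_apply
    rw [probReal_univ] at h2
    linarith
  obtain ⟨n₁, hn₁, e₁, r₁⟩ := key m₁ ‹_› h₁
  obtain ⟨n₂, hn₂, e₂, r₂⟩ := key m₂ ‹_› h₂
  have sub₁ : n₁ ≤ m₁ := by rw [e₁]; exact Measure.le_add_right le_rfl
  have sub₂ : n₂ ≤ m₂ := by rw [e₂]; exact Measure.le_add_right le_rfl
  have sp : ∀ (g : M → ℝ) (m n : Measure M), m = n + ν → Integrable g m →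
      ∫ x, g x ∂m = ∫ x, g x ∂n + ∫ x, g x ∂ν := fun g m n e hg => by
    rw [e] at hg ⊢
    exact integral_add_measure hg.left_of_add_measure hg.right_of_add_measure
  have hw : ∀ (m n : Measure M), n ≤ m → IsFiniteMeasure n → Integrable v m →
      Integrable (fun x => L * (1 + v x)) n := fun m n e _ hg =>
    ((integrable_const 1).add (hg.mono_measure e)).const_mul L
  have main := integral_sub_integral_le (r₁.trans r₂.symm) (hφ₁.mono_measure sub₁)
    (hφ₂.mono_measure sub₂) (hw _ _ sub₁ hn₁ hv₁) (hw _ _ sub₂ hn₂ hv₂)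
    (fun x y => (h x y).trans_eq (by ring))
  have ev : ∀ (m n : Measure M), n ≤ m → IsFiniteMeasure n → n.real univ = 1 - ν.real univ →
      Integrable v m → ∫ x, L * (1 + v x) ∂n ≤ L * (1 - ν.real univ + ∫ x, v x ∂m) :=
    fun m n e _ r hg => by
    rw [integral_const_mul, integral_add (integrable_const 1) (hg.mono_measure e)]
    have := integral_mono_measure e (ae_of_all _ hv) hg
    have h1 : ∫ _, (1 : ℝ) ∂n = 1 - ν.real univ := by simp [r]
    rw [h1]
    gcongr
  rw [sp φ m₁ n₁ e₁ hφ₁, sp φ m₂ n₂ e₂ hφ₂]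
  have e1 := ev m₁ n₁ sub₁ hn₁ r₁ hv₁
  have e2 := ev m₂ n₂ sub₂ hn₂ r₂ hv₂
  linarith

/-- The contraction estimate of Hairer and Mattingly: a drift condition and a minorization on a
large sublevel set make the kernel contract the oscillation with respect to `2 + β V + β V`. -/
theorem exists_contraction (h : Drift Q V θ K) (hV0 : ∀ x, 0 ≤ V x)
    (hθ : 0 ≤ θ) (hθ1 : θ < 1) (hK : 0 ≤ K) {ν : Measure M} [IsFiniteMeasure ν] (hν : ν ≠ 0)
    (hmin : ∀ x, V x ≤ (2 * K + 2) / (1 - θ) → ν ≤ Q x) :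
    ∃ β ρ : ℝ, 0 < β ∧ 0 < ρ ∧ ρ < 1 ∧ ∀ (φ : M → ℝ) (L N : ℝ), Measurable φ → 0 ≤ L →
      (∀ x, |φ x| ≤ N * V x) → (∀ x y, |φ x - φ y| ≤ L * (2 + β * V x + β * V y)) →
      ∀ x y, |∫ z, φ z ∂(Q x) - ∫ z, φ z ∂(Q y)| ≤ L * ρ * (2 + β * V x + β * V y) := by
  set a := ν.real univ with ha
  have ha0 : 0 < a := by
    refine lt_of_le_of_ne measureReal_nonneg fun h0 => hν ?_
    rwa [ha, eq_comm, measureReal_eq_zero_iff, Measure.measure_univ_eq_zero] at h0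
  -- The weight `β` is small enough that the drift error `2βK` eats at most half of the gain `2a`
  -- from the minorization.
  set β := a / (2 * K + 1) with hβ
  have hβ0 : 0 < β := by positivity
  have hβK : 2 * β * K ≤ a := by
    rw [hβ]
    have : 2 * (a / (2 * K + 1)) * K = a * (2 * K / (2 * K + 1)) := by ring
    rw [this]
    have : 2 * K / (2 * K + 1) ≤ 1 := by rw [div_le_one (by positivity)]; linarith
    nlinarith
  -- This `ε` solves `β - εβ(K + 1) = ε`, which is what the case of large `V x + V y` requires.
  set ε := β / (β * (K + 1) + 1) with hε
  have hε0 : 0 < ε := by positivity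
  have hεe : ε * (β * (K + 1) + 1) = β := by rw [hε]; field_simp
  have hε1 : ε < 1 := by
    rw [hε, div_lt_one (by positivity)]; nlinarith
  have h1θ : 0 < 1 - θ := by linarith
  set ρ := max (1 - (1 - θ) * ε) (1 - a / 2) with hρ
  have hρ1 : 1 - (1 - θ) * ε ≤ ρ := le_max_left _ _
  have hρ2 : 1 - a / 2 ≤ ρ := le_max_right _ _
  have hρ0 : 0 < ρ := lt_of_lt_of_le (by nlinarith) hρ1
  have hρθ : θ ≤ ρ := le_trans (by nlinarith) hρ1
  refine ⟨β, ρ, hβ0, hρ0, max_lt (by nlinarith) (by linarith), ?_⟩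
  intro φ L N hφ hL hN hosc
  have hiφ := h.integrable_of_le hφ hN
  have hiV : ∀ x, Integrable (fun y => β * V y) (Q x) := fun x => (h.integrable x).const_mul β
  have hbV : ∀ x, ∫ y, β * V y ∂(Q x) ≤ β * (θ * V x + K) := fun x => by
    rw [integral_const_mul]; exact mul_le_mul_of_nonneg_left (h.le x) hβ0.le
  have one : ∀ x y, ∫ z, φ z ∂(Q x) - ∫ z, φ z ∂(Q y) ≤ L * ρ * (2 + β * V x + β * V y) := by
    intro x y
    have hosc' : ∀ x y, φ x - φ y ≤ L * (2 + β * V x + β * V y) :=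
      fun x y => (le_abs_self _).trans (hosc x y)
    have hx := hV0 x
    have hy := hV0 y
    rw [mul_assoc]
    rcases le_or_gt ((2 * K + 2) / (1 - θ)) (V x + V y) with hR | hR
    -- For large `V x + V y` the drift alone contracts, so the zero measure serves as common part.
    · have h1 := integral_sub_integral_le_of_minorization (Measure.zero_le (Q x))
        (Measure.zero_le (Q y)) (hiφ x) (hiφ y) (hiV x) (hiV y)
        (fun z => mul_nonneg hβ0.le (hV0 z)) hL hosc'
      refine h1.trans (mul_le_mul_of_nonneg_left ?_ hL)
      have h2 := hbV x
      have h3 := hbV y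
      rw [div_le_iff₀ h1θ] at hR
      have h4 : β * (1 - ε) * (2 * K + 2) ≤ β * (1 - ε) * ((V x + V y) * (1 - θ)) :=
        mul_le_mul_of_nonneg_left hR (mul_nonneg hβ0.le (by linarith))
      have h5 : (1 - (1 - θ) * ε) * (2 + β * V x + β * V y) ≤ ρ * (2 + β * V x + β * V y) :=
        mul_le_mul_of_nonneg_right hρ1 (by positivity)
      simp only [measureReal_zero_apply]
      nlinarith
    · have hVx : V x ≤ (2 * K + 2) / (1 - θ) := by linarith
      have hVy : V y ≤ (2 * K + 2) / (1 - θ) := by linarith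
      have h1 := integral_sub_integral_le_of_minorization (hmin x hVx) (hmin y hVy)
        (hiφ x) (hiφ y) (hiV x) (hiV y) (fun z => mul_nonneg hβ0.le (hV0 z)) hL hosc'
      refine h1.trans (mul_le_mul_of_nonneg_left ?_ hL)
      have h2 := hbV x
      have h3 := hbV y
      have h4 : θ * (β * V x + β * V y) ≤ ρ * (β * V x + β * V y) :=
        mul_le_mul_of_nonneg_right hρθ (by positivity)
      nlinarith
  intro x y
  rw [abs_le]
  refine ⟨?_, one x y⟩
  have := one y x
  nlinarith

end Harris

end HamiltonianShear

namespace HamiltonianShear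

/-! ### Contraction for all iterates, and setwise limits of measures -/

section Harris

variable {M : Type*} [MeasurableSpace M]

theorem exists_geometric_contraction {Q : Kernel M M} [IsMarkovKernel Q] {V : M → ℝ} {θ K : ℝ}
    (h : Drift Q V θ K) (hV : Measurable V) (hV1 : ∀ x, 1 ≤ V x)
    (hθ : 0 ≤ θ) (hθ1 : θ < 1) (hK : 0 ≤ K)
    (hmin : ∀ R : ℝ, ∃ n : ℕ, n ≠ 0 ∧ ∃ ν : Measure M, IsFiniteMeasure ν ∧ ν ≠ 0 ∧
      ∀ x, V x ≤ R → ν ≤ (Q ^ n) x) :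
    ∃ C γ : ℝ, 0 < C ∧ 0 < γ ∧ γ < 1 ∧ ∀ (g : M → ℝ) (N : ℝ), Measurable g → 0 ≤ N →
      (∀ x, |g x| ≤ N * V x) → ∀ (m : ℕ) (x y : M),
        |∫ z, g z ∂((Q ^ m) x) - ∫ z, g z ∂((Q ^ m) y)| ≤ C * N * γ ^ m * (V x + V y) := by
  have hV0 : ∀ x, 0 ≤ V x := fun x => zero_le_one.trans (hV1 x)
  have h1θ : 0 < 1 - θ := by linarith
  set K' := K / (1 - θ) with hK'
  have hK'0 : 0 ≤ K' := by positivity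
  have hpow : ∀ n, Drift (Q ^ n) V (θ ^ n) K' := h.pow hV hV0 hθ hθ1 hK
  have hbound : ∀ (g : M → ℝ) (N : ℝ), Measurable g → 0 ≤ N → (∀ x, |g x| ≤ N * V x) →
      ∀ m x, |∫ z, g z ∂((Q ^ m) x)| ≤ N * (1 + K') * V x := fun g N hg hN hgN m x => by
    refine ((hpow m).abs_integral_le hg hN hgN x).trans ?_
    rw [mul_assoc]
    refine mul_le_mul_of_nonneg_left ?_ hN
    have h1 : θ ^ m * V x ≤ 1 * V x :=
      mul_le_mul_of_nonneg_right (pow_le_one₀ hθ hθ1.le) (hV0 x)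
    have h2 : K' * 1 ≤ K' * V x := mul_le_mul_of_nonneg_left (hV1 x) hK'0
    linarith
  -- The level must be fixed before `n` is known. Since `θ ^ n ≤ θ`, this level exceeds the one that
  -- the contraction asks for with rate `θ ^ n`.
  obtain ⟨n, hn, ν, hνf, hν0, hν⟩ := hmin ((2 * K' + 2) / (1 - θ))
  have hθn : θ ^ n ≤ θ := pow_le_of_le_one hθ hθ1.le hn
  obtain ⟨β, ρ, hβ, hρ0, hρ1, hc⟩ := exists_contraction (hpow n) hV0 (pow_nonneg hθ n)
    (hθn.trans_lt hθ1) hK'0 hν0 (fun x hx => hν x (hx.trans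
      (div_le_div_of_nonneg_left (by positivity) h1θ (by linarith))))
  have iter : ∀ (φ : M → ℝ) (L N : ℝ), Measurable φ → 0 ≤ L → 0 ≤ N → (∀ x, |φ x| ≤ N * V x) →
      (∀ x y, |φ x - φ y| ≤ L * (2 + β * V x + β * V y)) → ∀ (k : ℕ) (x y : M),
      |∫ z, φ z ∂((Q ^ (n * k)) x) - ∫ z, φ z ∂((Q ^ (n * k)) y)| ≤
        L * ρ ^ k * (2 + β * V x + β * V y) := by
    intro φ L N hφ hL hN hφN hosc k
    induction k with
    | zero =>
      intro x y
      have e : ∀ x, ∫ z, φ z ∂((Q ^ (n * 0)) x) = φ x := fun x => by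
        rw [mul_zero, pow_zero]
        change ∫ z, φ z ∂(Kernel.id x) = φ x
        rw [Kernel.id_apply, integral_dirac' _ _ hφ.stronglyMeasurable]
      rw [e, e]
      simpa using hosc x y
    | succ k ih =>
      intro x y
      have e := integral_pow_add h hV hV0 hθ hθ1 hK hφ hφN (n * k) n
      rw [mul_add, mul_one, e, e, pow_succ, ← mul_assoc]
      exact hc _ _ _ (stronglyMeasurable_integral (Q ^ (n * k)) hφ).measurable (by positivity)
        (hbound φ N hφ hN hφN (n * k)) ih x y
  have hn0 : (n : ℝ) ≠ 0 := Nat.cast_ne_zero.2 hn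
  set γ := ρ ^ (1 / (n : ℝ)) with hγ
  have hγ0 : 0 < γ := Real.rpow_pos_of_pos hρ0 _
  have hγ1 : γ < 1 := Real.rpow_lt_one hρ0.le hρ1 (by positivity)
  have hγn : γ ^ n = ρ := by
    rw [hγ, ← Real.rpow_natCast, ← Real.rpow_mul hρ0.le, one_div, inv_mul_cancel₀ hn0,
      Real.rpow_one]
  refine ⟨(1 + K') * (1 + β) / (β * ρ), γ, by positivity, hγ0, hγ1, ?_⟩
  intro g N hg hN hgN m x y
  -- The remainder `m % n` of the steps is absorbed into the test function, and the `m / n` blocks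
  -- of length `n` contract.
  have e := integral_pow_add h hV hV0 hθ hθ1 hK hg hgN (m % n) (n * (m / n))
  rw [Nat.mod_add_div] at e
  rw [e, e]
  have hosc : ∀ x y, |∫ z, g z ∂((Q ^ (m % n)) x) - ∫ z, g z ∂((Q ^ (m % n)) y)| ≤
      N * (1 + K') / β * (2 + β * V x + β * V y) := fun x y => by
    have h1 := hbound g N hg hN hgN (m % n) x
    have h2 := hbound g N hg hN hgN (m % n) y
    calc _ ≤ N * (1 + K') * V x + N * (1 + K') * V y := (abs_sub _ _).trans (add_le_add h1 h2)
      _ = N * (1 + K') / β * (β * V x + β * V y) := by field_simp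
      _ ≤ _ := by
        refine mul_le_mul_of_nonneg_left ?_ (by positivity)
        linarith
  refine (iter _ _ _ (stronglyMeasurable_integral (Q ^ (m % n)) hg).measurable (by positivity)
    (by positivity) (hbound g N hg hN hgN (m % n)) hosc (m / n) x y).trans ?_
  -- Rounding `m / n` down costs at most one factor `ρ = γ ^ n`.
  have hk : ρ ^ (m / n) ≤ γ ^ m / ρ := by
    rw [le_div_iff₀ hρ0]
    conv_rhs => rw [← Nat.div_add_mod m n, pow_add, pow_mul, hγn]
    refine mul_le_mul_of_nonneg_left ?_ (by positivity)
    rw [← hγn]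
    exact pow_le_pow_of_le_one hγ0.le hγ1.le (Nat.mod_lt _ (Nat.pos_of_ne_zero hn)).le
  have hS : 2 + β * V x + β * V y ≤ (1 + β) * (V x + V y) := by
    nlinarith [hV1 x, hV1 y]
  have hVx := hV0 x
  have hVy := hV0 y
  have hVV : 0 ≤ V x + V y := add_nonneg (hV0 x) (hV0 y)
  calc N * (1 + K') / β * ρ ^ (m / n) * (2 + β * V x + β * V y)
      ≤ N * (1 + K') / β * (γ ^ m / ρ) * ((1 + β) * (V x + V y)) := by gcongr
    _ = _ := by field_simp

/-- The Cauchy bound is uniform over measurable sets, so countable additivity passes to the limit by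
an `ε/3` argument; no topology on `M` is needed. -/
theorem exists_setwise_limit {u : ℕ → Measure M} [∀ m, IsProbabilityMeasure (u m)] {δ : ℕ → ℝ}
    (hδ : Tendsto δ atTop (𝓝 0))
    (h : ∀ m k, m ≤ k → ∀ A, MeasurableSet A → |(u m).real A - (u k).real A| ≤ δ m) :
    ∃ μ : Measure M, IsProbabilityMeasure μ ∧
      ∀ m A, MeasurableSet A → |(u m).real A - μ.real A| ≤ δ m := by
  have hlim : ∀ A : Set M, ∃ l : ℝ, MeasurableSet A →
      Tendsto (fun m => (u m).real A) atTop (𝓝 l) := fun A => by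
    by_cases hA : MeasurableSet A
    · have : CauchySeq fun m => (u m).real A := by
        refine cauchySeq_of_le_tendsto_0 (fun m => δ m + δ m) (fun a b m ha hb => ?_)
          (by simpa using hδ.add hδ)
        refine (dist_triangle_left _ _ ((u m).real A)).trans ?_
        exact add_le_add (h m a ha A hA) (h m b hb A hA)
      obtain ⟨l, hl⟩ := cauchySeq_tendsto_of_complete this
      exact ⟨l, fun _ => hl⟩
    · exact ⟨0, fun h => absurd h hA⟩
  choose l hl using hlim
  have hl0 : ∀ A, MeasurableSet A → 0 ≤ l A := fun A hA =>
    ge_of_tendsto' (hl A hA) fun m => measureReal_nonneg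
  have hlδ : ∀ m A, MeasurableSet A → |(u m).real A - l A| ≤ δ m := fun m A hA =>
    le_of_tendsto ((tendsto_const_nhds.sub (hl A hA)).abs)
      ((eventually_ge_atTop m).mono fun k hk => h m k hk A hA)
  have hsum : ∀ f : ℕ → Set M, (∀ i, MeasurableSet (f i)) → Pairwise (Function.onFun Disjoint f) →
      HasSum (fun i => l (f i)) (l (⋃ i, f i)) := by
    intro f hf hd
    rw [hasSum_iff_tendsto_nat_of_nonneg fun i => hl0 _ (hf i)]
    have hB : ∀ k, MeasurableSet (⋃ i ∈ Finset.range k, f i) := fun k =>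
      Finset.measurableSet_biUnion _ fun i _ => hf i
    have hfin : ∀ m k, ∑ i ∈ Finset.range k, (u m).real (f i) =
        (u m).real (⋃ i ∈ Finset.range k, f i) := fun m k =>
      (measureReal_biUnion_finset (hd.set_pairwise _) fun i _ => hf i).symm
    have hlk : ∀ k, ∑ i ∈ Finset.range k, l (f i) = l (⋃ i ∈ Finset.range k, f i) := fun k => by
      refine tendsto_nhds_unique (tendsto_finsetSum _ fun i _ => hl (f i) (hf i)) ?_
      simp_rw [hfin]
      exact hl _ (hB k)
    rw [Metric.tendsto_atTop]
    intro ε hε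
    obtain ⟨m, hm⟩ := ((tendsto_order.1 hδ).2 (ε / 3) (by positivity)).exists
    have hu : HasSum (fun i => (u m).real (f i)) ((u m).real (⋃ i, f i)) := by
      have e := measure_iUnion (μ := u m) hd hf
      rw [measureReal_def, e, ENNReal.tsum_toReal_eq fun i => measure_ne_top _ _]
      exact (ENNReal.summable_toReal (e ▸ measure_ne_top _ _)).hasSum
    obtain ⟨k₀, hk₀⟩ := Metric.tendsto_atTop.1 hu.tendsto_sum_nat (ε / 3) (by positivity)
    refine ⟨k₀, fun k hk => ?_⟩
    have h1 := hk₀ k hk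
    rw [hfin, Real.dist_eq] at h1
    rw [hlk, Real.dist_eq]
    have h2 := abs_le.1 (hlδ m _ (hB k))
    have h3 := abs_le.1 (hlδ m _ (MeasurableSet.iUnion hf))
    have h4 := abs_lt.1 h1
    rw [abs_lt]
    constructor <;> linarith
  let μ : Measure M := Measure.ofMeasurable (fun A _ => ENNReal.ofReal (l A))
    (by
      have : 0 = l ∅ := by simpa using hl ∅ MeasurableSet.empty
      simp [← this])
    (fun f hf hd => by
      have := hsum f hf hd
      rw [← this.tsum_eq, ENNReal.ofReal_tsum_of_nonneg (fun i => hl0 _ (hf i)) this.summable])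
  have hμ : ∀ A, MeasurableSet A → μ A = ENNReal.ofReal (l A) := fun A hA =>
    Measure.ofMeasurable_apply A hA
  refine ⟨μ, ⟨?_⟩, fun m A hA => ?_⟩
  · have : 1 = l univ := by simpa using hl univ MeasurableSet.univ
    rw [hμ _ MeasurableSet.univ, ← this]
    simp
  · rw [measureReal_def μ, hμ A hA, ENNReal.toReal_ofReal (hl0 A hA)]
    exact hlδ m A hA

/-- By the layer cake formula, the integral of `f` is the integral over `t ∈ (0, B]` of the measure
of `{t ≤ f}`. -/
theorem integral_le_integral_add_of_setwise {m₁ m₂ : Measure M} [IsProbabilityMeasure m₁]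
    [IsProbabilityMeasure m₂] {δ B : ℝ} (hB : 0 ≤ B)
    (h : ∀ A, MeasurableSet A → |m₁.real A - m₂.real A| ≤ δ) {f : M → ℝ} (hf : Measurable f)
    (hf0 : ∀ x, 0 ≤ f x) (hfB : ∀ x, f x ≤ B) :
    |∫ x, f x ∂m₁ - ∫ x, f x ∂m₂| ≤ B * δ := by
  have hi : ∀ m : Measure M, IsProbabilityMeasure m → Integrable f m := fun m _ =>
    (integrable_const B).mono' hf.aestronglyMeasurable
      (ae_of_all _ fun x => by rw [Real.norm_of_nonneg (hf0 x)]; exact hfB x)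
  have hl : ∀ m : Measure M, IsProbabilityMeasure m →
      ∫ x, f x ∂m = ∫ t in Ioc 0 B, m.real {a | t ≤ f a} := fun m hm =>
    (hi m hm).integral_eq_integral_Ioc_meas_le (ae_of_all _ hf0) (ae_of_all _ hfB)
  have hil : ∀ m : Measure M, IsProbabilityMeasure m →
      IntegrableOn (fun t => m.real {a | t ≤ f a}) (Ioc 0 B) := fun m _ => by
    have ha : Antitone fun t => m.real {a | t ≤ f a} := fun s t hst =>
      measureReal_mono fun a (ha : t ≤ f a) => hst.trans ha
    exact (integrable_const (1 : ℝ)).mono' ha.measurable.aestronglyMeasurable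
      (ae_of_all _ fun t => by
        rw [Real.norm_of_nonneg measureReal_nonneg]; exact measureReal_le_one)
  rw [hl m₁ ‹_›, hl m₂ ‹_›, ← integral_sub (hil m₁ ‹_›) (hil m₂ ‹_›)]
  have := norm_setIntegral_le_of_norm_le_const (μ := volume) (s := Ioc 0 B) (C := δ)
    (f := fun t => m₁.real {a | t ≤ f a} - m₂.real {a | t ≤ f a}) (by simp)
    (fun t _ => h _ (measurableSet_le measurable_const hf))
  rw [Real.norm_eq_abs] at this
  refine this.trans_eq ?_
  rw [Real.volume_real_Ioc_of_le hB]
  ring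

end Harris

end HamiltonianShear

namespace HamiltonianShear

/-! ### The invariant measure: existence, moments, uniqueness and rate -/

section Harris

variable {M : Type*} [MeasurableSpace M]

theorem integral_kernel_indicator (Q : Kernel M M) (x : M) {A : Set M} (hA : MeasurableSet A) :
    ∫ y, A.indicator (fun _ => (1 : ℝ)) y ∂(Q x) = (Q x).real A := by
  rw [integral_indicator hA]
  simp

theorem invariant_pow {Q : Kernel M M} {μ : Measure M} (h : Q.Invariant μ) (m : ℕ) :
    (Q ^ m).Invariant μ := by
  induction m with
  | zero => rw [pow_zero]; exact Measure.id_comp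
  | succ m ih => rw [pow_succ]; exact ih.comp h

theorem measureReal_bind {Q : Kernel M M} [IsMarkovKernel Q] (μ : Measure M)
    {A : Set M} (hA : MeasurableSet A) :
    (μ.bind Q).real A = ∫ x, (Q x).real A ∂μ := by
  rw [measureReal_def, Measure.bind_apply hA Q.aemeasurable]
  exact (integral_toReal (Q.measurable_coe hA).aemeasurable
    (ae_of_all _ fun x => measure_lt_top _ _)).symm

theorem measurable_measureReal (Q : Kernel M M) {A : Set M} (hA : MeasurableSet A) :
    Measurable fun x => (Q x).real A := (Q.measurable_coe hA).ennreal_toReal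

/-- Harris' theorem: a drift condition together with minorization on the sublevel sets of the
Lyapunov function implies uniform geometric ergodicity. -/
theorem uniformlyGeometricallyErgodic_of_drift [Nonempty M] {Q : Kernel M M} [IsMarkovKernel Q]
    {V : M → ℝ} {θ K : ℝ} (h : Drift Q V θ K) (hV : Measurable V) (hV1 : ∀ x, 1 ≤ V x)
    (hθ : 0 ≤ θ) (hθ1 : θ < 1) (hK : 0 ≤ K)
    (hmin : ∀ R : ℝ, ∃ n : ℕ, n ≠ 0 ∧ ∃ ν : Measure M, IsFiniteMeasure ν ∧ ν ≠ 0 ∧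
      ∀ x, V x ≤ R → ν ≤ (Q ^ n) x) :
    UniformlyGeometricallyErgodic Q V := by
  have hV0 : ∀ x, 0 ≤ V x := fun x => zero_le_one.trans (hV1 x)
  obtain ⟨C, γ, hC, hγ0, hγ1, hcon⟩ := exists_geometric_contraction h hV hV1 hθ hθ1 hK hmin
  have h1θ : 0 < 1 - θ := by linarith
  set K' := K / (1 - θ) with hK'
  have hK'0 : 0 ≤ K' := by positivity
  have hpow : ∀ n, Drift (Q ^ n) V (θ ^ n) K' := h.pow hV hV0 hθ hθ1 hK
  have hVm : ∀ m x, ∫ y, V y ∂((Q ^ m) x) ≤ V x + K' := fun m x => by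
    have h1 : θ ^ m * V x ≤ 1 * V x :=
      mul_le_mul_of_nonneg_right (pow_le_one₀ hθ hθ1.le) (hV0 x)
    linarith [(hpow m).le x]
  have hind : ∀ (A : Set M) (x : M), |A.indicator (fun _ => (1 : ℝ)) x| ≤ 1 * V x := fun A x => by
    by_cases hx : x ∈ A
    · simpa [hx] using hV1 x
    · simpa [hx] using hV0 x
  have hindm : ∀ A : Set M, MeasurableSet A → Measurable (A.indicator (fun _ => (1 : ℝ))) :=
    fun A hA => measurable_const.indicator hA
  obtain ⟨x₀⟩ := ‹Nonempty M›
  -- This bounds `C γ ^ m (V x₀ + ∫ V dQ ^ j(x₀))` uniformly in `j`, the moment being at most `V x₀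
  -- + K'`.
  set δ : ℕ → ℝ := fun m => C * (2 * V x₀ + K') * γ ^ m with hδ
  have hδ0 : Tendsto δ atTop (𝓝 0) := by
    simpa using (tendsto_pow_atTop_nhds_zero_of_lt_one hγ0.le hγ1).const_mul (C * (2 * V x₀ + K'))
  obtain ⟨μ, hμ, hμlim⟩ := exists_setwise_limit (u := fun m => (Q ^ m) x₀) hδ0 (by
    intro m k hmk A hA
    obtain ⟨j, rfl⟩ := Nat.exists_eq_add_of_le hmk
    have hi : Integrable (fun z => ((Q ^ m) z).real A) ((Q ^ j) x₀) :=
      (integrable_const (1 : ℝ)).mono' (measurable_measureReal (Q ^ m) hA).aestronglyMeasurable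
        (ae_of_all _ fun z => by
          rw [Real.norm_of_nonneg measureReal_nonneg]; exact measureReal_le_one)
    have e : ((Q ^ (m + j)) x₀).real A = ∫ z, ((Q ^ m) z).real A ∂((Q ^ j) x₀) := by
      rw [← integral_kernel_indicator _ _ hA,
        integral_pow_add h hV hV0 hθ hθ1 hK (hindm A hA) (hind A)]
      simp_rw [integral_kernel_indicator _ _ hA]
    have e' : ((Q ^ m) x₀).real A = ∫ _, ((Q ^ m) x₀).real A ∂((Q ^ j) x₀) := by simp
    rw [e, e', ← integral_sub (integrable_const _) hi]
    refine abs_integral_le_integral_abs.trans ?_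
    calc ∫ z, |((Q ^ m) x₀).real A - ((Q ^ m) z).real A| ∂((Q ^ j) x₀)
        ≤ ∫ z, C * γ ^ m * (V x₀ + V z) ∂((Q ^ j) x₀) := by
          refine integral_mono ((integrable_const _).sub hi).abs
            (((integrable_const _).add ((hpow j).integrable x₀)).const_mul _) fun z => ?_
          have := hcon _ 1 (hindm A hA) zero_le_one (hind A) m x₀ z
          simpa only [integral_kernel_indicator _ _ hA, mul_one] using this
      _ = C * γ ^ m * (V x₀ + ∫ z, V z ∂((Q ^ j) x₀)) := by
          rw [integral_const_mul, integral_add (integrable_const _) ((hpow j).integrable x₀)]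
          simp
      _ ≤ C * γ ^ m * (V x₀ + (V x₀ + K')) := by gcongr; exact hVm j x₀
      _ = δ m := by rw [hδ]; ring)
  -- The measures of `A` after `m + 1` steps from `x₀` tend both to `μ A` and, conditioning on the
  -- first `m` steps, to the integral of `Q(·, A)` against `μ`.
  have hinv : Q.Invariant μ := by
    have : IsProbabilityMeasure (μ.bind Q) :=
      inferInstanceAs (IsProbabilityMeasure (Q ∘ₘ μ))
    refine Measure.ext fun A hA => ?_
    rw [← ENNReal.toReal_eq_toReal_iff' (measure_ne_top _ _) (measure_ne_top _ _)]
    change (μ.bind Q).real A = μ.real A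
    rw [measureReal_bind μ hA]
    have h1 : ∀ m, |∫ x, (Q x).real A ∂((Q ^ m) x₀) - ∫ x, (Q x).real A ∂μ| ≤ 1 * δ m := fun m =>
      integral_le_integral_add_of_setwise zero_le_one (hμlim m) (measurable_measureReal Q hA)
        (fun _ => measureReal_nonneg) fun _ => measureReal_le_one
    have h2 : ∀ m, ∫ x, (Q x).real A ∂((Q ^ m) x₀) = ((Q ^ (m + 1)) x₀).real A := fun m => by
      rw [add_comm m 1, ← integral_kernel_indicator _ _ hA,
        integral_pow_add h hV hV0 hθ hθ1 hK (hindm A hA) (hind A), pow_one]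
      simp_rw [integral_kernel_indicator _ _ hA]
    have h3 : Tendsto (fun m => ((Q ^ (m + 1)) x₀).real A) atTop
        (𝓝 (∫ x, (Q x).real A ∂μ)) := by
      rw [tendsto_iff_dist_tendsto_zero]
      refine squeeze_zero (fun _ => dist_nonneg) (fun m => ?_) hδ0
      rw [← h2, Real.dist_eq]
      simpa using h1 m
    have h4 : Tendsto (fun m => ((Q ^ m) x₀).real A) atTop (𝓝 (μ.real A)) := by
      rw [tendsto_iff_dist_tendsto_zero]
      exact squeeze_zero (fun _ => dist_nonneg) (fun m => hμlim m A hA) hδ0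
    exact tendsto_nhds_unique h3 (h4.comp (tendsto_add_atTop_nat 1))
  -- Setwise convergence controls only bounded functions, so the moment bound is passed to `μ` for
  -- the truncations `min V N` and then by monotone convergence.
  have hVμ : Integrable V μ := by
    refine ⟨hV.aestronglyMeasurable, ?_⟩
    have hb : ∀ N : ℕ, ∫ x, min (V x) N ∂μ ≤ V x₀ + K' := fun N => by
      have hmm : Measurable fun x => min (V x) (N : ℝ) := hV.min measurable_const
      have h1 : ∀ m, ∫ x, min (V x) N ∂μ ≤ V x₀ + K' + N * δ m := fun m => by
        have h2 := (abs_le.1 (integral_le_integral_add_of_setwise (Nat.cast_nonneg N) (hμlim m)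
          hmm (fun x => le_min (hV0 x) (Nat.cast_nonneg N)) fun x => min_le_right _ _)).1
        have h3 : ∫ x, min (V x) N ∂((Q ^ m) x₀) ≤ ∫ x, V x ∂((Q ^ m) x₀) := by
          refine integral_mono ?_ ((hpow m).integrable x₀) fun x => min_le_left _ _
          refine ((hpow m).integrable x₀).mono' hmm.aestronglyMeasurable (ae_of_all _ fun x => ?_)
          rw [Real.norm_of_nonneg (le_min (hV0 x) (Nat.cast_nonneg N))]
          exact min_le_left _ _
        linarith [hVm m x₀]
      refine ge_of_tendsto' (f := fun m => V x₀ + K' + N * δ m) (x := atTop) ?_ h1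
      simpa using (hδ0.const_mul (N : ℝ)).const_add (V x₀ + K')
    have hsup : ∀ x, ‖V x‖ₑ = ⨆ N : ℕ, ENNReal.ofReal (min (V x) N) := fun x => by
      rw [Real.enorm_of_nonneg (hV0 x)]
      refine le_antisymm ?_ (iSup_le fun N => ENNReal.ofReal_le_ofReal (min_le_left _ _))
      obtain ⟨N, hN⟩ := exists_nat_ge (V x)
      exact le_iSup_of_le N (by rw [min_eq_left hN])
    rw [hasFiniteIntegral_iff_enorm]
    simp_rw [hsup]
    rw [lintegral_iSup (fun N => (hV.min measurable_const).ennreal_ofReal)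
      (fun N N' hN x => ENNReal.ofReal_le_ofReal (min_le_min_left _ (Nat.cast_le.2 hN)))]
    refine lt_of_le_of_lt (iSup_le fun N => ?_) (ENNReal.ofReal_lt_top (r := V x₀ + K'))
    rw [← ofReal_integral_eq_lintegral_ofReal _
      (ae_of_all _ fun x => le_min (hV0 x) (Nat.cast_nonneg N))]
    · exact ENNReal.ofReal_le_ofReal (hb N)
    · refine (integrable_const (N : ℝ)).mono' (hV.min measurable_const).aestronglyMeasurable
        (ae_of_all _ fun x => ?_)
      rw [Real.norm_of_nonneg (le_min (hV0 x) (Nat.cast_nonneg N))]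
      exact min_le_right _ _
  have hB0 : 0 ≤ ∫ x, V x ∂μ := integral_nonneg hV0
  have hest : ∀ (g : M → ℝ) (N : ℝ), Measurable g → 0 ≤ N → (∀ x, |g x| ≤ N * V x) →
      Integrable g μ ∧ ∀ (m : ℕ) (x : M), Integrable g ((Q ^ m) x) ∧
        |∫ y, g y ∂((Q ^ m) x) - ∫ y, g y ∂μ| ≤ C * (1 + ∫ x, V x ∂μ) * V x * N * γ ^ m := by
    intro g N hg hN hgN
    have hgμ : Integrable g μ := (hVμ.const_mul N).mono' hg.aestronglyMeasurable (ae_of_all _ hgN)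
    refine ⟨hgμ, fun m x => ⟨(hpow m).integrable_of_le hg hgN x, ?_⟩⟩
    have hQm : ((Q ^ m) ∘ₖ Kernel.const Unit μ) () = μ := by
      rw [← Measure.comp_eq_comp_const_apply]
      exact invariant_pow hinv m
    have e : ∫ y, g y ∂μ = ∫ y, ∫ z, g z ∂((Q ^ m) y) ∂μ := by
      have hg' : Integrable g (((Q ^ m) ∘ₖ Kernel.const Unit μ) ()) := by rwa [hQm]
      have := Kernel.integral_comp hg'
      rwa [hQm, Kernel.const_apply] at this
    have hi : Integrable (fun y => ∫ z, g z ∂((Q ^ m) y)) μ := by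
      refine (((hVμ.const_mul (θ ^ m)).add (integrable_const K')).const_mul N).mono'
        (stronglyMeasurable_integral (Q ^ m) hg).aestronglyMeasurable (ae_of_all _ fun y => ?_)
      exact (hpow m).abs_integral_le hg hN hgN y
    have e' : ∫ y, g y ∂((Q ^ m) x) = ∫ _, ∫ y, g y ∂((Q ^ m) x) ∂μ := by simp
    rw [e, e', ← integral_sub (integrable_const _) hi]
    refine abs_integral_le_integral_abs.trans ?_
    calc ∫ y, |∫ z, g z ∂((Q ^ m) x) - ∫ z, g z ∂((Q ^ m) y)| ∂μ
        ≤ ∫ y, C * N * γ ^ m * (V x + V y) ∂μ :=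
          integral_mono ((integrable_const _).sub hi).abs
            (((integrable_const _).add hVμ).const_mul _) fun y => hcon g N hg hN hgN m x y
      _ = C * N * γ ^ m * (V x + ∫ y, V y ∂μ) := by
          rw [integral_const_mul, integral_add (integrable_const _) hVμ]
          simp
      _ ≤ C * N * γ ^ m * (V x + (∫ y, V y ∂μ) * V x) := by
          gcongr
          exact le_mul_of_one_le_right hB0 (hV1 x)
      _ = _ := by ring
  refine ⟨μ, ⟨hμ, hinv⟩, fun ν hν hνinv => ?_, C * (1 + ∫ x, V x ∂μ), γ, by positivity, hγ0, hγ1,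
    fun g hg => ?_⟩
  -- For an invariant `ν`, `ν A` is the `ν`-mean of `Q ^ m(·, A)`. This tends pointwise to `μ A` and
  -- is bounded by `1`, so `V` need not be `ν`-integrable.
  · refine Measure.ext fun A hA => ?_
    rw [← ENNReal.toReal_eq_toReal_iff' (measure_ne_top _ _) (measure_ne_top _ _)]
    change ν.real A = μ.real A
    have h1 : ∀ m, ∫ x, ((Q ^ m) x).real A ∂ν = ν.real A := fun m => by
      rw [← measureReal_bind ν hA, (invariant_pow hνinv m).def]
    have h2 : Tendsto (fun m => ∫ x, ((Q ^ m) x).real A ∂ν) atTop (𝓝 (∫ _, μ.real A ∂ν)) := by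
      refine tendsto_integral_of_dominated_convergence (fun _ => 1)
        (fun m => (measurable_measureReal (Q ^ m) hA).aestronglyMeasurable) (integrable_const _)
        (fun m => ae_of_all _ fun x => ?_) (ae_of_all _ fun x => ?_)
      · rw [Real.norm_of_nonneg measureReal_nonneg]; exact measureReal_le_one
      · rw [tendsto_iff_dist_tendsto_zero]
        have hlim := (tendsto_pow_atTop_nhds_zero_of_lt_one hγ0.le hγ1).const_mul
          (C * (1 + ∫ x, V x ∂μ) * V x)
        rw [mul_zero] at hlim
        refine squeeze_zero (fun _ => dist_nonneg) (fun m => ?_) hlim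
        have := ((hest _ 1 (hindm A hA) zero_le_one (hind A)).2 m x).2
        rw [integral_kernel_indicator _ _ hA, integral_indicator hA] at this
        simpa [Real.dist_eq] using this
    simp_rw [h1] at h2
    simpa using h2
  · have hN0 : 0 ≤ weightedNorm V g :=
      Real.iSup_nonneg fun x => div_nonneg (abs_nonneg _) (hV0 x)
    refine hest g (weightedNorm V g) hg.1 hN0 fun x => ?_
    rw [← div_le_iff₀ (zero_lt_one.trans_le (hV1 x))]
    exact le_ciSup hg.2 x

end Harris

end HamiltonianShear

namespace HamiltonianShear

/-! ### Uniform local minorization by a submersion -/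

section Submersion

variable {E : Type*} [NormedAddCommGroup E] [NormedSpace ℝ E] [FiniteDimensional ℝ E]
  [MeasurableSpace E] [BorelSpace E]

/-- If the partial derivative of `F` in the second variable is onto at a point, then near that
point the images of Lebesgue measure under `F (e, ·)` dominate a common multiple of Lebesgue
measure. -/
theorem exists_uniform_volume_le (μ : Measure E) [μ.IsAddHaarMeasure] {F : E × E → E}
    (hFm : Measurable F) {e₀ t₀ : E} (hF : ContDiffAt ℝ 1 F (e₀, t₀))
    (hsurj : Function.Surjective
      ((fderiv ℝ F (e₀, t₀)).comp (ContinuousLinearMap.inr ℝ E E)))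
    {O : Set E} (hO : O ∈ 𝓝 t₀) :
    ∃ (c : ℝ) (N B : Set E), N ∈ 𝓝 e₀ ∧ B ∈ 𝓝 (F (e₀, t₀)) ∧ MeasurableSet B ∧
      ∀ e ∈ N, ∀ A ⊆ B, MeasurableSet A →
        μ A ≤ ENNReal.ofReal c * μ {t | t ∈ O ∧ F (e, t) ∈ A} := by
  let D : E × E → E →L[ℝ] E := fun z => (fderiv ℝ F z).comp (ContinuousLinearMap.inr ℝ E E)
  have hD : ContinuousAt (fun z => |(D z).det|) (e₀, t₀) := by
    have h1 : ContinuousAt (fderiv ℝ F) (e₀, t₀) :=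
      (hF.fderiv_right (m := 0) (by norm_num)).continuousAt
    have h2 : ContinuousAt D (e₀, t₀) := h1.clm_comp continuousAt_const
    exact (ContinuousLinearMap.continuous_det.continuousAt.comp h2).abs
  set c := |(D (e₀, t₀)).det| + 1 with hc
  have hW : ∀ᶠ z in 𝓝 (e₀, t₀), DifferentiableAt ℝ F z ∧ |(D z).det| < c := by
    refine ((hF.eventually (by simp)).mono fun z hz => hz.differentiableAt (by simp)).and ?_
    exact hD.eventually_lt continuousAt_const (by rw [hc]; linarith)
  rw [nhds_prod_eq, eventually_prod_iff] at hW
  obtain ⟨pN, hpN, pO, hpO, hW⟩ := hW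
  obtain ⟨O', hO'sub, hO'open, hO't⟩ := mem_nhds_iff.1 (inter_mem hO hpO)
  -- Keeping the parameter as a coordinate turns the surjective partial derivative into a surjective
  -- full one. Local openness of this map yields one `B` covered by the images for all nearby `e` at
  -- once.
  have hstrict : HasStrictFDerivAt (fun z : E × E => (z.1, F z))
      ((ContinuousLinearMap.fst ℝ E E).prod (fderiv ℝ F (e₀, t₀))) (e₀, t₀) :=
    hasStrictFDerivAt_fst.prodMk (hF.hasStrictFDerivAt (by simp))
  have hrange : ((ContinuousLinearMap.fst ℝ E E).prod (fderiv ℝ F (e₀, t₀))).range = ⊤ := by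
    rw [LinearMap.range_eq_top]
    rintro ⟨x, y⟩
    obtain ⟨t, ht⟩ := hsurj (y - fderiv ℝ F (e₀, t₀) (x, 0))
    refine ⟨(x, t), ?_⟩
    have : ((x, t) : E × E) = (x, 0) + (0, t) := by simp
    have ht' : fderiv ℝ F (e₀, t₀) (0, t) = y - fderiv ℝ F (e₀, t₀) (x, 0) := by simpa using ht
    change (x, fderiv ℝ F (e₀, t₀) (x, t)) = (x, y)
    rw [this, map_add, ht']
    simp
  have hmap := hstrict.map_nhds_eq_of_surj hrange
  have himg : (fun z : E × E => (z.1, F z)) '' ({e | pN e} ×ˢ O') ∈ 𝓝 (e₀, F (e₀, t₀)) := by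
    rw [← hmap]
    refine image_mem_map ?_
    exact prod_mem_nhds hpN (hO'open.mem_nhds hO't)
  obtain ⟨N, hN, B, hB, hNB⟩ := mem_nhds_prod_iff.1 himg
  obtain ⟨B', hB'sub, hB'open, hB'⟩ := mem_nhds_iff.1 hB
  refine ⟨c, N, B', hN, hB'open.mem_nhds hB', hB'open.measurableSet, fun e he A hA hAm => ?_⟩
  set S := {t | t ∈ O' ∧ F (e, t) ∈ A} with hS
  have hSm : MeasurableSet S :=
    hO'open.measurableSet.inter ((hFm.comp measurable_prodMk_left) hAm)
  -- `N` comes from the image neighbourhood; a preimage of any point of `A` has first coordinate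
  -- `e`, which places `e` in the domain of the estimates.
  have hpNe : A.Nonempty → pN e := fun ⟨z, hz⟩ => by
    obtain ⟨⟨e', t⟩, ⟨he', _⟩, h⟩ := hNB (mk_mem_prod he (hB'sub (hA hz)))
    simp only [Prod.mk.injEq] at h
    exact h.1 ▸ he'
  have hAsub : A ⊆ (fun t => F (e, t)) '' S := fun z hz => by
    obtain ⟨⟨e', t⟩, ⟨_, ht⟩, h⟩ := hNB (mk_mem_prod he (hB'sub (hA hz)))
    simp only [Prod.mk.injEq] at h
    obtain ⟨rfl, rfl⟩ := h
    exact ⟨t, ⟨ht, hz⟩, rfl⟩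
  have hderiv : ∀ t ∈ S, HasFDerivWithinAt (fun t => F (e, t)) (D (e, t)) S t := fun t ht => by
    have h1 := (hW (hpNe ⟨_, ht.2⟩) (hO'sub ht.1).2).1.hasFDerivAt
    exact (h1.comp t (hasFDerivAt_prodMk_right e t)).hasFDerivWithinAt
  -- Only the upper bound for the volume of an image is used, so injectivity in `t` is not needed.
  calc μ A ≤ μ ((fun t => F (e, t)) '' S) := measure_mono hAsub
    _ ≤ ∫⁻ t in S, ENNReal.ofReal |(D (e, t)).det| ∂μ :=
        addHaar_image_le_lintegral_abs_det_fderiv μ hSm hderiv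
    _ ≤ ∫⁻ _ in S, ENNReal.ofReal c ∂μ :=
        setLIntegral_mono measurable_const fun t ht =>
          ENNReal.ofReal_le_ofReal (hW (hpNe ⟨_, ht.2⟩) (hO'sub ht.1).2).2.le
    _ = ENNReal.ofReal c * μ S := by simp
    _ ≤ _ := by
        gcongr
        exact fun t ht => ⟨(hO'sub ht.1).1, ht.2⟩

end Submersion

/-! ### The shears in an affine chart of the projective bundle -/

theorem AnalyticFun.contDiff (f : AnalyticFun) : ContDiff ℝ 1 fun t : ℝ => f (t : Circ) :=
  contDiffOn_univ.1 (f.analytic'.contDiffOn uniqueDiffOn_univ)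

theorem AnalyticFun.contDiff_deriv (f : AnalyticFun) :
    ContDiff ℝ 1 fun t : ℝ => f.deriv (t : Circ) := by
  have h : (fun t : ℝ => f.deriv (t : Circ)) = _root_.deriv (fun t : ℝ => f (t : Circ)) :=
    funext fun x => f.deriv_coe x
  rw [h]
  exact contDiffOn_univ.1 (f.analytic'.deriv.contDiffOn uniqueDiffOn_univ)

variable (f₁ f₂ : AnalyticFun)

/-- The lift of `pShear₁ τ` to the chart `(q, p, s) ↦ (q, p, [s : 1])`. -/
noncomputable def chartShear₁ (τ : ℝ) (x : ℝ × ℝ × ℝ) : ℝ × ℝ × ℝ :=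
  (x.1 + τ * f₁ (x.2.1 : Circ), x.2.1, x.2.2 + τ * f₁.deriv (x.2.1 : Circ))

/-- The lift of `pShear₂ τ` to the chart `(q, p, s) ↦ (q, p, [s : 1])`, valid as long as
`1 + τ f₂'(q) s` does not vanish. -/
noncomputable def chartShear₂ (τ : ℝ) (x : ℝ × ℝ × ℝ) : ℝ × ℝ × ℝ :=
  (x.1, x.2.1 + τ * f₂ (x.1 : Circ), x.2.2 / (1 + τ * f₂.deriv (x.1 : Circ) * x.2.2))

/-- The chart expression of `pShear₂ c ∘ pShear₁ b ∘ pShear₂ a` at the point `z.1`, where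
`z.2 = (a, b, c)`. -/
noncomputable def chartWord (z : (ℝ × ℝ × ℝ) × (ℝ × ℝ × ℝ)) : ℝ × ℝ × ℝ :=
  chartShear₂ f₂ z.2.2.2 (chartShear₁ f₁ z.2.2.1 (chartShear₂ f₂ z.2.1 z.1))

theorem measurable_chartShear₁ :
    Measurable fun z : ℝ × (ℝ × ℝ × ℝ) => chartShear₁ f₁ z.1 z.2 := by
  have h1 := f₁.contDiff.continuous.measurable
  have h2 := f₁.contDiff_deriv.continuous.measurable
  unfold chartShear₁
  fun_prop

theorem measurable_chartShear₂ :
    Measurable fun z : ℝ × (ℝ × ℝ × ℝ) => chartShear₂ f₂ z.1 z.2 := by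
  have h1 := f₂.contDiff.continuous.measurable
  have h2 := f₂.contDiff_deriv.continuous.measurable
  unfold chartShear₂
  fun_prop

theorem measurable_chartWord : Measurable (chartWord f₁ f₂) := by
  have h1 : Measurable fun z : (ℝ × ℝ × ℝ) × (ℝ × ℝ × ℝ) => chartShear₂ f₂ z.2.1 z.1 :=
    (measurable_chartShear₂ f₂).comp (f := fun z : (ℝ × ℝ × ℝ) × (ℝ × ℝ × ℝ) => (z.2.1, z.1))
      (by fun_prop)
  have h2 : Measurable fun z : (ℝ × ℝ × ℝ) × (ℝ × ℝ × ℝ) =>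
      chartShear₁ f₁ z.2.2.1 (chartShear₂ f₂ z.2.1 z.1) :=
    (measurable_chartShear₁ f₁).comp
      ((by fun_prop : Measurable fun z : (ℝ × ℝ × ℝ) × (ℝ × ℝ × ℝ) => z.2.2.1).prodMk h1)
  exact (measurable_chartShear₂ f₂).comp
    ((by fun_prop : Measurable fun z : (ℝ × ℝ × ℝ) × (ℝ × ℝ × ℝ) => z.2.2.2).prodMk h2)

theorem contDiff_chartShear₁ :
    ContDiff ℝ 1 fun z : ℝ × (ℝ × ℝ × ℝ) => chartShear₁ f₁ z.1 z.2 := by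
  have h1 : ContDiff ℝ 1 fun z : ℝ × (ℝ × ℝ × ℝ) => f₁ (z.2.2.1 : Circ) :=
    f₁.contDiff.comp (by fun_prop : ContDiff ℝ 1 fun z : ℝ × (ℝ × ℝ × ℝ) => z.2.2.1)
  have h2 : ContDiff ℝ 1 fun z : ℝ × (ℝ × ℝ × ℝ) => f₁.deriv (z.2.2.1 : Circ) :=
    f₁.contDiff_deriv.comp (by fun_prop : ContDiff ℝ 1 fun z : ℝ × (ℝ × ℝ × ℝ) => z.2.2.1)
  unfold chartShear₁
  fun_prop

theorem contDiffAt_chartShear₂ {z : ℝ × (ℝ × ℝ × ℝ)}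
    (hz : 1 + z.1 * f₂.deriv (z.2.1 : Circ) * z.2.2.2 ≠ 0) :
    ContDiffAt ℝ 1 (fun z : ℝ × (ℝ × ℝ × ℝ) => chartShear₂ f₂ z.1 z.2) z := by
  have h1 : ContDiff ℝ 1 fun z : ℝ × (ℝ × ℝ × ℝ) => f₂ (z.2.1 : Circ) :=
    f₂.contDiff.comp (by fun_prop : ContDiff ℝ 1 fun z : ℝ × (ℝ × ℝ × ℝ) => z.2.1)
  have h2 : ContDiff ℝ 1 fun z : ℝ × (ℝ × ℝ × ℝ) => f₂.deriv (z.2.1 : Circ) :=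
    f₂.contDiff_deriv.comp (by fun_prop : ContDiff ℝ 1 fun z : ℝ × (ℝ × ℝ × ℝ) => z.2.1)
  have h3 : ContDiff ℝ 1 fun z : ℝ × (ℝ × ℝ × ℝ) =>
    1 + z.1 * f₂.deriv (z.2.1 : Circ) * z.2.2.2 := by fun_prop
  have h4 : ContDiffAt ℝ 1 (fun z : ℝ × (ℝ × ℝ × ℝ) =>
      z.2.2.2 / (1 + z.1 * f₂.deriv (z.2.1 : Circ) * z.2.2.2)) z :=
    (by fun_prop : ContDiffAt ℝ 1 (fun z : ℝ × (ℝ × ℝ × ℝ) => z.2.2.2) z).div h3.contDiffAt hz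
  unfold chartShear₂
  fun_prop

/-- At outer times zero both denominators equal `1`. -/
theorem contDiffAt_chartWord (x : ℝ × ℝ × ℝ) (b : ℝ) :
    ContDiffAt ℝ 1 (chartWord f₁ f₂) (x, (0, b, 0)) := by
  have h1 : ContDiffAt ℝ 1 (fun z : (ℝ × ℝ × ℝ) × (ℝ × ℝ × ℝ) => chartShear₂ f₂ z.2.1 z.1)
      (x, (0, b, 0)) :=
    (contDiffAt_chartShear₂ f₂ (z := (0, x)) (by simp)).comp (x, (0, b, 0))
      (f := fun z : (ℝ × ℝ × ℝ) × (ℝ × ℝ × ℝ) => (z.2.1, z.1)) (by fun_prop)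
  have h2 : ContDiffAt ℝ 1 (fun z : (ℝ × ℝ × ℝ) × (ℝ × ℝ × ℝ) =>
      chartShear₁ f₁ z.2.2.1 (chartShear₂ f₂ z.2.1 z.1)) (x, (0, b, 0)) :=
    (contDiff_chartShear₁ f₁).contDiffAt.comp (x, (0, b, 0))
      ((by fun_prop : ContDiffAt ℝ 1 (fun z : (ℝ × ℝ × ℝ) × (ℝ × ℝ × ℝ) => z.2.2.1)
        (x, (0, b, 0))).prodMk h1)
  exact (contDiffAt_chartShear₂ f₂ (by simp)).comp (x, (0, b, 0))
      ((by fun_prop : ContDiffAt ℝ 1 (fun z : (ℝ × ℝ × ℝ) × (ℝ × ℝ × ℝ) => z.2.2.2)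
        (x, (0, b, 0))).prodMk h2)

/-- Since `b` is a period of the horizontal motion, both vertical shears see the same `f₂ (q)` and
`f₂'(q)`. The three columns of the Jacobian are then explicit, and `hdet` is its determinant up to a
nonzero factor. -/
theorem surjective_fderiv_chartWord {q p b : ℝ} (hb : b ≠ 0)
    (hper : ((b * f₁ (p : Circ) : ℝ) : Circ) = 0) (h1 : f₁ (p : Circ) ≠ 0)
    (h2 : f₂ (q : Circ) ≠ 0)
    (hdet : f₁ (p : Circ) * deriv (fun t : ℝ => f₁.deriv (t : Circ)) p * f₂ (q : Circ)
      - f₁.deriv (p : Circ) ^ 2 * f₂ (q : Circ)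
      + b * (f₁ (p : Circ) * f₁.deriv (p : Circ) ^ 2 * f₂.deriv (q : Circ)) ≠ 0) :
    Function.Surjective ((fderiv ℝ (chartWord f₁ f₂) ((q, p, 0), (0, b, 0))).comp
      (ContinuousLinearMap.inr ℝ (ℝ × ℝ × ℝ) (ℝ × ℝ × ℝ))) := by
  set L := (fderiv ℝ (chartWord f₁ f₂) ((q, p, 0), (0, b, 0))).comp
      (ContinuousLinearMap.inr ℝ (ℝ × ℝ × ℝ) (ℝ × ℝ × ℝ)) with hL
  have hLd : HasFDerivAt (fun t => chartWord f₁ f₂ ((q, p, 0), t)) L (0, b, 0) :=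
    (((contDiffAt_chartWord f₁ f₂ (q, p, 0) b).differentiableAt (by simp)).hasFDerivAt).comp
      (0, b, 0) (hasFDerivAt_prodMk_right (𝕜 := ℝ) (q, p, (0 : ℝ)) (0, b, (0 : ℝ)))
  set f₁'' := deriv (fun t : ℝ => f₁.deriv (t : Circ)) p with hf₁''
  have hd2 : HasDerivAt (fun t : ℝ => f₁.deriv (t : Circ)) f₁'' p :=
    (f₁.contDiff_deriv.differentiable (by simp) p).hasDerivAt
  have hq1 : ((q + b * f₁ (p : Circ) : ℝ) : Circ) = q := by
    rw [AddCircle.coe_add, hper, add_zero]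
  have hlin : HasDerivAt (fun α : ℝ => p + α * f₂ (q : Circ)) (f₂ (q : Circ)) 0 := by
    simpa using ((hasDerivAt_id (0 : ℝ)).mul_const (f₂ (q : Circ))).const_add p
  -- The slope `0` (vertical line) is fixed by the first vertical shear, so `a` acts only through
  -- `p`.
  have ea : L (1, 0, 0) = (b * (f₁.deriv (p : Circ) * f₂ (q : Circ)), f₂ (q : Circ),
      b * (f₁'' * f₂ (q : Circ))) := by
    have hcurve : HasDerivAt (fun α : ℝ => ((α, b, 0) : ℝ × ℝ × ℝ)) (1, 0, 0) 0 :=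
      (hasDerivAt_id (0 : ℝ)).prodMk ((hasDerivAt_const _ _).prodMk (hasDerivAt_const _ _))
    have hA := hLd.comp_hasDerivAt (0 : ℝ) hcurve
    refine hA.unique ?_
    have e : ((fun t => chartWord f₁ f₂ ((q, p, 0), t)) ∘ fun α : ℝ => ((α, b, 0) : ℝ × ℝ × ℝ)) =
        fun α : ℝ => (q + b * f₁ ((p + α * f₂ (q : Circ) : ℝ) : Circ), p + α * f₂ (q : Circ),
          b * f₁.deriv ((p + α * f₂ (q : Circ) : ℝ) : Circ)) := by
      funext α
      simp [chartWord, chartShear₁, chartShear₂]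
    rw [e]
    have k1 : HasDerivAt (fun α : ℝ => f₁ ((p + α * f₂ (q : Circ) : ℝ) : Circ))
        (f₁.deriv (p : Circ) * f₂ (q : Circ)) 0 :=
      HasDerivAt.comp (h₂ := fun t : ℝ => f₁ (t : Circ)) (0 : ℝ)
        (by simpa using f₁.hasDerivAt p) hlin
    have k2 : HasDerivAt (fun α : ℝ => f₁.deriv ((p + α * f₂ (q : Circ) : ℝ) : Circ))
        (f₁'' * f₂ (q : Circ)) 0 :=
      HasDerivAt.comp (h₂ := fun t : ℝ => f₁.deriv (t : Circ)) (0 : ℝ) (by simpa using hd2) hlin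
    exact ((k1.const_mul b).const_add q).prodMk (hlin.prodMk (k2.const_mul b))
  have eb : L (0, 1, 0) = (f₁ (p : Circ), 0, f₁.deriv (p : Circ)) := by
    have hcurve : HasDerivAt (fun β : ℝ => ((0, β, 0) : ℝ × ℝ × ℝ)) (0, 1, 0) b :=
      (hasDerivAt_const _ _).prodMk ((hasDerivAt_id b).prodMk (hasDerivAt_const _ _))
    have hA := hLd.comp_hasDerivAt b hcurve
    refine hA.unique ?_
    have e : ((fun t => chartWord f₁ f₂ ((q, p, 0), t)) ∘ fun β : ℝ => ((0, β, 0) : ℝ × ℝ × ℝ)) =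
        fun β : ℝ => (q + β * f₁ (p : Circ), p, β * f₁.deriv (p : Circ)) := by
      funext β
      simp [chartWord, chartShear₁, chartShear₂]
    rw [e]
    have k1 : HasDerivAt (fun β : ℝ => q + β * f₁ (p : Circ)) (f₁ (p : Circ)) b := by
      simpa using ((hasDerivAt_id b).mul_const (f₁ (p : Circ))).const_add q
    have k2 : HasDerivAt (fun β : ℝ => β * f₁.deriv (p : Circ)) (f₁.deriv (p : Circ)) b := by
      simpa using (hasDerivAt_id b).mul_const (f₁.deriv (p : Circ))
    exact k1.prodMk ((hasDerivAt_const _ _).prodMk k2)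
  have ec : L (0, 0, 1) = (0, f₂ (q : Circ),
      -((b * f₁.deriv (p : Circ)) ^ 2 * f₂.deriv (q : Circ))) := by
    have hcurve : HasDerivAt (fun γ : ℝ => ((0, b, γ) : ℝ × ℝ × ℝ)) (0, 0, 1) 0 :=
      (hasDerivAt_const _ _).prodMk ((hasDerivAt_const _ _).prodMk (hasDerivAt_id _))
    have hA := hLd.comp_hasDerivAt (0 : ℝ) hcurve
    refine hA.unique ?_
    set s := b * f₁.deriv (p : Circ) with hs
    have e : ((fun t => chartWord f₁ f₂ ((q, p, 0), t)) ∘ fun γ : ℝ => ((0, b, γ) : ℝ × ℝ × ℝ)) =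
        fun γ : ℝ => (q + b * f₁ (p : Circ), p + γ * f₂ (q : Circ),
          s / (1 + γ * f₂.deriv (q : Circ) * s)) := by
      funext γ
      have := hq1
      simp only [Function.comp, chartWord, chartShear₁, chartShear₂, zero_mul, add_zero, zero_div,
        zero_add, hq1, hs]
    rw [e]
    have k : HasDerivAt (fun γ : ℝ => 1 + γ * f₂.deriv (q : Circ) * s)
        (f₂.deriv (q : Circ) * s) 0 := by
      simpa using (((hasDerivAt_id (0 : ℝ)).mul_const (f₂.deriv (q : Circ))).mul_const s).const_add 1
    have k2 : HasDerivAt (fun γ : ℝ => s / (1 + γ * f₂.deriv (q : Circ) * s))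
        (-(s ^ 2 * f₂.deriv (q : Circ))) 0 := by
      have := (hasDerivAt_const (0 : ℝ) s).div k (by simp)
      refine this.congr_deriv ?_
      simp only [zero_mul, add_zero, zero_sub, one_pow, div_one]
      ring
    have k1 : HasDerivAt (fun γ : ℝ => p + γ * f₂ (q : Circ)) (f₂ (q : Circ)) 0 := by
      simpa using ((hasDerivAt_id (0 : ℝ)).mul_const (f₂ (q : Circ))).const_add p
    exact (hasDerivAt_const _ _).prodMk (k1.prodMk k2)
  have hinj : Function.Injective (L : (ℝ × ℝ × ℝ) →ₗ[ℝ] (ℝ × ℝ × ℝ)) := by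
    rw [injective_iff_map_eq_zero]
    rintro ⟨α, β, γ⟩ h0
    have hdecomp : ((α, β, γ) : ℝ × ℝ × ℝ) =
        α • ((1, 0, 0) : ℝ × ℝ × ℝ) + β • ((0, 1, 0) : ℝ × ℝ × ℝ) +
          γ • ((0, 0, 1) : ℝ × ℝ × ℝ) := by simp
    have h0' : L (α, β, γ) = 0 := h0
    rw [hdecomp, map_add, map_add, map_smul, map_smul, map_smul, ea, eb, ec] at h0'
    simp only [Prod.smul_mk, smul_eq_mul, Prod.mk_add_mk, Prod.mk_eq_zero, mul_zero, add_zero] at h0'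
    obtain ⟨x1, x2, x3⟩ := h0'
    have hγ : γ = -α := by
      have : (α + γ) * f₂ (q : Circ) = 0 := by linarith
      have := (mul_eq_zero.1 this).resolve_right h2
      linarith
    have hα : α = 0 := by
      -- Eliminating `γ = -α` and then `β` from the first and third equations leaves the
      -- determinant.
      have : α * b * (f₁ (p : Circ) * f₁'' * f₂ (q : Circ)
          - f₁.deriv (p : Circ) ^ 2 * f₂ (q : Circ)
          + b * (f₁ (p : Circ) * f₁.deriv (p : Circ) ^ 2 * f₂.deriv (q : Circ))) = 0 := by
        rw [hγ] at x3
        linear_combination f₁ (p : Circ) * x3 - f₁.deriv (p : Circ) * x1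
      rcases mul_eq_zero.1 this with h | h
      · exact (mul_eq_zero.1 h).resolve_right hb
      · exact absurd h hdet
    have hβ : β = 0 := by
      rw [hα] at x1
      have : β * f₁ (p : Circ) = 0 := by linarith
      exact (mul_eq_zero.1 this).resolve_right h1
    simp [hγ, hα, hβ]
  exact LinearMap.injective_iff_surjective.1 hinj

/-- A nonconstant affine function of `b` cannot vanish at both the first period and its double. -/
theorem exists_period_det_ne_zero {p : ℝ} (h1 : f₁ (p : Circ) ≠ 0) (X : ℝ) {Y : ℝ} (hY : Y ≠ 0) :
    ∃ b : ℝ, 0 < b ∧ ((b * f₁ (p : Circ) : ℝ) : Circ) = 0 ∧ X + b * Y ≠ 0 := by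
  set b := 2 * Real.pi / |f₁ (p : Circ)| with hb
  have hb0 : 0 < b := by positivity
  have hper : ((b * f₁ (p : Circ) : ℝ) : Circ) = 0 := by
    rcases lt_or_gt_of_ne h1 with h | h
    · have : b * f₁ (p : Circ) = -(2 * Real.pi) := by
        rw [hb, abs_of_neg h]; field_simp
      rw [this, AddCircle.coe_neg, AddCircle.coe_period, neg_zero]
    · have : b * f₁ (p : Circ) = 2 * Real.pi := by
        rw [hb, abs_of_pos h]; field_simp
      rw [this, AddCircle.coe_period]
  by_cases h : X + b * Y = 0
  · refine ⟨2 * b, by positivity, ?_, fun h' => ?_⟩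
    · have : 2 * b * f₁ (p : Circ) = b * f₁ (p : Circ) + b * f₁ (p : Circ) := by ring
      rw [this, AddCircle.coe_add, hper, add_zero]
    · have : b * Y = 0 := by linarith
      exact (mul_ne_zero hb0.ne' hY) this
  · exact ⟨b, hb0, hper, h⟩

end HamiltonianShear

namespace HamiltonianShear

/-! ### The affine chart of the projective line -/

/-- The line spanned by `(s, 1)`. -/
noncomputable def lineOf (s : ℝ) : Line := Projectivization.mk ℝ (s, 1) (by simp)

theorem continuous_lineOf : Continuous lineOf :=
  isOpenQuotientMap_mk.continuous.comp
    (Continuous.subtype_mk (f := fun s : ℝ => ((s, 1) : ℝ × ℝ)) (p := fun v => v ≠ 0)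
      (by fun_prop) (by simp))

theorem mk_eq_lineOf {v : ℝ × ℝ} (hv : v ≠ 0) (h2 : v.2 ≠ 0) :
    Projectivization.mk ℝ v hv = lineOf (v.1 / v.2) := by
  rw [lineOf, Projectivization.mk_eq_mk_iff']
  refine ⟨v.2, ?_⟩
  ext
  · simp [mul_div_cancel₀ _ h2]
  · simp

theorem image_lineOf_mem_nhds {s : ℝ} {N : Set ℝ} (hN : N ∈ 𝓝 s) :
    lineOf '' N ∈ 𝓝 (lineOf s) := by
  have h1 : {v : {v : ℝ × ℝ // v ≠ 0} | v.1.2 ≠ 0 ∧ v.1.1 / v.1.2 ∈ N} ∈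
      𝓝 (⟨(s, 1), by simp⟩ : {v : ℝ × ℝ // v ≠ 0}) := by
    have c1 : ContinuousAt (fun v : {v : ℝ × ℝ // v ≠ 0} => v.1.2) ⟨(s, 1), by simp⟩ := by
      fun_prop
    have c2 : ContinuousAt (fun v : {v : ℝ × ℝ // v ≠ 0} => v.1.1 / v.1.2) ⟨(s, 1), by simp⟩ :=
      ContinuousAt.div (by fun_prop) c1 (by simp)
    exact (c1.eventually_ne (by simp)).and (c2.eventually (by simpa using hN))
  refine mem_of_superset (isOpenQuotientMap_mk.isOpenMap.image_mem_nhds h1) ?_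
  rintro _ ⟨v, ⟨hv2, hvN⟩, rfl⟩
  exact ⟨_, hvN, (mk_eq_lineOf v.2 hv2).symm⟩

theorem lineMap_upper_lineOf (a s : ℝ) : lineMap (upper a) (lineOf s) = lineOf (s + a) := by
  change Projectivization.mk ℝ ((s + a * 1, 1) : ℝ × ℝ) _ = _
  simp only [mul_one]
  rfl

theorem lineMap_lower_lineOf {a s : ℝ} (h : 1 + a * s ≠ 0) :
    lineMap (lower a) (lineOf s) = lineOf (s / (1 + a * s)) := by
  change Projectivization.mk ℝ ((s, 1 + a * s) : ℝ × ℝ) _ = _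
  exact mk_eq_lineOf _ h

/-- The line space is a continuous image of the unit sphere of `ℝ × ℝ`. -/
instance : CompactSpace Line := by
  have hs : IsCompact (Metric.sphere (0 : ℝ × ℝ) 1) := isCompact_sphere _ _
  have : CompactSpace (Metric.sphere (0 : ℝ × ℝ) 1) := isCompact_iff_compactSpace.1 hs
  have hne : ∀ v : Metric.sphere (0 : ℝ × ℝ) 1, (v : ℝ × ℝ) ≠ 0 := fun v h => by
    have := v.2
    rw [h] at this
    simp at this
  have hc : Continuous fun v : Metric.sphere (0 : ℝ × ℝ) 1 =>
      (Projectivization.mk' ℝ ⟨v.1, hne v⟩ : Line) :=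
    isOpenQuotientMap_mk.continuous.comp (continuous_subtype_val.subtype_mk hne)
  refine Function.Surjective.compactSpace (f := fun v : Metric.sphere (0 : ℝ × ℝ) 1 =>
      (Projectivization.mk' ℝ ⟨v.1, hne v⟩ : Line)) hc (fun l => ?_)
  induction l using Projectivization.ind with
  | h v hv =>
    have hn : ‖v‖ ≠ 0 := norm_ne_zero_iff.2 hv
    refine ⟨⟨‖v‖⁻¹ • v, ?_⟩, ?_⟩
    · simp [norm_smul, hn]
    · exact (Projectivization.mk_eq_mk_iff' ℝ _ _ _ _).2 ⟨‖v‖⁻¹, rfl⟩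

/-! ### Semigroup property of the shears -/

variable {f₁ f₂ : AnalyticFun}

theorem lineMap_comp (A B : (ℝ × ℝ) ≃ₗ[ℝ] (ℝ × ℝ)) (l : Line) :
    lineMap A (lineMap B l) = lineMap (B.trans A) l := by
  induction l using Projectivization.ind with
  | h v hv => rfl

theorem lineMap_refl (l : Line) : lineMap (LinearEquiv.refl ℝ (ℝ × ℝ)) l = l := by
  induction l using Projectivization.ind with
  | h v hv => rfl

theorem upper_trans (a b : ℝ) : (upper b).trans (upper a) = upper (a + b) := by
  refine LinearEquiv.ext fun x => Prod.ext ?_ rfl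
  simp only [upper, LinearEquiv.trans_apply, LinearEquiv.coe_mk, LinearMap.coe_mk, AddHom.coe_mk]
  ring

theorem lower_trans (a b : ℝ) : (lower b).trans (lower a) = lower (a + b) := by
  refine LinearEquiv.ext fun x => Prod.ext rfl ?_
  simp only [lower, LinearEquiv.trans_apply, LinearEquiv.coe_mk, LinearMap.coe_mk, AddHom.coe_mk]
  ring

theorem upper_zero : upper 0 = LinearEquiv.refl ℝ (ℝ × ℝ) := by
  ext x <;> simp [upper]

theorem lower_zero : lower 0 = LinearEquiv.refl ℝ (ℝ × ℝ) := by
  ext x <;> simp [lower]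

/-- The speed and its derivative depend only on the coordinate that the shear fixes. The flow
property lets long times be cut into pieces and times be translated. -/
theorem pShear₁_add (s t : ℝ) (y : PBundle f₁ f₂) :
    pShear₁ s (pShear₁ t y) = pShear₁ (s + t) y := by
  refine Prod.ext (Subtype.ext (Prod.ext ?_ rfl)) ?_
  · simp only [pShear₁, shear₁, add_mul, AddCircle.coe_add]
    abel
  · change lineMap (upper (s * f₁.deriv y.1.1.2)) (lineMap (upper (t * f₁.deriv y.1.1.2)) y.2) =
      lineMap (upper ((s + t) * f₁.deriv y.1.1.2)) y.2
    rw [lineMap_comp, upper_trans, add_mul]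

theorem pShear₂_add (s t : ℝ) (y : PBundle f₁ f₂) :
    pShear₂ s (pShear₂ t y) = pShear₂ (s + t) y := by
  refine Prod.ext (Subtype.ext (Prod.ext rfl ?_)) ?_
  · simp only [pShear₂, shear₂, add_mul, AddCircle.coe_add]
    abel
  · change lineMap (lower (s * f₂.deriv y.1.1.1)) (lineMap (lower (t * f₂.deriv y.1.1.1)) y.2) =
      lineMap (lower ((s + t) * f₂.deriv y.1.1.1)) y.2
    rw [lineMap_comp, lower_trans, add_mul]

theorem pShear₁_zero (y : PBundle f₁ f₂) : pShear₁ 0 y = y := by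
  refine Prod.ext (Subtype.ext (Prod.ext ?_ rfl)) ?_
  · simp [pShear₁, shear₁]
  · change lineMap (upper (0 * f₁.deriv y.1.1.2)) y.2 = y.2
    rw [zero_mul, upper_zero, lineMap_refl]

theorem pShear₂_zero (y : PBundle f₁ f₂) : pShear₂ 0 y = y := by
  refine Prod.ext (Subtype.ext (Prod.ext rfl ?_)) ?_
  · simp [pShear₂, shear₂]
  · change lineMap (lower (0 * f₂.deriv y.1.1.1)) y.2 = y.2
    rw [zero_mul, lower_zero, lineMap_refl]

/-! ### The affine chart of the projective bundle -/

variable (f₁ f₂) in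
/-- The domain of the affine chart: points of the plane lying over the phase space, with the
affine coordinate of a direction. -/
abbrev ChartDom : Type := {x : ℝ × ℝ × ℝ // ¬ (f₁ (x.2.1 : Circ) = 0 ∧ f₂ (x.1 : Circ) = 0)}

/-- The point of the projective bundle with chart coordinates `(q, p, s)`. -/
noncomputable def chartPt (x : ChartDom f₁ f₂) : PBundle f₁ f₂ :=
  (⟨((x.1.1 : Circ), (x.1.2.1 : Circ)), x.2⟩, lineOf x.1.2.2)

theorem continuous_chartPt : Continuous (chartPt : ChartDom f₁ f₂ → PBundle f₁ f₂) := by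
  have hc := AddCircle.continuous_mk' (2 * Real.pi)
  refine Continuous.prodMk (Continuous.subtype_mk ?_ _) (continuous_lineOf.comp (by fun_prop))
  exact (hc.comp (by fun_prop)).prodMk (hc.comp (by fun_prop))

theorem isOpen_chartDom :
    IsOpen {x : ℝ × ℝ × ℝ | ¬ (f₁ (x.2.1 : Circ) = 0 ∧ f₂ (x.1 : Circ) = 0)} := by
  have h1 : Continuous fun x : ℝ × ℝ × ℝ => f₁ (x.2.1 : Circ) :=
    f₁.contDiff.continuous.comp (by fun_prop : Continuous fun x : ℝ × ℝ × ℝ => x.2.1)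
  have h2 : Continuous fun x : ℝ × ℝ × ℝ => f₂ (x.1 : Circ) :=
    f₂.contDiff.continuous.comp (by fun_prop : Continuous fun x : ℝ × ℝ × ℝ => x.1)
  exact ((isClosed_singleton.preimage h1).inter (isClosed_singleton.preimage h2)).isOpen_compl

/-- Each of the three coordinates of the chart is an open map, so estimates in the chart hold on
neighbourhoods in the bundle. -/
theorem eventually_exists_chartPt_eq (x : ChartDom f₁ f₂) {N : Set (ℝ × ℝ × ℝ)} (hN : N ∈ 𝓝 x.1) :
    ∀ᶠ y in 𝓝 (chartPt x), ∃ x' : ChartDom f₁ f₂, x'.1 ∈ N ∧ chartPt x' = y := by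
  obtain ⟨⟨q, p, s⟩, hx⟩ := x
  obtain ⟨N₁, h₁, N', h', hN'⟩ := mem_nhds_prod_iff.1 hN
  obtain ⟨N₂, h₂, N₃, h₃, hN''⟩ := mem_nhds_prod_iff.1 h'
  have ho : IsOpenMap ((↑) : ℝ → Circ) := QuotientAddGroup.isOpenMap_coe
  have c1 : Continuous fun y : PBundle f₁ f₂ => y.1.1.1 := by fun_prop
  have c2 : Continuous fun y : PBundle f₁ f₂ => y.1.1.2 := by fun_prop
  have c3 : Continuous fun y : PBundle f₁ f₂ => y.2 := by fun_prop
  filter_upwards [c1.continuousAt.preimage_mem_nhds (ho.image_mem_nhds h₁),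
    c2.continuousAt.preimage_mem_nhds (ho.image_mem_nhds h₂),
    c3.continuousAt.preimage_mem_nhds (image_lineOf_mem_nhds h₃)]
  rintro ⟨⟨⟨yq, yp⟩, hy⟩, l⟩ ⟨q', hq', e1⟩ ⟨p', hp', e2⟩ ⟨s', hs', e3⟩
  simp only at e1 e2 e3
  subst e1 e2 e3
  exact ⟨⟨(q', p', s'), hy⟩, hN' ⟨hq', hN'' ⟨hp', hs'⟩⟩, rfl⟩

theorem pShear₁_chartPt (τ : ℝ) (x : ChartDom f₁ f₂) :
    ∃ h, pShear₁ τ (chartPt x) = chartPt ⟨chartShear₁ f₁ τ x.1, h⟩ := by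
  refine ⟨by simpa [chartShear₁, shear₁, chartPt] using (shear₁ τ (chartPt x).1).2, ?_⟩
  refine Prod.ext (Subtype.ext (Prod.ext ?_ rfl)) ?_
  · simp [pShear₁, shear₁, chartPt, chartShear₁]
  · exact lineMap_upper_lineOf _ _

theorem pShear₂_chartPt {τ : ℝ} {x : ChartDom f₁ f₂}
    (hx : 1 + τ * f₂.deriv (x.1.1 : Circ) * x.1.2.2 ≠ 0) :
    ∃ h, pShear₂ τ (chartPt x) = chartPt ⟨chartShear₂ f₂ τ x.1, h⟩ := by
  refine ⟨by simpa [chartShear₂, shear₂, chartPt] using (shear₂ τ (chartPt x).1).2, ?_⟩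
  refine Prod.ext (Subtype.ext (Prod.ext rfl ?_)) ?_
  · simp [pShear₂, shear₂, chartPt, chartShear₂]
  · exact lineMap_lower_lineOf hx

/-- The composition of three shears, with times `t = (a, b, c)`. -/
noncomputable def pWord (t : ℝ × ℝ × ℝ) (y : PBundle f₁ f₂) : PBundle f₁ f₂ :=
  pShear₂ t.2.2 (pShear₁ t.2.1 (pShear₂ t.1 y))

theorem continuous_pWord :
    Continuous fun z : (ℝ × ℝ × ℝ) × PBundle f₁ f₂ => pWord z.1 z.2 := by
  have h1 : Continuous fun z : (ℝ × ℝ × ℝ) × PBundle f₁ f₂ => pShear₂ z.1.1 z.2 :=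
    continuous_pShear₂.comp (f := fun z : (ℝ × ℝ × ℝ) × PBundle f₁ f₂ => (z.1.1, z.2))
      (by fun_prop)
  have h2 : Continuous fun z : (ℝ × ℝ × ℝ) × PBundle f₁ f₂ =>
      pShear₁ z.1.2.1 (pShear₂ z.1.1 z.2) :=
    continuous_pShear₁.comp ((by fun_prop :
      Continuous fun z : (ℝ × ℝ × ℝ) × PBundle f₁ f₂ => z.1.2.1).prodMk h1)
  exact continuous_pShear₂.comp ((by fun_prop :
      Continuous fun z : (ℝ × ℝ × ℝ) × PBundle f₁ f₂ => z.1.2.2).prodMk h2)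

/-- The denominators of the chart formula are `1` at the base point, hence nonzero nearby, and the
lines never leave the affine chart. -/
theorem eventually_pWord_chartPt (x₀ : ChartDom f₁ f₂) (b : ℝ) :
    ∀ᶠ z in 𝓝 ((x₀.1, (0, b, 0)) : (ℝ × ℝ × ℝ) × (ℝ × ℝ × ℝ)),
      ∀ hz, ∃ h, pWord z.2 (chartPt ⟨z.1, hz⟩ : PBundle f₁ f₂) =
        chartPt ⟨chartWord f₁ f₂ z, h⟩ := by
  have c1 : ContinuousAt (fun z : (ℝ × ℝ × ℝ) × (ℝ × ℝ × ℝ) => chartShear₂ f₂ z.2.1 z.1)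
      (x₀.1, (0, b, 0)) :=
    (contDiffAt_chartShear₂ f₂ (z := (0, x₀.1)) (by simp)).continuousAt.comp
      (x := ((x₀.1, (0, b, 0)) : (ℝ × ℝ × ℝ) × (ℝ × ℝ × ℝ)))
      (f := fun z : (ℝ × ℝ × ℝ) × (ℝ × ℝ × ℝ) => (z.2.1, z.1)) (by fun_prop)
  have c2 : ContinuousAt (fun z : (ℝ × ℝ × ℝ) × (ℝ × ℝ × ℝ) =>
      chartShear₁ f₁ z.2.2.1 (chartShear₂ f₂ z.2.1 z.1)) (x₀.1, (0, b, 0)) :=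
    (contDiff_chartShear₁ f₁).continuous.continuousAt.comp
      ((by fun_prop : ContinuousAt (fun z : (ℝ × ℝ × ℝ) × (ℝ × ℝ × ℝ) => z.2.2.1)
        (x₀.1, (0, b, 0))).prodMk c1)
  have hd : Continuous fun w : ℝ × (ℝ × ℝ × ℝ) => 1 + w.1 * f₂.deriv (w.2.1 : Circ) * w.2.2.2 := by
    have : Continuous fun w : ℝ × (ℝ × ℝ × ℝ) => f₂.deriv (w.2.1 : Circ) :=
      f₂.contDiff_deriv.continuous.comp
        (by fun_prop : Continuous fun w : ℝ × (ℝ × ℝ × ℝ) => w.2.1)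
    fun_prop
  have d1 : ContinuousAt (fun z : (ℝ × ℝ × ℝ) × (ℝ × ℝ × ℝ) =>
      1 + z.2.1 * f₂.deriv (z.1.1 : Circ) * z.1.2.2) (x₀.1, (0, b, 0)) :=
    (hd.comp (by fun_prop :
      Continuous fun z : (ℝ × ℝ × ℝ) × (ℝ × ℝ × ℝ) => (z.2.1, z.1))).continuousAt
  have d2 := hd.continuousAt.comp
    ((by fun_prop : ContinuousAt (fun z : (ℝ × ℝ × ℝ) × (ℝ × ℝ × ℝ) => z.2.2.2)
        (x₀.1, (0, b, 0))).prodMk c2)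
  filter_upwards [d1.eventually_ne (y := 0) (by simp), d2.eventually_ne (y := 0) (by simp)] with z hz1 hz2 hz
  obtain ⟨k1, e1⟩ := pShear₂_chartPt (τ := z.2.1) (x := (⟨z.1, hz⟩ : ChartDom f₁ f₂)) hz1
  obtain ⟨k2, e2⟩ := pShear₁_chartPt z.2.2.1 (⟨_, k1⟩ : ChartDom f₁ f₂)
  obtain ⟨k3, e3⟩ := pShear₂_chartPt (τ := z.2.2.2) (x := (⟨_, k2⟩ : ChartDom f₁ f₂)) hz2
  exact ⟨k3, by rw [pWord, e1, e2, e3]; rfl⟩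

end HamiltonianShear

namespace HamiltonianShear

variable {f₁ f₂ : AnalyticFun}

/-! ### Local minorization of the two-step kernel -/

instance : (volume : Measure (ℝ × ℝ)).IsAddHaarMeasure :=
  inferInstanceAs ((volume : Measure ℝ).prod (volume : Measure ℝ)).IsAddHaarMeasure

instance : (volume : Measure (ℝ × ℝ × ℝ)).IsAddHaarMeasure :=
  inferInstanceAs ((volume : Measure ℝ).prod (volume : Measure (ℝ × ℝ))).IsAddHaarMeasure

theorem exists_measure_le_volume_pWord (x₀ : ChartDom f₁ f₂) {b : ℝ}
    (hsurj : Function.Surjective ((fderiv ℝ (chartWord f₁ f₂) (x₀.1, (0, b, 0))).comp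
      (ContinuousLinearMap.inr ℝ (ℝ × ℝ × ℝ) (ℝ × ℝ × ℝ))))
    {O : Set (ℝ × ℝ × ℝ)} (hO : O ∈ 𝓝 (0, b, 0)) :
    ∃ ν : Measure (PBundle f₁ f₂), ν ≠ 0 ∧ ∀ᶠ y in 𝓝 (chartPt x₀), ∀ A, MeasurableSet A →
      ν A ≤ volume {t | t ∈ O ∧ pWord t y ∈ A} := by
  have hev := eventually_pWord_chartPt x₀ b
  have hev' := hev
  rw [nhds_prod_eq, eventually_prod_iff] at hev'
  obtain ⟨pN, hpN, pO, hpO, hW⟩ := hev'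
  obtain ⟨c, N, B, hN, hB, hBm, hcN⟩ := exists_uniform_volume_le (volume : Measure (ℝ × ℝ × ℝ))
    (measurable_chartWord f₁ f₂) (contDiffAt_chartWord f₁ f₂ x₀.1 b) hsurj (inter_mem hO hpO)
  have hΩm : MeasurableSet {x : ℝ × ℝ × ℝ | ¬ (f₁ (x.2.1 : Circ) = 0 ∧ f₂ (x.1 : Circ) = 0)} :=
    isOpen_chartDom.measurableSet
  have hemb : MeasurableEmbedding (Subtype.val : ChartDom f₁ f₂ → ℝ × ℝ × ℝ) :=
    MeasurableEmbedding.subtype_coe hΩm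
  have hψ : Measurable (chartPt : ChartDom f₁ f₂ → PBundle f₁ f₂) := continuous_chartPt.measurable
  -- Lebesgue measure on the part of `B` over the phase space, pushed to the bundle. It need not be
  -- finite; finiteness follows later from domination by a probability measure.
  let ν₀ : Measure (PBundle f₁ f₂) :=
    (((volume.restrict B).comap (Subtype.val : ChartDom f₁ f₂ → ℝ × ℝ × ℝ))).map chartPt
  have hν₀ : ∀ A, MeasurableSet A → ν₀ A = volume (Subtype.val '' (chartPt ⁻¹' A) ∩ B) := by
    intro A hA
    rw [Measure.map_apply hψ hA, hemb.comap_apply,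
      Measure.restrict_apply (hemb.measurableSet_image.2 (hψ hA))]
  refine ⟨(ENNReal.ofReal c)⁻¹ • ν₀, ?_, ?_⟩
  · intro h0
    have h1 : (ENNReal.ofReal c)⁻¹ * ν₀ univ = 0 := by
      have := congrArg (fun m : Measure (PBundle f₁ f₂) => m univ) h0
      simpa using this
    rcases mul_eq_zero.1 h1 with h | h
    · exact ENNReal.ofReal_ne_top (ENNReal.inv_eq_zero.1 h)
    · rw [hν₀ _ MeasurableSet.univ] at h
      obtain ⟨hz, -⟩ := hev.self_of_nhds x₀.2
      refine (Measure.measure_pos_of_mem_nhds volume (inter_mem (isOpen_chartDom.mem_nhds hz) hB)).ne' ?_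
      simpa using h
  · have hN' : {e | pN e} ∩ N ∈ 𝓝 x₀.1 := inter_mem hpN hN
    filter_upwards [eventually_exists_chartPt_eq x₀ hN'] with y hy A hA
    obtain ⟨x, ⟨hxp, hxN⟩, rfl⟩ := hy
    rw [Measure.smul_apply, smul_eq_mul, hν₀ A hA, mul_comm, ← div_eq_mul_inv]
    refine ENNReal.div_le_of_le_mul' ((hcN x.1 hxN _ inter_subset_right
      ((hemb.measurableSet_image.2 (hψ hA)).inter hBm)).trans ?_)
    refine mul_le_mul' le_rfl (measure_mono ?_)
    rintro t ⟨⟨htO, htp⟩, ⟨⟨w, hw, hwe⟩, -⟩⟩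
    refine ⟨htO, ?_⟩
    obtain ⟨k, e⟩ := hW hxp htp x.2
    have : w = ⟨chartWord f₁ f₂ (x.1, t), k⟩ := Subtype.ext hwe
    simp only at e
    rw [e, ← this]
    exact hw

/-- The uniform law on `[0, T]`. -/
theorem cond_Icc_eq (T : ℝ) : cond volume (Icc 0 T) =
    (ENNReal.ofReal T)⁻¹ • (volume.restrict (Icc 0 T) : Measure ℝ) := by
  rw [ProbabilityTheory.cond, Real.volume_Icc, sub_zero]

theorem isProbabilityMeasure_cond_Icc {T : ℝ} (hT : 0 < T) :
    IsProbabilityMeasure (cond (volume : Measure ℝ) (Icc 0 T)) :=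
  cond_isProbabilityMeasure_of_finite (by simp [hT]) (by simp)

theorem isProbabilityMeasure_timeLaw {T : ℝ} (hT : 0 < T) :
    IsProbabilityMeasure (timeLaw T) := by
  have := isProbabilityMeasure_cond_Icc hT
  unfold timeLaw
  infer_instance

theorem isMarkovKernel_projKernel {T : ℝ} (hT : 0 < T) : IsMarkovKernel (projKernel f₁ f₂ T) := by
  have := isProbabilityMeasure_timeLaw hT
  refine ⟨fun y => ?_⟩
  exact Measure.isProbabilityMeasure_map
    (continuous_pStep.comp (Continuous.prodMk_right y)).measurable.aemeasurable

theorem lintegral_projKernel {T : ℝ} (y : PBundle f₁ f₂) {g : PBundle f₁ f₂ → ℝ≥0∞}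
    (hg : Measurable g) :
    ∫⁻ z, g z ∂(projKernel f₁ f₂ T y) = ∫⁻ τ, g (pStep τ y) ∂(timeLaw T) :=
  lintegral_map hg (continuous_pStep.comp (Continuous.prodMk_right y)).measurable

theorem projKernel_apply {T : ℝ} (y : PBundle f₁ f₂) {A : Set (PBundle f₁ f₂)}
    (hA : MeasurableSet A) :
    projKernel f₁ f₂ T y A = timeLaw T {τ | pStep τ y ∈ A} :=
  Measure.map_apply (continuous_pStep.comp (Continuous.prodMk_right y)).measurable hA

/-- Two steps use four times; the first, `e`, is set apart and the other three form the word to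
which the submersion applies. -/
theorem projKernel_sq_apply {T : ℝ} (y : PBundle f₁ f₂) {A : Set (PBundle f₁ f₂)}
    (hA : MeasurableSet A) :
    (projKernel f₁ f₂ T ^ 2) y A = ∫⁻ e, (cond volume (Icc 0 T)).prod (timeLaw T)
      {t | pWord t (pShear₁ e y) ∈ A} ∂(cond volume (Icc 0 T)) := by
  have hm : Measurable fun z => projKernel f₁ f₂ T z A := Kernel.measurable_coe _ hA
  have hW : MeasurableSet {w : ℝ × (ℝ × ℝ × ℝ) | pWord w.2 (pShear₁ w.1 y) ∈ A} := by
    have h1 : Continuous fun w : ℝ × (ℝ × ℝ × ℝ) => pShear₁ w.1 y :=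
      continuous_pShear₁.comp (f := fun w : ℝ × (ℝ × ℝ × ℝ) => (w.1, y)) (by fun_prop)
    exact (continuous_pWord.comp (continuous_snd.prodMk h1)).measurable hA
  rw [Kernel.pow_succ_apply_eq_lintegral _ 1 _ hA, pow_one, lintegral_projKernel _ hm]
  conv_lhs => rw [timeLaw]
  have hm' : Measurable fun τ : ℝ × ℝ => projKernel f₁ f₂ T (pStep τ y) A :=
    hm.comp (continuous_pStep.comp (Continuous.prodMk_right y)).measurable
  rw [lintegral_prod _ hm'.aemeasurable]
  refine lintegral_congr fun e => ?_
  have hWe : MeasurableSet {t : ℝ × ℝ × ℝ | pWord t (pShear₁ e y) ∈ A} :=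
    measurable_prodMk_left (x := e) hW
  rw [Measure.prod_apply hWe]
  refine lintegral_congr fun a => ?_
  rw [projKernel_apply _ hA]
  rfl

theorem smul_volume_restrict_eq (T : ℝ) :
    (cond volume (Icc 0 T)).prod (timeLaw T) = ((ENNReal.ofReal T)⁻¹ ^ 3) •
      (volume : Measure (ℝ × ℝ × ℝ)).restrict (Icc 0 T ×ˢ (Icc 0 T ×ˢ Icc 0 T)) := by
  rw [timeLaw, cond_Icc_eq, Measure.volume_eq_prod, Measure.volume_eq_prod,
    ← Measure.prod_restrict, ← Measure.prod_restrict]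
  simp only [Measure.prod_smul_left, Measure.prod_smul_right, smul_smul]
  rw [pow_succ, pow_two]

/-- The times `(0, b, 0)` lie on the boundary of the allowed cube. Starting from `pShear₂ (-1)
(chartPt x₀)` and pushing the result by `pShear₂ 1` translates them to `(1, b, 1)`, an interior
point as `b + 2 ≤ T`. -/
theorem exists_local_minorization (x₀ : ChartDom f₁ f₂) {b T : ℝ} (hb : 0 < b) (hT : b + 2 ≤ T)
    (hsurj : Function.Surjective ((fderiv ℝ (chartWord f₁ f₂) (x₀.1, (0, b, 0))).comp
      (ContinuousLinearMap.inr ℝ (ℝ × ℝ × ℝ) (ℝ × ℝ × ℝ)))) :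
    ∃ ν : Measure (PBundle f₁ f₂), ν ≠ 0 ∧ ∀ᶠ y in 𝓝 (pShear₂ (-1) (chartPt x₀)),
      ν ≤ (projKernel f₁ f₂ T ^ 2) y := by
  have hT0 : 0 < T := by linarith
  have := isProbabilityMeasure_cond_Icc hT0
  have hr : (ENNReal.ofReal T)⁻¹ ≠ 0 := ENNReal.inv_ne_zero.2 ENNReal.ofReal_ne_top
  set O : Set (ℝ × ℝ × ℝ) := Ioo (-1) 1 ×ˢ (Ioo 0 (b + 1) ×ˢ Ioo (-1) 1) with hOdef
  have hO : O ∈ 𝓝 ((0, b, 0) : ℝ × ℝ × ℝ) :=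
    prod_mem_nhds (Ioo_mem_nhds (by norm_num) (by norm_num))
      (prod_mem_nhds (Ioo_mem_nhds hb (by linarith)) (Ioo_mem_nhds (by norm_num) (by norm_num)))
  obtain ⟨ν, hν0, hν⟩ := exists_measure_le_volume_pWord x₀ hsurj hO
  have hs2 : Continuous (pShear₂ 1 : PBundle f₁ f₂ → PBundle f₁ f₂) :=
    continuous_pShear₂.comp (Continuous.prodMk_right 1)
  have hcont : Continuous fun w : PBundle f₁ f₂ × ℝ => pShear₂ 1 (pShear₁ w.2 w.1) :=
    hs2.comp (continuous_pShear₁.comp (f := fun w : PBundle f₁ f₂ × ℝ => (w.2, w.1)) (by fun_prop))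
  have hbase : pShear₂ 1 (pShear₁ 0 (pShear₂ (-1) (chartPt x₀))) = chartPt x₀ := by
    rw [pShear₁_zero, pShear₂_add, add_neg_cancel, pShear₂_zero]
  have hev : ∀ᶠ w in 𝓝 ((pShear₂ (-1) (chartPt x₀), 0) : PBundle f₁ f₂ × ℝ),
      ∀ A, MeasurableSet A → ν A ≤
        volume {t | t ∈ O ∧ pWord t (pShear₂ 1 (pShear₁ w.2 w.1)) ∈ A} :=
    hcont.continuousAt.eventually (p := fun y => ∀ A, MeasurableSet A → ν A ≤
      volume {t | t ∈ O ∧ pWord t y ∈ A}) (by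
        change ∀ᶠ y in 𝓝 (pShear₂ 1 (pShear₁ 0 (pShear₂ (-1) (chartPt x₀)))), _
        rw [hbase]; exact hν)
  rw [nhds_prod_eq, eventually_prod_iff] at hev
  obtain ⟨pU, hpU, pe, hpe, hUe⟩ := hev
  obtain ⟨ε, hε, hεball⟩ := Metric.eventually_nhds_iff.1 hpe
  set κ : Measure ℝ := cond volume (Icc 0 T) with hκ
  set I : Set ℝ := Icc 0 T ∩ Ioo (-ε) ε with hI
  -- The extra initial time `e` is taken so small that it stays within the neighbourhood where the
  -- estimate holds; this event has positive probability.
  have hκI : κ I ≠ 0 := by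
    rw [hκ, cond_Icc_eq, Measure.smul_apply, smul_eq_mul, Measure.restrict_apply
      (measurableSet_Icc.inter measurableSet_Ioo)]
    refine mul_ne_zero hr fun h0 => ?_
    have hsub : Ioo 0 (min T ε) ⊆ I ∩ Icc 0 T := fun t ht => by
      have h1 := ht.1
      have h2 := lt_min_iff.1 ht.2
      exact ⟨⟨⟨h1.le, h2.1.le⟩, by linarith, h2.2⟩, h1.le, h2.1.le⟩
    have := measure_mono_null hsub h0
    rw [Real.volume_Ioo, ENNReal.ofReal_eq_zero] at this
    have := lt_min hT0 hε
    linarith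
  set r := (ENNReal.ofReal T)⁻¹ ^ 3 * κ I with hrdef
  have hr0 : r ≠ 0 := mul_ne_zero (pow_ne_zero _ hr) hκI
  refine ⟨r • ν.map (pShear₂ 1), ?_, ?_⟩
  · intro h0
    have h1 : r * ν univ = 0 := by
      have := congrArg (fun m : Measure (PBundle f₁ f₂) => m univ) h0
      simpa [Measure.map_apply hs2.measurable MeasurableSet.univ] using this
    rcases mul_eq_zero.1 h1 with h | h
    · exact hr0 h
    · exact hν0 (Measure.measure_univ_eq_zero.1 h)
  · filter_upwards [hpU] with y hy
    refine Measure.le_iff.2 fun A hA => ?_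
    rw [projKernel_sq_apply y hA, smul_volume_restrict_eq, Measure.smul_apply,
      Measure.map_apply hs2.measurable hA, smul_eq_mul]
    have key : ∀ e ∈ I, (ENNReal.ofReal T)⁻¹ ^ 3 * ν (pShear₂ 1 ⁻¹' A) ≤
        ((ENNReal.ofReal T)⁻¹ ^ 3 •
          (volume : Measure (ℝ × ℝ × ℝ)).restrict (Icc 0 T ×ˢ (Icc 0 T ×ˢ Icc 0 T)))
          {t | pWord t (pShear₁ e y) ∈ A} := by
      intro e he
      rw [Measure.smul_apply, smul_eq_mul]
      gcongr
      refine (hUe hy (hεball (by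
        rw [Real.dist_eq, sub_zero, abs_lt]; exact he.2)) _ (hs2.measurable hA)).trans ?_
      have hmeas : MeasurableSet {t : ℝ × ℝ × ℝ | pWord t (pShear₁ e y) ∈ A} :=
        (continuous_pWord.comp (Continuous.prodMk_left (pShear₁ e y))).measurable hA
      rw [Measure.restrict_apply hmeas]
      -- Translation by `(1, 0, 1)` preserves volume and carries `O` into the cube.
      refine le_trans (measure_mono ?_)
        (measure_preimage_add_right volume ((1, 0, 1) : ℝ × ℝ × ℝ) _).le
      rintro ⟨a, b', c⟩ ⟨⟨ha, hb', hc⟩, hmem⟩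
      simp only [mem_Ioo] at ha hb' hc
      refine ⟨?_, ⟨?_, ?_⟩, ⟨?_, ?_⟩, ?_, ?_⟩
      · have e1 : pWord ((a, b', c) + (1, 0, 1)) (pShear₁ e y) =
            pShear₂ 1 (pWord (a, b', c) (pShear₂ 1 (pShear₁ e y))) := by
          simp only [pWord, Prod.mk_add_mk, add_zero, pShear₂_add]
          rw [add_comm c 1]
        change pWord ((a, b', c) + (1, 0, 1)) (pShear₁ e y) ∈ A
        rw [e1]
        exact hmem
      all_goals simp only [Prod.mk_add_mk]; linarith
    calc r * ν (pShear₂ 1 ⁻¹' A)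
        = ∫⁻ _ in I, (ENNReal.ofReal T)⁻¹ ^ 3 * ν (pShear₂ 1 ⁻¹' A) ∂κ := by
          rw [setLIntegral_const, hrdef]; ring
      _ ≤ ∫⁻ e in I, _ ∂κ :=
          setLIntegral_mono' (measurableSet_Icc.inter measurableSet_Ioo) key
      _ ≤ _ := setLIntegral_le_lintegral _ _

end HamiltonianShear

namespace HamiltonianShear

variable {f₁ f₂ : AnalyticFun}

/-! ### Reachability -/

theorem pStep_zero (y : PBundle f₁ f₂) : pStep (0, 0) y = y := by
  change pShear₂ 0 (pShear₁ 0 y) = y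
  rw [pShear₁_zero, pShear₂_zero]

/-- The points from which the set `U` can be reached in exactly `n` steps. -/
def reach (T : ℝ) (U : Set (PBundle f₁ f₂)) : ℕ → Set (PBundle f₁ f₂)
  | 0 => U
  | n + 1 => {y | ∃ τ ∈ Icc 0 T ×ˢ Icc 0 T, pStep τ y ∈ reach T U n}

theorem isOpen_reach (T : ℝ) {U : Set (PBundle f₁ f₂)} (hU : IsOpen U) (n : ℕ) :
    IsOpen (reach T U n) := by
  induction n with
  | zero => exact hU
  | succ n ih =>
    have : reach T U (n + 1) = ⋃ τ ∈ Icc 0 T ×ˢ Icc 0 T, (fun y => pStep τ y) ⁻¹' reach T U n := by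
      ext y
      simp [reach]
    rw [this]
    exact isOpen_biUnion fun τ _ =>
      ih.preimage (continuous_pStep.comp (Continuous.prodMk_left τ))

/-- Waiting is allowed: the times `(0, 0)` leave every point fixed. Thus one number of steps serves
a whole compact set. -/
theorem monotone_reach {T : ℝ} (hT : 0 ≤ T) (U : Set (PBundle f₁ f₂)) : Monotone (reach T U) :=
  monotone_nat_of_le_succ fun n y hy =>
    ⟨(0, 0), ⟨⟨le_rfl, hT⟩, ⟨le_rfl, hT⟩⟩, by rwa [pStep_zero]⟩

/-- Boundary times count too, since the closed square is the closure of its interior; waiting uses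
the corner. -/
theorem timeLaw_ne_zero_of_mem_nhds {T : ℝ} (hT : 0 < T) {τ : ℝ × ℝ}
    (hτ : τ ∈ Icc 0 T ×ˢ Icc 0 T) {J : Set (ℝ × ℝ)} (hJ : J ∈ 𝓝 τ) : timeLaw T J ≠ 0 := by
  obtain ⟨J₁, h₁, J₂, h₂, hsub⟩ := mem_nhds_prod_iff.1 hJ
  have key : ∀ s ∈ Icc 0 T, ∀ I ∈ 𝓝 s, cond volume (Icc 0 T) I ≠ 0 := by
    intro s hs I hI h0
    rw [cond_Icc_eq, Measure.smul_apply, smul_eq_mul] at h0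
    rcases mul_eq_zero.1 h0 with h | h
    · exact ENNReal.ofReal_ne_top (ENNReal.inv_eq_zero.1 h)
    · have h1 : s ∈ closure (Ioo 0 T) := by rwa [closure_Ioo hT.ne]
      obtain ⟨I', hI', ho, hsI'⟩ := mem_nhds_iff.1 hI
      have h2 : (I' ∩ Ioo 0 T).Nonempty := mem_closure_iff.1 h1 I' ho hsI'
      have h3 : 0 < volume (I' ∩ Ioo 0 T) := (ho.inter isOpen_Ioo).measure_pos _ h2
      refine h3.ne' (le_antisymm (le_trans ?_ h.le) zero_le)
      refine le_trans ?_ (Measure.le_restrict_apply _ _)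
      exact measure_mono (inter_subset_inter hI' Ioo_subset_Icc_self)
  intro h0
  have h1 := measure_mono_null hsub h0
  rw [timeLaw, Measure.prod_prod, mul_eq_zero] at h1
  exact h1.elim (key _ hτ.1 _ h₁) (key _ hτ.2 _ h₂)

/-- Joint continuity in point and times makes a controlled path robust, so nearby points follow it
with probability bounded below. -/
theorem exists_le_projKernel_pow_of_mem_reach {T : ℝ} (hT : 0 < T) {U : Set (PBundle f₁ f₂)}
    (hU : IsOpen U) (n : ℕ) {y : PBundle f₁ f₂} (hy : y ∈ reach T U n) :
    ∃ c : ℝ≥0∞, c ≠ 0 ∧ ∀ᶠ y' in 𝓝 y, c ≤ (projKernel f₁ f₂ T ^ n) y' U := by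
  induction n generalizing y with
  | zero =>
    refine ⟨1, one_ne_zero, ?_⟩
    filter_upwards [hU.mem_nhds hy] with y' hy'
    rw [pow_zero]
    change 1 ≤ Kernel.id y' U
    rw [Kernel.id_apply, Measure.dirac_apply' _ hU.measurableSet, indicator_of_mem hy']
    simp
  | succ n ih =>
    obtain ⟨τ, hτ, hyτ⟩ := hy
    obtain ⟨c, hc, hev⟩ := ih hyτ
    have hcont : ContinuousAt (fun z : PBundle f₁ f₂ × (ℝ × ℝ) => pStep z.2 z.1) (y, τ) :=
      continuous_pStep.continuousAt
    have hev' := hcont.eventually hev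
    rw [nhds_prod_eq, eventually_prod_iff] at hev'
    obtain ⟨pN, hpN, pJ, hpJ, hNJ⟩ := hev'
    obtain ⟨J, hJsub, hJo, hJτ⟩ := mem_nhds_iff.1 hpJ
    refine ⟨c * timeLaw T J,
      mul_ne_zero hc (timeLaw_ne_zero_of_mem_nhds hT hτ (hJo.mem_nhds hJτ)), ?_⟩
    filter_upwards [hpN] with y' hy'
    have hm : Measurable fun z => (projKernel f₁ f₂ T ^ n) z U :=
      Kernel.measurable_coe _ hU.measurableSet
    rw [add_comm, Kernel.pow_add_apply_eq_lintegral _ 1 n _ hU.measurableSet, pow_one,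
      lintegral_projKernel _ hm]
    calc c * timeLaw T J = ∫⁻ _ in J, c ∂(timeLaw T) := by rw [setLIntegral_const]
      _ ≤ ∫⁻ τ in J, (projKernel f₁ f₂ T ^ n) (pStep τ y') U ∂(timeLaw T) :=
          setLIntegral_mono' hJo.measurableSet fun τ' hτ' => hNJ hy' (hJsub hτ')
      _ ≤ _ := setLIntegral_le_lintegral _ _

/-- A long shear is cut into shears of duration at most `T`, each a step with vertical time `0`. -/
theorem mem_iUnion_reach_of_pShear₁ {T : ℝ} (hT : 0 < T) {U : Set (PBundle f₁ f₂)} {τ : ℝ}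
    (hτ : 0 ≤ τ) {y : PBundle f₁ f₂} (h : pShear₁ τ y ∈ ⋃ n, reach T U n) :
    y ∈ ⋃ n, reach T U n := by
  have one : ∀ σ ∈ Icc 0 T, ∀ y : PBundle f₁ f₂, pShear₁ σ y ∈ ⋃ n, reach T U n →
      y ∈ ⋃ n, reach T U n := fun σ hσ y hy => by
    obtain ⟨n, hn⟩ := mem_iUnion.1 hy
    refine mem_iUnion.2 ⟨n + 1, (σ, 0), ⟨hσ, ⟨le_rfl, hT.le⟩⟩, ?_⟩
    change pShear₂ 0 (pShear₁ σ y) ∈ _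
    rwa [pShear₂_zero]
  obtain ⟨k, hk⟩ := exists_nat_ge (τ / T)
  rw [div_le_iff₀ hT] at hk
  induction k generalizing τ y with
  | zero => exact one τ ⟨hτ, by simp at hk; linarith⟩ y h
  | succ k ih =>
    rcases le_total τ T with hle | hle
    · exact one τ ⟨hτ, hle⟩ y h
    · refine one T ⟨hT.le, le_rfl⟩ y (ih (τ := τ - T) (by linarith) ?_ ?_)
      · rwa [pShear₁_add, sub_add_cancel]
      · push_cast at hk; linarith

theorem mem_iUnion_reach_of_pShear₂ {T : ℝ} (hT : 0 < T) {U : Set (PBundle f₁ f₂)} {τ : ℝ}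
    (hτ : 0 ≤ τ) {y : PBundle f₁ f₂} (h : pShear₂ τ y ∈ ⋃ n, reach T U n) :
    y ∈ ⋃ n, reach T U n := by
  have one : ∀ σ ∈ Icc 0 T, ∀ y : PBundle f₁ f₂, pShear₂ σ y ∈ ⋃ n, reach T U n →
      y ∈ ⋃ n, reach T U n := fun σ hσ y hy => by
    obtain ⟨n, hn⟩ := mem_iUnion.1 hy
    refine mem_iUnion.2 ⟨n + 1, (0, σ), ⟨⟨le_rfl, hT.le⟩, hσ⟩, ?_⟩
    change pShear₂ σ (pShear₁ 0 y) ∈ _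
    rwa [pShear₁_zero]
  obtain ⟨k, hk⟩ := exists_nat_ge (τ / T)
  rw [div_le_iff₀ hT] at hk
  induction k generalizing τ y with
  | zero => exact one τ ⟨hτ, by simp at hk; linarith⟩ y h
  | succ k ih =>
    rcases le_total τ T with hle | hle
    · exact one τ ⟨hτ, hle⟩ y h
    · refine one T ⟨hT.le, le_rfl⟩ y (ih (τ := τ - T) (by linarith) ?_ ?_)
      · rwa [pShear₂_add, sub_add_cancel]
      · push_cast at hk; linarith

/-- A rotation at non-zero speed reaches any point of the circle at arbitrarily late times. -/
theorem exists_times_rotation {v : ℝ} (hv : v ≠ 0) (z w : Circ) :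
    ∃ τ : ℕ → ℝ, (∀ n, 0 ≤ τ n) ∧ Tendsto τ atTop atTop ∧
      ∀ n, z + ((τ n * v : ℝ) : Circ) = w := by
  have : Fact (0 < 2 * Real.pi) := ⟨Real.two_pi_pos⟩
  have hlift : ∀ a : Circ, ∃ x : ℝ, 0 ≤ x ∧ (x : Circ) = a := fun a =>
    ⟨(AddCircle.equivIco (2 * Real.pi) 0 a : ℝ), (AddCircle.equivIco (2 * Real.pi) 0 a).2.1,
      AddCircle.coe_equivIco⟩
  have hper : ∀ (x : ℝ) (n : ℕ), ((x + n * (2 * Real.pi) : ℝ) : Circ) = x := fun x n => by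
    rw [AddCircle.coe_add, ← nsmul_eq_mul, AddCircle.coe_nsmul, AddCircle.coe_period, smul_zero,
      add_zero]
  have htend : ∀ (x r : ℝ), 0 < r →
      Tendsto (fun n : ℕ => (x + n * (2 * Real.pi)) / r) atTop atTop := fun x r hr =>
    (tendsto_atTop_add_const_left _ x
      (tendsto_natCast_atTop_atTop.atTop_mul_const Real.two_pi_pos)).atTop_div_const hr
  rcases lt_or_gt_of_ne hv with h | h
  · obtain ⟨x, hx0, hx⟩ := hlift (z - w)
    refine ⟨fun n => (x + n * (2 * Real.pi)) / (-v), fun n => ?_, htend x _ (by linarith),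
      fun n => ?_⟩
    · have := Real.pi_pos
      exact div_nonneg (by positivity) (by linarith)
    · have : (x + n * (2 * Real.pi)) / (-v) * v = -(x + n * (2 * Real.pi)) := by
        field_simp
      rw [this, AddCircle.coe_neg, hper, hx]
      abel
  · obtain ⟨x, hx0, hx⟩ := hlift (w - z)
    refine ⟨fun n => (x + n * (2 * Real.pi)) / v, fun n => ?_, htend x _ h, fun n => ?_⟩
    · have := Real.pi_pos
      positivity
    · have : (x + n * (2 * Real.pi)) / v * v = x + n * (2 * Real.pi) := by
        field_simp
      rw [this, hper, hx]
      abel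

/-- The vertical line is fixed; for `u.1 ≠ 0` the second component grows without bound while the
first stays, so the slope `u.1 / u.2` tends to `0`. -/
theorem tendsto_lineMap_lower {d : ℝ} (hd : d ≠ 0) {τ : ℕ → ℝ} (hτ : Tendsto τ atTop atTop)
    (l : Line) : Tendsto (fun n => lineMap (lower (τ n * d)) l) atTop (𝓝 (lineOf 0)) := by
  induction l using Projectivization.ind with
  | h u hu =>
    have hmk : ∀ a : ℝ, lineMap (lower a) (Projectivization.mk ℝ u hu) =
        Projectivization.mk ℝ (lower a u) ((lower a).map_ne_zero_iff.2 hu) := fun a => rfl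
    by_cases hu1 : u.1 = 0
    · have hu2 : u.2 ≠ 0 := fun h => hu (Prod.ext hu1 h)
      have : ∀ n, lineMap (lower (τ n * d)) (Projectivization.mk ℝ u hu) = lineOf 0 := fun n => by
        have e : lower (τ n * d) u = u := by
          refine Prod.ext rfl ?_
          change u.2 + τ n * d * u.1 = u.2
          rw [hu1, mul_zero, add_zero]
        rw [hmk, mk_eq_lineOf _ (by rwa [e]), e, hu1, zero_div]
      simp_rw [this]
      exact tendsto_const_nhds
    · have hden : Tendsto (fun n => |u.2 + τ n * d * u.1|) atTop atTop := by
        have h1 : Tendsto (fun n => τ n * |d * u.1|) atTop atTop :=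
          hτ.atTop_mul_const (abs_pos.2 (mul_ne_zero hd hu1))
        refine tendsto_atTop_mono' _ ?_ (tendsto_atTop_add_const_right _ (-|u.2|) h1)
        filter_upwards [hτ.eventually_ge_atTop 0] with n hn
        have h2 : τ n * |d * u.1| = |τ n * d * u.1| := by
          rw [mul_assoc, abs_mul (τ n), abs_of_nonneg hn]
        have h3 := abs_sub_abs_le_abs_sub (τ n * d * u.1) (-u.2)
        rw [abs_neg, sub_neg_eq_add, add_comm (τ n * d * u.1)] at h3
        rw [h2]
        linarith
      have hq : Tendsto (fun n => u.1 / (u.2 + τ n * d * u.1)) atTop (𝓝 0) := by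
        rw [tendsto_zero_iff_abs_tendsto_zero]
        have : (abs ∘ fun n => u.1 / (u.2 + τ n * d * u.1)) =
            fun n => |u.1| / |u.2 + τ n * d * u.1| := funext fun n => abs_div _ _
        rw [this]
        exact tendsto_const_nhds.div_atTop hden
      refine ((continuous_lineOf.tendsto 0).comp hq).congr' ?_
      filter_upwards [hden.eventually_gt_atTop 0] with n hn
      rw [hmk, mk_eq_lineOf _ (abs_pos.1 hn)]
      rfl

/-- Near a point with `f' ≠ 0` the derivative stays nonzero, and `f` has no zero except possibly
that point. -/
theorem exists_ne_zero_and_deriv_ne_zero (f : AnalyticFun) (hc : ¬ ∃ c : ℝ, ∀ z, f z = c) :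
    ∃ x : ℝ, f (x : Circ) ≠ 0 ∧ f.deriv (x : Circ) ≠ 0 := by
  have h1 : ∃ x : ℝ, f.deriv (x : Circ) ≠ 0 := by
    by_contra! h
    refine hc ⟨f ((0 : ℝ) : Circ), fun z => ?_⟩
    obtain ⟨x, rfl⟩ := QuotientAddGroup.mk_surjective z
    exact is_const_of_deriv_eq_zero (f.contDiff.differentiable (by simp))
      (fun x => by rw [← f.deriv_coe, h]) x 0
  obtain ⟨x, hx⟩ := h1
  have e1 : ∀ᶠ t : ℝ in 𝓝[≠] x, f (t : Circ) ≠ 0 := (f.hasDerivAt x).eventually_ne hx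
  have e2 : ∀ᶠ t : ℝ in 𝓝[≠] x, f.deriv (t : Circ) ≠ 0 :=
    (f.contDiff_deriv.continuous.continuousAt.eventually_ne hx).filter_mono nhdsWithin_le_nhds
  exact (e1.and e2).exists

/-- Every neighbourhood of a point over `q₀` with vertical direction can be reached from
everywhere, provided `f₂` and `f₂'` do not vanish at `q₀`. -/
theorem iUnion_reach_eq_univ {T : ℝ} (hT : 0 < T) (hc₁ : ¬ ∃ c : ℝ, ∀ z, f₁ z = c)
    {y₀ : PBundle f₁ f₂} (hl : y₀.2 = lineOf 0) (h2 : f₂ y₀.1.1.1 ≠ 0)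
    (h2' : f₂.deriv y₀.1.1.1 ≠ 0) {U : Set (PBundle f₁ f₂)} (hU : U ∈ 𝓝 y₀) :
    ⋃ n, reach T U n = univ := by
  -- Over `q₀` the vertical shear hits `p₀` at arbitrarily late times, and at these times the line
  -- approaches the vertical.
  have third : ∀ y : PBundle f₁ f₂, y.1.1.1 = y₀.1.1.1 → y ∈ ⋃ n, reach T U n := by
    rintro ⟨⟨⟨q, p⟩, hy⟩, l⟩ e
    obtain ⟨⟨⟨q₀, p₀⟩, hy₀⟩, l₀⟩ := y₀
    simp only at e hl h2 h2'
    subst e hl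
    obtain ⟨τ, hτ0, hτ, hτw⟩ := exists_times_rotation h2 p p₀
    have ht : Tendsto (fun n => pShear₂ (τ n) ((⟨(q, p), hy⟩, l) : PBundle f₁ f₂)) atTop
        (𝓝 (⟨(q, p₀), hy₀⟩, lineOf 0)) := by
      refine Tendsto.prodMk_nhds ?_ (tendsto_lineMap_lower h2' hτ l)
      have e : ∀ n, shear₂ (τ n) (⟨(q, p), hy⟩ : Phase f₁ f₂) = ⟨(q, p₀), hy₀⟩ := fun n =>
        Subtype.ext (Prod.ext rfl (hτw n))
      simp_rw [e]
      exact tendsto_const_nhds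
    obtain ⟨n, hn⟩ := (ht.eventually hU).exists
    exact mem_iUnion_reach_of_pShear₂ hT (hτ0 n) (mem_iUnion.2 ⟨0, hn⟩)
  have second : ∀ y : PBundle f₁ f₂, f₁ y.1.1.2 ≠ 0 → y ∈ ⋃ n, reach T U n := fun y hy => by
    obtain ⟨τ, hτ0, -, hτw⟩ := exists_times_rotation hy y.1.1.1 y₀.1.1.1
    exact mem_iUnion_reach_of_pShear₁ hT (hτ0 0) (third _ (hτw 0))
  -- When `f₁` vanishes at the height of `y`, `f₂` does not vanish at its abscissa, so a vertical
  -- shear first reaches a height where the horizontal one moves.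
  refine eq_univ_of_forall fun y => ?_
  by_cases hy : f₁ y.1.1.2 = 0
  · have hy2 : f₂ y.1.1.1 ≠ 0 := fun h => y.1.2 ⟨hy, h⟩
    obtain ⟨x, hx, -⟩ := exists_ne_zero_and_deriv_ne_zero f₁ hc₁
    obtain ⟨τ, hτ0, -, hτw⟩ := exists_times_rotation hy2 y.1.1.2 x
    refine mem_iUnion_reach_of_pShear₂ hT (hτ0 0) (second _ ?_)
    have e : (pShear₂ (τ 0) y).1.1.2 = x := hτw 0
    rwa [e]
  · exact second y hy

/-- Minorization on compact sets. -/
theorem exists_minorization_of_isCompact {T : ℝ} (hT : 0 < T) {U : Set (PBundle f₁ f₂)}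
    (hU : IsOpen U) (hreach : ⋃ n, reach T U n = univ) {ν : Measure (PBundle f₁ f₂)}
    [IsFiniteMeasure ν] (hν0 : ν ≠ 0) {k : ℕ} (hk : k ≠ 0) (hν : ∀ y ∈ U, ν ≤ (projKernel f₁ f₂ T ^ k) y)
    {S : Set (PBundle f₁ f₂)} (hS : IsCompact S) :
    ∃ n : ℕ, n ≠ 0 ∧ ∃ ν' : Measure (PBundle f₁ f₂), IsFiniteMeasure ν' ∧ ν' ≠ 0 ∧
      ∀ y ∈ S, ν' ≤ (projKernel f₁ f₂ T ^ n) y := by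
  have := isMarkovKernel_projKernel (f₁ := f₁) (f₂ := f₂) hT
  obtain ⟨m, hm⟩ := hS.elim_directed_cover (reach T U) (isOpen_reach T hU)
    (by rw [hreach]; exact subset_univ S) (monotone_reach hT.le U).directed_le
  have hc : ∃ c : ℝ≥0∞, c ≠ 0 ∧ ∀ y ∈ S, c ≤ (projKernel f₁ f₂ T ^ m) y U := by
    refine hS.induction_on (p := fun s => ∃ c : ℝ≥0∞, c ≠ 0 ∧
      ∀ y ∈ s, c ≤ (projKernel f₁ f₂ T ^ m) y U) ⟨1, one_ne_zero, by simp⟩ ?_ ?_ ?_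
    · rintro s t hst ⟨c, hc, h⟩
      exact ⟨c, hc, fun y hy => h y (hst hy)⟩
    · rintro s t ⟨c, hc, h⟩ ⟨c', hc', h'⟩
      refine ⟨min c c', ?_, fun y hy => ?_⟩
      · rcases min_choice c c' with e | e <;> rw [e] <;> assumption
      · rcases hy with hy | hy
        · exact (min_le_left _ _).trans (h y hy)
        · exact (min_le_right _ _).trans (h' y hy)
    · intro y hy
      obtain ⟨c, hc, hev⟩ := exists_le_projKernel_pow_of_mem_reach hT hU m (hm hy)
      exact ⟨_, mem_nhdsWithin_of_mem_nhds hev, c, hc, fun y' hy' => hy'⟩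
  obtain ⟨c, hc0, hc1, hc⟩ : ∃ c : ℝ≥0∞, c ≠ 0 ∧ c ≠ ⊤ ∧
      ∀ y ∈ S, c ≤ (projKernel f₁ f₂ T ^ m) y U := by
    obtain ⟨c, hc0, hc⟩ := hc
    refine ⟨min c 1, by simp [hc0], by simp, fun y hy => (min_le_left _ _).trans (hc y hy)⟩
  -- Enter `U` within `m` steps with probability at least `c`, then use the minorization there for
  -- `k` more.
  refine ⟨m + k, by omega, c • ν, Measure.smul_finite ν hc1, ?_, fun y hy => Measure.le_iff.2 fun A hA => ?_⟩
  · intro h0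
    have h1 : c * ν univ = 0 := by
      have := congrArg (fun m : Measure (PBundle f₁ f₂) => m univ) h0
      simpa using this
    rcases mul_eq_zero.1 h1 with h | h
    · exact hc0 h
    · exact hν0 (Measure.measure_univ_eq_zero.1 h)
  · rw [Kernel.pow_add_apply_eq_lintegral _ m k _ hA, Measure.smul_apply, smul_eq_mul, mul_comm]
    calc ν A * c ≤ ν A * (projKernel f₁ f₂ T ^ m) y U := by gcongr; exact hc y hy
      _ = ∫⁻ _ in U, ν A ∂((projKernel f₁ f₂ T ^ m) y) := by rw [setLIntegral_const]
      _ ≤ ∫⁻ z in U, (projKernel f₁ f₂ T ^ k) z A ∂((projKernel f₁ f₂ T ^ m) y) :=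
          setLIntegral_mono' hU.measurableSet fun z hz => hν z hz A
      _ ≤ _ := setLIntegral_le_lintegral _ _

end HamiltonianShear

namespace HamiltonianShear

/-! ### Zeros and distances on the circle -/

instance : Fact (0 < 2 * Real.pi) := ⟨Real.two_pi_pos⟩

theorem exists_lift_abs_eq_norm (z : Circ) : ∃ x : ℝ, (x : Circ) = z ∧ |x| = ‖z‖ := by
  obtain ⟨x, rfl⟩ := QuotientAddGroup.mk_surjective z
  refine ⟨x - round ((2 * Real.pi)⁻¹ * x) * (2 * Real.pi), ?_, ?_⟩
  · rw [AddCircle.coe_sub, ← zsmul_eq_mul, AddCircle.coe_zsmul, AddCircle.coe_period, smul_zero,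
      sub_zero]
  · exact (AddCircle.norm_eq (2 * Real.pi)).symm

theorem norm_le_pi (z : Circ) : ‖z‖ ≤ Real.pi := by
  have := AddCircle.norm_le_half_period (2 * Real.pi) (x := z) Real.two_pi_pos.ne'
  rwa [abs_of_pos Real.two_pi_pos, mul_div_cancel_left₀ _ two_ne_zero] at this

theorem norm_coe_le_abs (x : ℝ) : ‖(x : Circ)‖ ≤ |x| := by
  have := QuotientAddGroup.norm_mk_le_norm (S := AddSubgroup.zmultiples (2 * Real.pi)) (m := x)
  simpa using this

theorem nhds_coe_le (x : ℝ) : 𝓝 (x : Circ) ≤ map ((↑) : ℝ → Circ) (𝓝 x) :=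
  (QuotientAddGroup.isOpenMap_coe (N := AddSubgroup.zmultiples (2 * Real.pi))).nhds_le x

theorem edist_eq_ofReal_norm (z w : Circ) : edist z w = ENNReal.ofReal ‖z - w‖ := by
  rw [edist_dist, dist_eq_norm]

namespace AnalyticFun

variable (f : AnalyticFun)

theorem exists_abs_le : ∃ B : ℝ, ∀ z, |f z| ≤ B := by
  obtain ⟨B, hB⟩ := isCompact_univ.exists_bound_of_continuousOn f.continuous.continuousOn
  exact ⟨B, fun z => hB z (mem_univ z)⟩

theorem isClosed_zeros : IsClosed f.zeros := isClosed_singleton.preimage f.continuous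

/-- Mean value inequality along the shortest arc to a zero; without zeros the distance is `⊤`. -/
theorem exists_abs_le_mul_infEDist : ∃ A : ℝ, 0 < A ∧
    ∀ z, ENNReal.ofReal |f z| ≤ ENNReal.ofReal A * Metric.infEDist z f.zeros := by
  obtain ⟨B, hB⟩ := isCompact_univ.exists_bound_of_continuousOn f.continuous_deriv.continuousOn
  have hB0 : 0 ≤ B := (norm_nonneg _).trans (hB 0 (mem_univ _))
  refine ⟨B + 1, by positivity, fun z => ?_⟩
  have hA : ENNReal.ofReal (B + 1) ≠ 0 := by simp; linarith
  rw [mul_comm, ← ENNReal.div_le_iff hA ENNReal.ofReal_ne_top, Metric.le_infEDist]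
  intro c hc
  rw [ENNReal.div_le_iff hA ENNReal.ofReal_ne_top, edist_eq_ofReal_norm,
    ← ENNReal.ofReal_mul (norm_nonneg _)]
  refine ENNReal.ofReal_le_ofReal ?_
  obtain ⟨x, hx, hxn⟩ := exists_lift_abs_eq_norm (z - c)
  obtain ⟨y, rfl⟩ := QuotientAddGroup.mk_surjective c
  change f (y : Circ) = 0 at hc
  have hz : z = ((y + x : ℝ) : Circ) := by
    rw [AddCircle.coe_add, hx]
    change z = (y : Circ) + (z - (y : Circ))
    abel
  have h := Convex.norm_image_sub_le_of_norm_deriv_le (f := fun t : ℝ => f (t : Circ)) (C := B)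
    (s := univ) (x := y) (y := y + x) (fun t _ => f.contDiff.differentiable (by simp) t)
    (fun t _ => by rw [← f.deriv_coe]; exact hB _ (mem_univ _)) convex_univ (mem_univ _)
    (mem_univ _)
  rw [hc, sub_zero, add_sub_cancel_left, ← hz, Real.norm_eq_abs, Real.norm_eq_abs, hxn] at h
  change |f z| ≤ ‖z - (y : Circ)‖ * (B + 1)
  change |f z| ≤ B * ‖z - (y : Circ)‖ at h
  nlinarith [norm_nonneg (z - (y : Circ))]

variable {f}

theorem deriv_ne_zero_of_noDegenerateZero (hf : f.NoDegenerateZero) {z : Circ} (hz : f z = 0) :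
    f.deriv z ≠ 0 := fun h => by
  have : z ∈ f.zeros ∩ {z | f.deriv z = 0} := ⟨hz, h⟩
  rw [hf] at this
  exact this

/-- Simple zeros are isolated, and the circle is compact. -/
theorem finite_zeros (hf : f.NoDegenerateZero) : f.zeros.Finite := by
  have : ((univ : Set Circ) ∩ f.zeros).Finite := by
    refine isCompact_univ.induction_on (p := fun s => (s ∩ f.zeros).Finite) (by simp)
      (fun s t hst ht => ht.subset (inter_subset_inter_left _ hst))
      (fun s t hs ht => by rw [union_inter_distrib_right]; exact hs.union ht) fun z _ => ?_
    obtain ⟨x, rfl⟩ := QuotientAddGroup.mk_surjective z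
    refine ⟨{z | z ≠ (x : Circ) → f z ≠ 0}, mem_nhdsWithin_of_mem_nhds ?_, ?_⟩
    · refine nhds_coe_le x ?_
      rw [mem_map]
      by_cases hx : f (x : Circ) = 0
      · have h1 : ∀ᶠ t : ℝ in 𝓝[≠] x, f (t : Circ) ≠ 0 :=
          (f.hasDerivAt x).eventually_ne (deriv_ne_zero_of_noDegenerateZero hf hx)
        filter_upwards [eventually_nhdsWithin_iff.1 h1] with t ht hne
        exact ht fun h => hne (by rw [h])
      · filter_upwards [f.contDiff.continuous.continuousAt.eventually_ne hx] with t ht _ using ht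
    · refine (finite_singleton (x : Circ)).subset fun w hw => ?_
      by_contra hne
      exact hw.1 hne hw.2
  simpa using this

/-- Near a zero, `|f|` is at least half its linear part; elsewhere `|f|` is locally bounded below
while distances are at most `π`. Compactness gives one constant. -/
theorem exists_mul_infEDist_le (hf : f.NoDegenerateZero) (hne : f.zeros.Nonempty) :
    ∃ a : ℝ, 0 < a ∧ ∀ z, ENNReal.ofReal a * Metric.infEDist z f.zeros ≤ ENNReal.ofReal |f z| := by
  have : ∃ a : ℝ, 0 < a ∧ ∀ z ∈ (univ : Set Circ),
      ENNReal.ofReal a * Metric.infEDist z f.zeros ≤ ENNReal.ofReal |f z| := by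
    refine isCompact_univ.induction_on (p := fun s => ∃ a : ℝ, 0 < a ∧ ∀ z ∈ s,
      ENNReal.ofReal a * Metric.infEDist z f.zeros ≤ ENNReal.ofReal |f z|)
      ⟨1, one_pos, by simp⟩ ?_ ?_ ?_
    · rintro s t hst ⟨a, ha, h⟩
      exact ⟨a, ha, fun z hz => h z (hst hz)⟩
    · rintro s t ⟨a, ha, h⟩ ⟨b, hb, h'⟩
      refine ⟨min a b, lt_min ha hb, fun z hz => ?_⟩
      rcases hz with hz | hz
      · exact le_trans (by gcongr; exact min_le_left _ _) (h z hz)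
      · exact le_trans (by gcongr; exact min_le_right _ _) (h' z hz)
    · intro z _
      obtain ⟨x, rfl⟩ := QuotientAddGroup.mk_surjective z
      suffices h : ∃ a : ℝ, 0 < a ∧ ∀ᶠ t : ℝ in 𝓝 x,
          ENNReal.ofReal a * Metric.infEDist (t : Circ) f.zeros ≤
            ENNReal.ofReal |f (t : Circ)| by
        obtain ⟨a, ha, h⟩ := h
        exact ⟨_, mem_nhdsWithin_of_mem_nhds (nhds_coe_le x (image_mem_map h)), a, ha, by
          rintro _ ⟨t, ht, rfl⟩; exact ht⟩
      by_cases hx : f (x : Circ) = 0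
      · have hd := deriv_ne_zero_of_noDegenerateZero hf hx
        have hd0 : 0 < |f.deriv (x : Circ)| / 2 := by positivity
        refine ⟨|f.deriv (x : Circ)| / 2, hd0, ?_⟩
        have ho := (hasDerivAt_iff_isLittleO.1 (f.hasDerivAt x)).def hd0
        filter_upwards [ho] with t ht
        rw [hx, sub_zero, smul_eq_mul, Real.norm_eq_abs, Real.norm_eq_abs] at ht
        have h1 : Metric.infEDist (t : Circ) f.zeros ≤ ENNReal.ofReal |t - x| := by
          refine (Metric.infEDist_le_edist_of_mem (show (x : Circ) ∈ f.zeros from hx)).trans ?_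
          rw [edist_eq_ofReal_norm, ← AddCircle.coe_sub]
          exact ENNReal.ofReal_le_ofReal (norm_coe_le_abs _)
        calc _ ≤ ENNReal.ofReal (|f.deriv (x : Circ)| / 2) * ENNReal.ofReal |t - x| := by gcongr
          _ = ENNReal.ofReal (|f.deriv (x : Circ)| / 2 * |t - x|) :=
              (ENNReal.ofReal_mul hd0.le).symm
          _ ≤ _ := by
            refine ENNReal.ofReal_le_ofReal ?_
            have h2 := abs_sub_abs_le_abs_sub ((t - x) * f.deriv (x : Circ)) (f (t : Circ))
            rw [abs_sub_comm, abs_mul] at h2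
            linarith
      · have hp := Real.pi_pos
        have hx0 : 0 < |f (x : Circ)| := abs_pos.2 hx
        refine ⟨|f (x : Circ)| / 2 / Real.pi, by positivity, ?_⟩
        have hc : ContinuousAt (fun t : ℝ => |f (t : Circ)|) x :=
          f.contDiff.continuous.abs.continuousAt
        obtain ⟨c, hc0⟩ := hne
        filter_upwards [hc.eventually_const_lt
          (show |f (x : Circ)| / 2 < |f (x : Circ)| by linarith)] with t ht
        have h1 : Metric.infEDist (t : Circ) f.zeros ≤ ENNReal.ofReal Real.pi := by
          refine (Metric.infEDist_le_edist_of_mem hc0).trans ?_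
          rw [edist_eq_ofReal_norm]
          exact ENNReal.ofReal_le_ofReal (norm_le_pi _)
        calc _ ≤ ENNReal.ofReal (|f (x : Circ)| / 2 / Real.pi) * ENNReal.ofReal Real.pi := by gcongr
          _ = ENNReal.ofReal (|f (x : Circ)| / 2) := by
            rw [← ENNReal.ofReal_mul (by positivity), div_mul_cancel₀ _ hp.ne']
          _ ≤ _ := ENNReal.ofReal_le_ofReal ht.le
  obtain ⟨a, ha, h⟩ := this
  exact ⟨a, ha, fun z => h z (mem_univ z)⟩

end AnalyticFun

/-! ### Averages of inverse square roots of distances -/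

theorem rpow_neg_half_anti {x y : ℝ≥0∞} (h : x ≤ y) :
    y ^ (-(1 / 2) : ℝ) ≤ x ^ (-(1 / 2) : ℝ) := by
  rw [ENNReal.rpow_neg, ENNReal.rpow_neg]
  exact ENNReal.inv_le_inv.2 (ENNReal.rpow_le_rpow h (by norm_num))

theorem ofReal_mul_rpow_neg_half {s : ℝ} (hs : 0 < s) (x : ℝ≥0∞) :
    (ENNReal.ofReal s * x) ^ (-(1 / 2) : ℝ) =
      ENNReal.ofReal s ^ (-(1 / 2) : ℝ) * x ^ (-(1 / 2) : ℝ) := by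
  have h0 : ENNReal.ofReal s ≠ 0 := by simpa using hs
  have h2 : ENNReal.ofReal s ^ (1 / 2 : ℝ) ≠ 0 := by simp [hs]
  have h3 : ENNReal.ofReal s ^ (1 / 2 : ℝ) ≠ ⊤ :=
    ENNReal.rpow_ne_top_of_nonneg (by norm_num) ENNReal.ofReal_ne_top
  rw [ENNReal.rpow_neg, ENNReal.rpow_neg, ENNReal.rpow_neg,
    ENNReal.mul_rpow_of_nonneg _ _ (by norm_num), ENNReal.mul_inv (Or.inl h2) (Or.inl h3)]

theorem ofReal_rpow_neg_half {s : ℝ} (hs : 0 < s) :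
    ENNReal.ofReal s ^ (-(1 / 2) : ℝ) = ENNReal.ofReal (1 / √s) := by
  rw [ENNReal.ofReal_rpow_of_pos hs, Real.rpow_neg hs.le, Real.sqrt_eq_rpow, one_div, one_div]

theorem lintegral_Ioo_rpow_neg_half {T : ℝ} (hT : 0 < T) :
    ∫⁻ σ in Ioo 0 T, ENNReal.ofReal |σ| ^ (-(1 / 2) : ℝ) = ENNReal.ofReal (2 * √T) := by
  have e : ∫⁻ σ in Ioo 0 T, ENNReal.ofReal |σ| ^ (-(1 / 2) : ℝ) =
      ∫⁻ σ in Ioo 0 T, ENNReal.ofReal (σ ^ (-(1 / 2) : ℝ)) := by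
    refine setLIntegral_congr_fun measurableSet_Ioo fun σ hσ => ?_
    rw [abs_of_pos hσ.1, ENNReal.ofReal_rpow_of_pos hσ.1]
  have hi : IntervalIntegrable (fun σ : ℝ => σ ^ (-(1 / 2) : ℝ)) volume 0 T :=
    intervalIntegral.intervalIntegrable_rpow' (by norm_num)
  have hi' : IntegrableOn (fun σ : ℝ => σ ^ (-(1 / 2) : ℝ)) (Ioo 0 T) :=
    ((intervalIntegrable_iff_integrableOn_Ioc_of_le hT.le).1 hi).mono_set Ioo_subset_Ioc_self
  rw [e, ← ofReal_integral_eq_lintegral_ofReal hi' (by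
    filter_upwards [ae_restrict_mem measurableSet_Ioo] with σ hσ
    exact Real.rpow_nonneg hσ.1.le _), ← integral_Ioc_eq_integral_Ioo,
    ← intervalIntegral.integral_of_le hT.le, integral_rpow (Or.inl (by norm_num))]
  congr 1
  rw [Real.zero_rpow (by norm_num), Real.sqrt_eq_rpow]
  norm_num
  ring

theorem lintegral_Ioo_neg_rpow_neg_half {T : ℝ} (hT : 0 < T) :
    ∫⁻ σ in Ioo (-T) T, ENNReal.ofReal |σ| ^ (-(1 / 2) : ℝ) ≤ ENNReal.ofReal (4 * √T) := by
  have hsub : Ioo (-T) T ⊆ (Ioo (-T) 0 ∪ {0}) ∪ Ioo 0 T := fun σ hσ => by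
    rcases lt_trichotomy σ 0 with h | h | h
    · exact Or.inl (Or.inl ⟨hσ.1, h⟩)
    · exact Or.inl (Or.inr h)
    · exact Or.inr ⟨h, hσ.2⟩
  have hneg : ∫⁻ σ in Ioo (-T) 0, ENNReal.ofReal |σ| ^ (-(1 / 2) : ℝ) =
      ∫⁻ σ in Ioo 0 T, ENNReal.ofReal |σ| ^ (-(1 / 2) : ℝ) := by
    rw [← lintegral_indicator measurableSet_Ioo, ← lintegral_indicator measurableSet_Ioo,
      ← lintegral_neg_eq_self]
    refine lintegral_congr fun σ => ?_
    by_cases h : σ ∈ Ioo 0 T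
    · rw [indicator_of_mem h, indicator_of_mem (by exact ⟨by linarith [h.2], by linarith [h.1]⟩),
        abs_neg]
    · rw [indicator_of_notMem h, indicator_of_notMem]
      exact fun h' => h ⟨by linarith [h'.2], by linarith [h'.1]⟩
  calc _ ≤ ∫⁻ σ in (Ioo (-T) 0 ∪ {0}) ∪ Ioo 0 T, ENNReal.ofReal |σ| ^ (-(1 / 2) : ℝ) :=
        lintegral_mono_set hsub
    _ ≤ ((∫⁻ σ in Ioo (-T) 0, ENNReal.ofReal |σ| ^ (-(1 / 2) : ℝ)) +
          ∫⁻ σ in {0}, ENNReal.ofReal |σ| ^ (-(1 / 2) : ℝ)) +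
          ∫⁻ σ in Ioo 0 T, ENNReal.ofReal |σ| ^ (-(1 / 2) : ℝ) :=
        (lintegral_union_le _ _ _).trans (add_le_add (lintegral_union_le _ _ _) le_rfl)
    _ = ENNReal.ofReal (4 * √T) := by
        rw [hneg, lintegral_Ioo_rpow_neg_half hT, setLIntegral_measure_zero _ _ (by simp), add_zero,
          ← ENNReal.ofReal_add (by positivity) (by positivity)]
        congr 1
        ring

/-- The times with `|τ - c| < T` contribute at most `4√T`; on the rest the integrand is at most
`1/√T`, giving `√T`. -/
theorem lintegral_Icc_abs_sub_rpow_neg_half {T : ℝ} (hT : 0 < T) (c : ℝ) :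
    ∫⁻ τ in Icc 0 T, ENNReal.ofReal |τ - c| ^ (-(1 / 2) : ℝ) ≤ ENNReal.ofReal (5 * √T) := by
  set g : ℝ → ℝ≥0∞ := (Ioo (-T) T).indicator fun σ => ENNReal.ofReal |σ| ^ (-(1 / 2) : ℝ) with hg
  have hpt : ∀ τ, ENNReal.ofReal |τ - c| ^ (-(1 / 2) : ℝ) ≤ g (τ - c) + ENNReal.ofReal (1 / √T) := by
    intro τ
    by_cases h : τ - c ∈ Ioo (-T) T
    · rw [hg, indicator_of_mem h]
      exact le_self_add
    · have : T ≤ |τ - c| := by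
        by_contra! h'
        exact h (abs_lt.1 h')
      rw [← ofReal_rpow_neg_half hT]
      exact (rpow_neg_half_anti (ENNReal.ofReal_le_ofReal this)).trans le_add_self
  calc _ ≤ ∫⁻ τ in Icc 0 T, (g (τ - c) + ENNReal.ofReal (1 / √T)) := lintegral_mono hpt
    _ = (∫⁻ τ in Icc 0 T, g (τ - c)) + ENNReal.ofReal (1 / √T) * ENNReal.ofReal T := by
        rw [lintegral_add_right _ measurable_const, setLIntegral_const, Real.volume_Icc, sub_zero]
    _ ≤ (∫⁻ τ, g (τ - c)) + ENNReal.ofReal (1 / √T) * ENNReal.ofReal T := by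
        exact add_le_add (setLIntegral_le_lintegral _ _) le_rfl
    _ = (∫⁻ σ in Ioo (-T) T, ENNReal.ofReal |σ| ^ (-(1 / 2) : ℝ)) +
          ENNReal.ofReal (1 / √T) * ENNReal.ofReal T := by
        rw [lintegral_sub_right_eq_self g c, hg, lintegral_indicator measurableSet_Ioo]
    _ ≤ ENNReal.ofReal (4 * √T) + ENNReal.ofReal (√T) := by
        refine add_le_add (lintegral_Ioo_neg_rpow_neg_half hT) (le_of_eq ?_)
        rw [← ENNReal.ofReal_mul (by positivity)]
        congr 1
        rw [one_div, inv_mul_eq_div, Real.div_sqrt]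
    _ = _ := by
        rw [← ENNReal.ofReal_add (by positivity) (by positivity)]
        congr 1
        ring

/-- The average over `[0, T]` of `|y + τ v| ^ (-1/2)`. -/
theorem lintegral_cond_abs_rpow_neg_half_le {T : ℝ} (hT : 0 < T) (y v : ℝ) :
    ∫⁻ τ, ENNReal.ofReal |y + τ * v| ^ (-(1 / 2) : ℝ) ∂(cond volume (Icc 0 T)) ≤
      5 * ENNReal.ofReal (T * |v|) ^ (-(1 / 2) : ℝ) := by
  -- At speed zero the right side is infinite, since `0 ^ (-1/2) = ⊤`.
  by_cases hv : v = 0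
  · simp [hv]
  have hv0 : 0 < |v| := abs_pos.2 hv
  have e : ∀ τ : ℝ, ENNReal.ofReal |y + τ * v| ^ (-(1 / 2) : ℝ) =
      ENNReal.ofReal |v| ^ (-(1 / 2) : ℝ) * ENNReal.ofReal |τ - (-y / v)| ^ (-(1 / 2) : ℝ) := by
    intro τ
    rw [← ofReal_mul_rpow_neg_half hv0, ← ENNReal.ofReal_mul hv0.le, ← abs_mul]
    congr 3
    field_simp
    ring
  have hfin : ENNReal.ofReal |v| ^ (-(1 / 2) : ℝ) ≠ ⊤ := by
    rw [ofReal_rpow_neg_half hv0]; exact ENNReal.ofReal_ne_top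
  rw [cond_Icc_eq, lintegral_smul_measure]
  simp_rw [e]
  rw [lintegral_const_mul' _ _ hfin, smul_eq_mul]
  calc _ ≤ (ENNReal.ofReal T)⁻¹ * (ENNReal.ofReal |v| ^ (-(1 / 2) : ℝ) *
        ENNReal.ofReal (5 * √T)) := by
        gcongr
        exact lintegral_Icc_abs_sub_rpow_neg_half hT _
    _ = _ := by
        have h5 : (5 : ℝ≥0∞) = ENNReal.ofReal 5 := by simp
        rw [ofReal_rpow_neg_half hv0, ofReal_rpow_neg_half (by positivity),
          ← ENNReal.ofReal_inv_of_pos hT, ← ENNReal.ofReal_mul (by positivity),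
          ← ENNReal.ofReal_mul (by positivity), h5, ← ENNReal.ofReal_mul (by positivity)]
        congr 1
        rw [Real.sqrt_mul hT.le]
        have := Real.sq_sqrt hT.le
        field_simp
        rw [this]

end HamiltonianShear

namespace HamiltonianShear

/-! ### Averages along rotations of the circle -/

theorem lintegral_cond_edist_le_of_le {T v : ℝ} (hT : 0 < T) {N : ℕ}
    (hN : Real.pi + T * |v| ≤ 2 * Real.pi * (N - 1 / 2)) (q c : Circ) :
    ∫⁻ τ, edist (q + ((τ * v : ℝ) : Circ)) c ^ (-(1 / 2) : ℝ) ∂(cond volume (Icc 0 T)) ≤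
      ((2 * N + 1 : ℕ) : ℝ≥0∞) * (5 * ENNReal.ofReal (T * |v|) ^ (-(1 / 2) : ℝ)) := by
  have hpi := Real.pi_pos
  obtain ⟨x, hx, hxn⟩ := exists_lift_abs_eq_norm (q - c)
  have hxpi : |x| ≤ Real.pi := hxn ▸ norm_le_pi _
  have hpt : ∀ τ ∈ Icc 0 T, edist (q + ((τ * v : ℝ) : Circ)) c ^ (-(1 / 2) : ℝ) ≤
      ∑ k ∈ Finset.Icc (-(N : ℤ)) N,
        ENNReal.ofReal |(x - k * (2 * Real.pi)) + τ * v| ^ (-(1 / 2) : ℝ) := by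
    intro τ hτ
    set s := x + τ * v with hs
    have e1 : q + ((τ * v : ℝ) : Circ) - c = (s : Circ) := by
      rw [hs, AddCircle.coe_add, hx]; abel
    have hsb : |s| ≤ 2 * Real.pi * (N - 1 / 2) := by
      refine le_trans ((abs_add_le _ _).trans (add_le_add hxpi ?_)) hN
      rw [abs_mul, abs_of_nonneg hτ.1]
      exact mul_le_mul_of_nonneg_right hτ.2 (abs_nonneg v)
    -- The distance on the circle is the distance of the lift to its nearest multiple of `2π`; the
    -- hypothesis on `N` confines that multiple to `2N + 1` values, over which one sums.
    set k := round ((2 * Real.pi)⁻¹ * s) with hk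
    have hkN : k ∈ Finset.Icc (-(N : ℤ)) N := by
      have h1 : |(2 * Real.pi)⁻¹ * s| ≤ N - 1 / 2 := by
        rw [abs_mul, abs_of_pos (by positivity), inv_mul_le_iff₀ (by positivity)]
        exact hsb
      have h2 := abs_sub_round ((2 * Real.pi)⁻¹ * s)
      rw [← hk] at h2
      have h3 := abs_le.1 h1
      have h4 := abs_le.1 h2
      rw [Finset.mem_Icc]
      constructor
      · have : (-(N : ℝ)) ≤ (k : ℝ) := by linarith
        exact_mod_cast this
      · have : (k : ℝ) ≤ (N : ℝ) := by linarith
        exact_mod_cast this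
    have e2 : edist (q + ((τ * v : ℝ) : Circ)) c =
        ENNReal.ofReal |(x - k * (2 * Real.pi)) + τ * v| := by
      rw [edist_eq_ofReal_norm, e1, AddCircle.norm_eq, ← hk, hs]
      congr 2
      ring
    rw [e2]
    exact Finset.single_le_sum (f := fun k : ℤ =>
      ENNReal.ofReal |(x - k * (2 * Real.pi)) + τ * v| ^ (-(1 / 2) : ℝ))
      (fun _ _ => zero_le) hkN
  have hmeas : ∀ k : ℤ, Measurable fun τ : ℝ =>
      ENNReal.ofReal |(x - k * (2 * Real.pi)) + τ * v| ^ (-(1 / 2) : ℝ) := fun k =>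
    (ENNReal.continuous_rpow_const.comp (ENNReal.continuous_ofReal.comp
      (by fun_prop : Continuous fun τ : ℝ => |(x - k * (2 * Real.pi)) + τ * v|))).measurable
  calc _ ≤ ∫⁻ τ, ∑ k ∈ Finset.Icc (-(N : ℤ)) N,
        ENNReal.ofReal |(x - k * (2 * Real.pi)) + τ * v| ^ (-(1 / 2) : ℝ)
          ∂(cond volume (Icc 0 T)) :=
        lintegral_mono_ae ((ae_cond_mem measurableSet_Icc).mono hpt)
    _ = ∑ k ∈ Finset.Icc (-(N : ℤ)) N, ∫⁻ τ,
        ENNReal.ofReal |(x - k * (2 * Real.pi)) + τ * v| ^ (-(1 / 2) : ℝ)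
          ∂(cond volume (Icc 0 T)) := lintegral_finsetSum _ fun k _ => hmeas k
    _ ≤ ∑ k ∈ Finset.Icc (-(N : ℤ)) N, 5 * ENNReal.ofReal (T * |v|) ^ (-(1 / 2) : ℝ) :=
        Finset.sum_le_sum fun k _ => lintegral_cond_abs_rpow_neg_half_le hT _ _
    _ = _ := by
        rw [Finset.sum_const, nsmul_eq_mul, Int.card_Icc]
        congr 2
        omega

/-- The average of the inverse square root of the distance to a point along a rotation. The
coefficient of the singular term does not depend on `T`. -/
theorem exists_lintegral_cond_edist_le {T : ℝ} (hT : 0 < T) (B : ℝ) :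
    ∃ K : ℝ≥0∞, K ≠ ⊤ ∧ ∀ v : ℝ, |v| ≤ B → ∀ q c : Circ,
      ∫⁻ τ, edist (q + ((τ * v : ℝ) : Circ)) c ^ (-(1 / 2) : ℝ) ∂(cond volume (Icc 0 T)) ≤
        25 * ENNReal.ofReal (T * |v|) ^ (-(1 / 2) : ℝ) + K := by
  have hpi := Real.pi_pos
  obtain ⟨N, hN⟩ := exists_nat_ge ((Real.pi + T * B) / (2 * Real.pi) + 1 / 2)
  refine ⟨((2 * N + 1 : ℕ) : ℝ≥0∞) * 5, by finiteness, fun v hv q c => ?_⟩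
  rcases le_or_gt (T * |v|) (2 * Real.pi) with h | h
  · refine (lintegral_cond_edist_le_of_le hT (N := 2) (by push_cast; linarith) q c).trans ?_
    refine le_trans (le_of_eq ?_) le_self_add
    rw [← mul_assoc]
    norm_num
  -- With more than one turn `(T|v|) ^ (-1/2) ≤ 1`, so everything goes into `K`, which may depend on
  -- `T` and `B`.
  · have hN' : Real.pi + T * |v| ≤ 2 * Real.pi * (N - 1 / 2) := by
      have h1 : (Real.pi + T * B) / (2 * Real.pi) ≤ N - 1 / 2 := by linarith
      rw [div_le_iff₀ (by positivity)] at h1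
      have h2 : T * |v| ≤ T * B := mul_le_mul_of_nonneg_left hv hT.le
      linarith
    refine (lintegral_cond_edist_le_of_le hT hN' q c).trans (le_trans ?_ le_add_self)
    have h1 : ENNReal.ofReal (T * |v|) ^ (-(1 / 2) : ℝ) ≤ 1 := by
      have h2 : (1 : ℝ≥0∞) ≤ ENNReal.ofReal (T * |v|) := by
        rw [ENNReal.one_le_ofReal]
        linarith [Real.pi_gt_three]
      simpa using rpow_neg_half_anti h2
    gcongr
    exact mul_le_of_le_one_right zero_le h1

theorem exists_lintegral_cond_infEDist_le {T : ℝ} (hT : 0 < T) (B : ℝ) {C : Set Circ}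
    (hC : C.Finite) :
    ∃ K : ℝ≥0∞, K ≠ ⊤ ∧ ∀ v : ℝ, |v| ≤ B → ∀ q : Circ,
      ∫⁻ τ, Metric.infEDist (q + ((τ * v : ℝ) : Circ)) C ^ (-(1 / 2) : ℝ)
        ∂(cond volume (Icc 0 T)) ≤
        (C.ncard * 25 : ℕ) * ENNReal.ofReal (T * |v|) ^ (-(1 / 2) : ℝ) + K := by
  obtain ⟨K, hK, h⟩ := exists_lintegral_cond_edist_le hT B
  refine ⟨C.ncard * K, by finiteness, fun v hv q => ?_⟩
  have hpt : ∀ z : Circ, Metric.infEDist z C ^ (-(1 / 2) : ℝ) ≤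
      ∑ c ∈ hC.toFinset, edist z c ^ (-(1 / 2) : ℝ) := by
    intro z
    rcases C.eq_empty_or_nonempty with rfl | hne
    · simp
    · obtain ⟨c, hc, e⟩ := hC.isCompact.exists_infEDist_eq_edist hne z
      rw [e]
      exact Finset.single_le_sum (f := fun c => edist z c ^ (-(1 / 2) : ℝ)) (fun _ _ => zero_le)
        (hC.mem_toFinset.2 hc)
  have hmeas : ∀ c : Circ, Measurable fun τ : ℝ =>
      edist (q + ((τ * v : ℝ) : Circ)) c ^ (-(1 / 2) : ℝ) := fun c => by
    have h1 : Continuous fun τ : ℝ => ((τ * v : ℝ) : Circ) :=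
      (AddCircle.continuous_mk' (2 * Real.pi)).comp (by fun_prop)
    exact (ENNReal.continuous_rpow_const.comp
      ((continuous_const.add h1).edist continuous_const)).measurable
  calc _ ≤ ∫⁻ τ, ∑ c ∈ hC.toFinset, edist (q + ((τ * v : ℝ) : Circ)) c ^ (-(1 / 2) : ℝ)
          ∂(cond volume (Icc 0 T)) := lintegral_mono fun τ => hpt _
    _ = ∑ c ∈ hC.toFinset, ∫⁻ τ, edist (q + ((τ * v : ℝ) : Circ)) c ^ (-(1 / 2) : ℝ)
          ∂(cond volume (Icc 0 T)) := lintegral_finsetSum _ fun c _ => hmeas c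
    _ ≤ ∑ c ∈ hC.toFinset, (25 * ENNReal.ofReal (T * |v|) ^ (-(1 / 2) : ℝ) + K) :=
        Finset.sum_le_sum fun c _ => h v hv q c
    _ = _ := by
        rw [Finset.sum_const, nsmul_eq_mul, ← ncard_eq_toFinset_card C hC]
        push_cast
        ring

/-! ### The drift condition -/

variable {f₁ f₂ : AnalyticFun}

variable (f₁ f₂) in
/-- The singular part of the Lyapunov function, on the whole torus. -/
noncomputable def lyap (x : Circ × Circ) : ℝ≥0∞ :=
  max (Metric.infEDist x.1 f₂.zeros) (Metric.infEDist x.2 f₁.zeros) ^ (-(1 / 2) : ℝ)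

theorem continuous_lyap : Continuous (lyap f₁ f₂) := by
  refine ENNReal.continuous_rpow_const.comp (Continuous.max ?_ ?_)
  · exact Metric.continuous_infEDist.comp continuous_fst
  · exact Metric.continuous_infEDist.comp continuous_snd

theorem lyap_ne_top_iff (x : Circ × Circ) :
    lyap f₁ f₂ x ≠ ⊤ ↔ ¬ (f₁ x.2 = 0 ∧ f₂ x.1 = 0) := by
  have h1 : Metric.infEDist x.1 f₂.zeros = 0 ↔ f₂ x.1 = 0 :=
    (Metric.mem_iff_infEDist_zero_of_closed f₂.isClosed_zeros).symm
  have h2 : Metric.infEDist x.2 f₁.zeros = 0 ↔ f₁ x.2 = 0 :=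
    (Metric.mem_iff_infEDist_zero_of_closed f₁.isClosed_zeros).symm
  rw [← h1, ← h2, lyap, Ne, ENNReal.rpow_eq_top_iff, not_iff_not]
  have h3 : max (Metric.infEDist x.1 f₂.zeros) (Metric.infEDist x.2 f₁.zeros) = 0 ↔
      Metric.infEDist x.2 f₁.zeros = 0 ∧ Metric.infEDist x.1 f₂.zeros = 0 := by
    simp [and_comm]
  rw [h3]
  norm_num

/-- A distance to the empty set is `⊤`, and `⊤ ^ (-1/2) = 0`; no point is deleted from the torus in
this case. -/
theorem lyap_eq_zero_of_zeros_eq_empty (h : f₁.zeros = ∅ ∨ f₂.zeros = ∅) (x : Circ × Circ) :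
    lyap f₁ f₂ x = 0 := by
  rcases h with h | h <;> simp [lyap, h]

/-- The drift estimate when both zero sets are non-empty. The constants are as follows:
`a dist ≤ |f| ≤ A dist` and `c` bounds the singular term of the averages. -/
theorem lintegral_lyap_le {T a A c : ℝ} {K : ℝ≥0∞} (hT : 1 ≤ T) (ha : 0 < a) (hA : 1 ≤ A)
    (hc : 0 ≤ c)
    (hT1 : 8 * c ^ 4 * A ≤ a ^ 2 * T) (hT2 : 8 * c ^ 2 ≤ a * T)
    (hne₂ : f₂.zeros.Nonempty)
    (ha₁ : ∀ z, ENNReal.ofReal a * Metric.infEDist z f₁.zeros ≤ ENNReal.ofReal |f₁ z|)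
    (ha₂ : ∀ z, ENNReal.ofReal a * Metric.infEDist z f₂.zeros ≤ ENNReal.ofReal |f₂ z|)
    (hA₁ : ∀ z, ENNReal.ofReal |f₁ z| ≤ ENNReal.ofReal A * Metric.infEDist z f₁.zeros)
    (hav₁ : ∀ q p, ∫⁻ τ, Metric.infEDist (p + ((τ * f₂ q : ℝ) : Circ)) f₁.zeros ^ (-(1 / 2) : ℝ)
      ∂(cond volume (Icc 0 T)) ≤
        ENNReal.ofReal c * ENNReal.ofReal (T * |f₂ q|) ^ (-(1 / 2) : ℝ) + K)
    (hav₂ : ∀ q p, ∫⁻ τ, Metric.infEDist (q + ((τ * f₁ p : ℝ) : Circ)) f₂.zeros ^ (-(1 / 2) : ℝ)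
      ∂(cond volume (Icc 0 T)) ≤
        ENNReal.ofReal c * ENNReal.ofReal (T * |f₁ p|) ^ (-(1 / 2) : ℝ) + K)
    (x : Phase f₁ f₂) :
    ∫⁻ τ, lyap f₁ f₂ (shear₂ τ.2 (shear₁ τ.1 x)).1 ∂(timeLaw T) ≤
      ENNReal.ofReal (1 / 2) * lyap f₁ f₂ x.1 +
        (ENNReal.ofReal (c / √(T * a)) * K + K) := by
  obtain ⟨⟨q, p⟩, hx⟩ := x
  have hT0 : 0 < T := by linarith
  have hprob := isProbabilityMeasure_cond_Icc hT0
  set κ : Measure ℝ := cond volume (Icc 0 T) with hκ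
  set θ := ENNReal.ofReal (c / √(T * a)) with hθ
  have hTa : 0 < T * a := by positivity
  -- the singular average, in terms of the distance
  have hsing : ∀ (f : AnalyticFun), (∀ z, ENNReal.ofReal a * Metric.infEDist z f.zeros ≤
      ENNReal.ofReal |f z|) → ∀ z,
      ENNReal.ofReal c * ENNReal.ofReal (T * |f z|) ^ (-(1 / 2) : ℝ) ≤
        θ * Metric.infEDist z f.zeros ^ (-(1 / 2) : ℝ) := by
    intro f hf z
    have h1 : ENNReal.ofReal (T * a) * Metric.infEDist z f.zeros ≤ ENNReal.ofReal (T * |f z|) := by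
      rw [ENNReal.ofReal_mul hT0.le, ENNReal.ofReal_mul hT0.le, mul_assoc]
      gcongr
      exact hf z
    have h2 := rpow_neg_half_anti h1
    rw [ofReal_mul_rpow_neg_half hTa, ofReal_rpow_neg_half hTa] at h2
    calc _ ≤ ENNReal.ofReal c * (ENNReal.ofReal (1 / √(T * a)) *
          Metric.infEDist z f.zeros ^ (-(1 / 2) : ℝ)) := by gcongr
      _ = _ := by
        rw [← mul_assoc, ← ENNReal.ofReal_mul hc, mul_one_div]
  -- averaging over the second time
  have hinner : ∀ τ₁ : ℝ, ∫⁻ τ₂, lyap f₁ f₂ (shear₂ τ₂ (shear₁ τ₁ (⟨(q, p), hx⟩ : Phase f₁ f₂))).1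
      ∂κ ≤ θ * Metric.infEDist (q + ((τ₁ * f₁ p : ℝ) : Circ)) f₂.zeros ^ (-(1 / 2) : ℝ) + K := by
    intro τ₁
    calc _ ≤ ∫⁻ τ₂, Metric.infEDist
          (p + ((τ₂ * f₂ (q + ((τ₁ * f₁ p : ℝ) : Circ)) : ℝ) : Circ)) f₁.zeros ^ (-(1 / 2) : ℝ)
          ∂κ := lintegral_mono fun τ₂ => rpow_neg_half_anti (le_max_right _ _)
      _ ≤ _ := (hav₁ _ _).trans (add_le_add (hsing f₂ ha₂ _) le_rfl)
  -- averaging over the first time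
  have houter : θ * ∫⁻ τ₁, Metric.infEDist (q + ((τ₁ * f₁ p : ℝ) : Circ)) f₂.zeros ^
      (-(1 / 2) : ℝ) ∂κ ≤ ENNReal.ofReal (1 / 2) * lyap f₁ f₂ (q, p) + θ * K := by
    set D₁ := Metric.infEDist p f₁.zeros with hD₁
    set D₂ := Metric.infEDist q f₂.zeros with hD₂
    have hAT : 0 < 2 * A * T := by positivity
    -- Below the ratio `D₁ / D₂ = η` the horizontal displacement, at most `T A D₁`, is at most `D₂ /
    -- 2`.
    set η := 1 / (2 * A * T) with hη
    have hη0 : 0 < η := by positivity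
    have hη1 : η ≤ 1 := by
      rw [hη, div_le_one hAT]; nlinarith
    have hηmul : ∀ D : ℝ≥0∞, ENNReal.ofReal η * D ≤ D := fun D =>
      mul_le_of_le_one_left zero_le (ENNReal.ofReal_le_one.2 hη1)
    rcases le_or_gt (ENNReal.ofReal η * D₂) D₁ with hcase | hcase
    · have hmax : ENNReal.ofReal η * max D₂ D₁ ≤ D₁ := by
        rcases max_choice D₂ D₁ with e | e <;> rw [e]
        · exact hcase
        · exact hηmul _
      have h1 : D₁ ^ (-(1 / 2) : ℝ) ≤ ENNReal.ofReal (√(2 * A * T)) * lyap f₁ f₂ (q, p) := by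
        have h2 := rpow_neg_half_anti hmax
        rw [ofReal_mul_rpow_neg_half hη0, ofReal_rpow_neg_half hη0] at h2
        refine h2.trans (le_of_eq ?_)
        rw [hη, Real.sqrt_div zero_le_one, Real.sqrt_one, one_div_one_div]
        rfl
      -- Two averages give `θ²`, of order `1/T`, against the loss `√(2AT)`; after squaring, the
      -- claim is `hT1`.
      have hcoef : θ * (θ * ENNReal.ofReal (√(2 * A * T))) ≤ ENNReal.ofReal (1 / 2) := by
        rw [hθ, ← ENNReal.ofReal_mul (by positivity), ← ENNReal.ofReal_mul (by positivity)]
        refine ENNReal.ofReal_le_ofReal ?_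
        have e : c / √(T * a) * (c / √(T * a) * √(2 * A * T)) = c ^ 2 / (T * a) * √(2 * A * T) := by
          have := Real.sq_sqrt hTa.le
          rw [← mul_assoc, div_mul_div_comm, ← pow_two, ← pow_two, this]
        rw [e, div_mul_eq_mul_div, div_le_iff₀ hTa]
        refine abs_le_of_sq_le_sq' ?_ (by positivity) |>.2
        rw [mul_pow, Real.sq_sqrt hAT.le]
        have := mul_le_mul_of_nonneg_right hT1 hT0.le
        nlinarith
      calc _ ≤ θ * (θ * D₁ ^ (-(1 / 2) : ℝ) + K) := by
            gcongr
            exact (hav₂ _ _).trans (add_le_add (hsing f₁ ha₁ _) le_rfl)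
        _ ≤ θ * (θ * (ENNReal.ofReal (√(2 * A * T)) * lyap f₁ f₂ (q, p)) + K) := by gcongr
        _ = θ * (θ * ENNReal.ofReal (√(2 * A * T))) * lyap f₁ f₂ (q, p) + θ * K := by ring
        _ ≤ _ := by gcongr
    -- Finiteness of `D₂` allows half of it to be cancelled in the triangle inequality.
    · have hD₂top : D₂ ≠ ⊤ := Metric.infEDist_ne_top hne₂
      have hmax : max D₂ D₁ = D₂ := max_eq_left (hcase.le.trans (hηmul _))
      have hdist : ∀ τ ∈ Icc 0 T, ENNReal.ofReal (1 / 2) * D₂ ≤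
          Metric.infEDist (q + ((τ * f₁ p : ℝ) : Circ)) f₂.zeros := by
        intro τ hτ
        have h1 : D₂ ≤ Metric.infEDist (q + ((τ * f₁ p : ℝ) : Circ)) f₂.zeros +
            ENNReal.ofReal (1 / 2) * D₂ := by
          refine Metric.infEDist_le_infEDist_add_edist.trans (add_le_add le_rfl ?_)
          calc edist q (q + ((τ * f₁ p : ℝ) : Circ)) ≤ ENNReal.ofReal (T * |f₁ p|) := by
                rw [edist_comm, edist_eq_ofReal_norm, add_sub_cancel_left]
                refine ENNReal.ofReal_le_ofReal ((norm_coe_le_abs _).trans ?_)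
                rw [abs_mul, abs_of_nonneg hτ.1]
                exact mul_le_mul_of_nonneg_right hτ.2 (abs_nonneg _)
            _ ≤ ENNReal.ofReal T * (ENNReal.ofReal A * (ENNReal.ofReal η * D₂)) := by
                rw [ENNReal.ofReal_mul hT0.le]
                gcongr
                refine (hA₁ p).trans ?_
                gcongr
            _ = ENNReal.ofReal (1 / 2) * D₂ := by
                rw [← mul_assoc, ← mul_assoc, ← ENNReal.ofReal_mul hT0.le,
                  ← ENNReal.ofReal_mul (by positivity)]
                congr 2
                rw [hη]
                field_simp
        have hhalf : D₂ = ENNReal.ofReal (1 / 2) * D₂ + ENNReal.ofReal (1 / 2) * D₂ := by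
          rw [← add_mul, ← ENNReal.ofReal_add (by norm_num) (by norm_num)]
          norm_num
        conv_lhs at h1 => rw [hhalf]
        exact (ENNReal.add_le_add_iff_right
          (ENNReal.mul_ne_top ENNReal.ofReal_ne_top hD₂top)).1 h1
      -- One factor `θ` against the loss `√2` from halving the distance; after squaring, the claim
      -- is `hT2`.
      have hcoef : θ * ENNReal.ofReal (1 / √(1 / 2)) ≤ ENNReal.ofReal (1 / 2) := by
        rw [hθ, ← ENNReal.ofReal_mul (by positivity)]
        refine ENNReal.ofReal_le_ofReal ?_
        rw [div_mul_div_comm, mul_one, ← Real.sqrt_mul hTa.le, div_le_iff₀ (by positivity)]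
        refine abs_le_of_sq_le_sq' ?_ (by positivity) |>.2
        rw [mul_pow, Real.sq_sqrt (by positivity)]
        nlinarith
      calc _ ≤ θ * ∫⁻ _, ENNReal.ofReal (1 / √(1 / 2)) * D₂ ^ (-(1 / 2) : ℝ) ∂κ := by
            refine mul_le_mul' le_rfl (lintegral_mono_ae ?_)
            filter_upwards [ae_cond_mem measurableSet_Icc] with τ hτ
            have := rpow_neg_half_anti (hdist τ hτ)
            rwa [ofReal_mul_rpow_neg_half (by norm_num), ofReal_rpow_neg_half (by norm_num)] at this
        _ = θ * ENNReal.ofReal (1 / √(1 / 2)) * lyap f₁ f₂ (q, p) := by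
            rw [lintegral_const, measure_univ, mul_one, mul_assoc]
            have : lyap f₁ f₂ (q, p) = D₂ ^ (-(1 / 2) : ℝ) := by
              change max D₂ D₁ ^ (-(1 / 2) : ℝ) = _
              rw [hmax]
            rw [this]
        _ ≤ ENNReal.ofReal (1 / 2) * lyap f₁ f₂ (q, p) := by gcongr
        _ ≤ _ := le_self_add
  have hmeas : Measurable fun τ : ℝ × ℝ =>
      lyap f₁ f₂ (shear₂ τ.2 (shear₁ τ.1 (⟨(q, p), hx⟩ : Phase f₁ f₂))).1 := by
    have h1 : Continuous fun τ : ℝ × ℝ =>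
        (pStep τ ((⟨(q, p), hx⟩, lineOf 0) : PBundle f₁ f₂)).1.1 :=
      continuous_subtype_val.comp (continuous_fst.comp
        (continuous_pStep.comp (Continuous.prodMk_right _)))
    exact (continuous_lyap.comp h1).measurable
  rw [timeLaw, lintegral_prod _ hmeas.aemeasurable]
  calc _ ≤ ∫⁻ τ₁, (θ * Metric.infEDist (q + ((τ₁ * f₁ p : ℝ) : Circ)) f₂.zeros ^
        (-(1 / 2) : ℝ) + K) ∂κ := lintegral_mono hinner
    _ = θ * ∫⁻ τ₁, Metric.infEDist (q + ((τ₁ * f₁ p : ℝ) : Circ)) f₂.zeros ^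
        (-(1 / 2) : ℝ) ∂κ + K := by
        rw [lintegral_add_right _ measurable_const, lintegral_const_mul' _ _ ENNReal.ofReal_ne_top,
          lintegral_const, measure_univ, mul_one]
    _ ≤ (ENNReal.ofReal (1 / 2) * lyap f₁ f₂ (q, p) + θ * K) + K := add_le_add houter le_rfl
    _ = _ := add_assoc _ _ _

theorem exists_drift_lyap (hH₁ : f₁.NoDegenerateZero) (hH₂ : f₂.NoDegenerateZero) :
    ∃ T₀ : ℝ, 0 < T₀ ∧ ∀ T, T₀ ≤ T → ∃ K : ℝ≥0∞, K ≠ ⊤ ∧ ∀ x : Phase f₁ f₂,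
      ∫⁻ τ, lyap f₁ f₂ (shear₂ τ.2 (shear₁ τ.1 x)).1 ∂(timeLaw T) ≤
        ENNReal.ofReal (1 / 2) * lyap f₁ f₂ x.1 + K := by
  by_cases hne : f₁.zeros.Nonempty ∧ f₂.zeros.Nonempty
  · obtain ⟨hne₁, hne₂⟩ := hne
    obtain ⟨a₁, ha₁, h₁⟩ := AnalyticFun.exists_mul_infEDist_le hH₁ hne₁
    obtain ⟨a₂, ha₂, h₂⟩ := AnalyticFun.exists_mul_infEDist_le hH₂ hne₂
    obtain ⟨A₁, hA₁, H₁⟩ := f₁.exists_abs_le_mul_infEDist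
    obtain ⟨B₁, hB₁⟩ := f₁.exists_abs_le
    obtain ⟨B₂, hB₂⟩ := f₂.exists_abs_le
    set a := min a₁ a₂ with ha
    set A := max A₁ 1 with hA
    set c : ℝ := ((max f₁.zeros.ncard f₂.zeros.ncard * 25 : ℕ) : ℝ) with hc
    have ha0 : 0 < a := lt_min ha₁ ha₂
    have hA1 : 1 ≤ A := le_max_right _ _
    -- The threshold is available because `a`, `A` and `c` do not depend on `T`; only `K₁` and `K₂`
    -- do.
    refine ⟨1 + 8 * c ^ 4 * A / a ^ 2 + 8 * c ^ 2 / a, by positivity, fun T hT => ?_⟩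
    have p1 : 0 ≤ 8 * c ^ 4 * A / a ^ 2 := by positivity
    have p2 : 0 ≤ 8 * c ^ 2 / a := by positivity
    have hT1 : 1 ≤ T := by linarith
    have hT0 : 0 < T := by linarith
    obtain ⟨K₁, hK₁, k₁⟩ := exists_lintegral_cond_infEDist_le hT0 B₂ (AnalyticFun.finite_zeros hH₁)
    obtain ⟨K₂, hK₂, k₂⟩ := exists_lintegral_cond_infEDist_le hT0 B₁ (AnalyticFun.finite_zeros hH₂)
    have hcast : ∀ n : ℕ, n ≤ max f₁.zeros.ncard f₂.zeros.ncard →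
        ((n * 25 : ℕ) : ℝ≥0∞) ≤ ENNReal.ofReal c := fun n hn => by
      rw [hc, ENNReal.ofReal_natCast]
      exact_mod_cast Nat.mul_le_mul_right 25 hn
    refine ⟨ENNReal.ofReal (c / √(T * a)) * (K₁ + K₂) + (K₁ + K₂), by finiteness, fun x => ?_⟩
    refine lintegral_lyap_le (K := K₁ + K₂) (A := A) hT1 ha0 hA1 (by positivity) ?_ ?_ hne₂ ?_ ?_ ?_
      ?_ ?_ x
    · have h : 8 * c ^ 4 * A / a ^ 2 ≤ T := by linarith
      rw [div_le_iff₀ (by positivity)] at h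
      linarith
    · have h : 8 * c ^ 2 / a ≤ T := by linarith
      rw [div_le_iff₀ ha0] at h
      linarith
    · exact fun z => le_trans (by gcongr; exact min_le_left _ _) (h₁ z)
    · exact fun z => le_trans (by gcongr; exact min_le_right _ _) (h₂ z)
    · exact fun z => (H₁ z).trans (by gcongr; exact le_max_left _ _)
    · intro q p
      refine (k₁ (f₂ q) (hB₂ q) p).trans (add_le_add ?_ le_self_add)
      gcongr
      exact hcast _ (le_max_left _ _)
    · intro q p
      refine (k₂ (f₁ p) (hB₁ p) q).trans (add_le_add ?_ le_add_self)
      gcongr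
      exact hcast _ (le_max_right _ _)
  · have h0 : f₁.zeros = ∅ ∨ f₂.zeros = ∅ := by
      rw [not_and_or, not_nonempty_iff_eq_empty, not_nonempty_iff_eq_empty] at hne
      exact hne
    exact ⟨1, one_pos, fun T _ => ⟨0, by simp, fun x => by
      simp [lyap_eq_zero_of_zeros_eq_empty h0]⟩⟩

end HamiltonianShear

namespace HamiltonianShear

/-! ### Drift and minorization for the projective chain -/

variable {f₁ f₂ : AnalyticFun}

theorem lyapunov_eq_toReal_lyap (x : Phase f₁ f₂) :
    lyapunov f₁ f₂ (1 / 2) 1 x = (lyap f₁ f₂ x.1).toReal + 1 := rfl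

theorem lyap_ne_top (x : Phase f₁ f₂) : lyap f₁ f₂ x.1 ≠ ⊤ := (lyap_ne_top_iff x.1).2 x.2

theorem continuous_lyapunov : Continuous (lyapunov f₁ f₂ (1 / 2) 1) := by
  have h : Continuous fun x : Phase f₁ f₂ => (lyap f₁ f₂ x.1).toReal :=
    ENNReal.continuousOn_toReal.comp_continuous
      ((continuous_lyap (f₁ := f₁) (f₂ := f₂)).comp continuous_subtype_val) lyap_ne_top
  exact h.add continuous_const

theorem one_le_lyapunov (x : Phase f₁ f₂) : 1 ≤ lyapunov f₁ f₂ (1 / 2) 1 x := by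
  rw [lyapunov_eq_toReal_lyap]
  linarith [ENNReal.toReal_nonneg (a := lyap f₁ f₂ x.1)]

/-- On the whole torus `lyap` is continuous with values in `[0, ⊤]` and equals `⊤` exactly at the
deleted points, so its finite sublevel sets are closed in the torus and avoid them; the fibre of
lines is compact. -/
theorem isCompact_lyapunov_le (R : ℝ) :
    IsCompact {y : PBundle f₁ f₂ | lyapunov f₁ f₂ (1 / 2) 1 y.1 ≤ R} := by
  have hbase : IsCompact {x : Phase f₁ f₂ | lyapunov f₁ f₂ (1 / 2) 1 x ≤ R} := by
    rw [Topology.IsEmbedding.subtypeVal.isCompact_iff]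
    by_cases hR : 0 ≤ R - 1
    · have hclosed : IsClosed {x : Circ × Circ | lyap f₁ f₂ x ≤ ENNReal.ofReal (R - 1)} :=
        isClosed_le continuous_lyap continuous_const
      convert hclosed.isCompact using 1
      ext x
      simp only [mem_image, mem_ofPred_eq]
      constructor
      · rintro ⟨z, hz, rfl⟩
        rw [lyapunov_eq_toReal_lyap] at hz
        exact (ENNReal.le_ofReal_iff_toReal_le (lyap_ne_top z) hR).2 (by linarith)
      · intro hx
        have hx' := (lyap_ne_top_iff x).1 (ne_top_of_le_ne_top ENNReal.ofReal_ne_top hx)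
        refine ⟨⟨x, hx'⟩, ?_, rfl⟩
        rw [lyapunov_eq_toReal_lyap]
        have := ENNReal.toReal_le_of_le_ofReal hR hx
        simp only at this ⊢
        linarith
    · convert isCompact_empty using 1
      refine image_eq_empty.2 (eq_empty_of_forall_notMem fun x hx => hR ?_)
      have h1 := one_le_lyapunov x
      simp only [mem_ofPred_eq] at hx
      linarith
  have h := hbase.prod (isCompact_univ (X := Line))
  convert h using 1
  ext y
  simp

theorem drift_projKernel {T : ℝ} (hT : 0 < T) {K : ℝ≥0∞} (hK : K ≠ ⊤)
    (h : ∀ x : Phase f₁ f₂, ∫⁻ τ, lyap f₁ f₂ (shear₂ τ.2 (shear₁ τ.1 x)).1 ∂(timeLaw T) ≤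
      ENNReal.ofReal (1 / 2) * lyap f₁ f₂ x.1 + K) :
    Drift (projKernel f₁ f₂ T) (fun y => lyapunov f₁ f₂ (1 / 2) 1 y.1) (1 / 2)
      (K.toReal + 1) := by
  have := isMarkovKernel_projKernel (f₁ := f₁) (f₂ := f₂) hT
  have hm : Measurable fun y : PBundle f₁ f₂ => lyap f₁ f₂ y.1.1 :=
    ((continuous_lyap (f₁ := f₁) (f₂ := f₂)).comp
      (continuous_subtype_val.comp continuous_fst)).measurable
  have hle : ∀ y : PBundle f₁ f₂, ∫⁻ z, lyap f₁ f₂ z.1.1 ∂(projKernel f₁ f₂ T y) ≤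
      ENNReal.ofReal (1 / 2) * lyap f₁ f₂ y.1.1 + K := fun y => by
    rw [lintegral_projKernel y hm]
    exact h y.1
  have htop : ∀ y : PBundle f₁ f₂, ENNReal.ofReal (1 / 2) * lyap f₁ f₂ y.1.1 + K ≠ ⊤ := fun y =>
    ENNReal.add_ne_top.2 ⟨ENNReal.mul_ne_top ENNReal.ofReal_ne_top (lyap_ne_top y.1), hK⟩
  have hint : ∀ y : PBundle f₁ f₂,
      Integrable (fun z : PBundle f₁ f₂ => (lyap f₁ f₂ z.1.1).toReal) (projKernel f₁ f₂ T y) :=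
    fun y => integrable_toReal_of_lintegral_ne_top hm.aemeasurable
      (ne_top_of_le_ne_top (htop y) (hle y))
  refine ⟨fun y => (hint y).add (integrable_const 1), fun y => ?_⟩
  simp only [lyapunov_eq_toReal_lyap]
  rw [integral_add (hint y) (integrable_const 1), integral_toReal hm.aemeasurable
    (Eventually.of_forall fun z => (lyap_ne_top z.1).lt_top)]
  have h1 := ENNReal.toReal_mono (htop y) (hle y)
  rw [ENNReal.toReal_add (ENNReal.mul_ne_top ENNReal.ofReal_ne_top (lyap_ne_top y.1)) hK,
    ENNReal.toReal_mul, ENNReal.toReal_ofReal (by norm_num)] at h1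
  simp only [integral_const, probReal_univ, smul_eq_mul, mul_one]
  linarith

theorem exists_minorization_of_lyapunov_le (hc₁ : ¬ ∃ c : ℝ, ∀ z, f₁ z = c)
    (hc₂ : ¬ ∃ c : ℝ, ∀ z, f₂ z = c) :
    ∃ T₀ : ℝ, 0 < T₀ ∧ ∀ T : ℝ, T₀ ≤ T → ∀ R : ℝ, ∃ n : ℕ, n ≠ 0 ∧
      ∃ ν : Measure (PBundle f₁ f₂), IsFiniteMeasure ν ∧ ν ≠ 0 ∧
        ∀ y, lyapunov f₁ f₂ (1 / 2) 1 y.1 ≤ R → ν ≤ (projKernel f₁ f₂ T ^ n) y := by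
  obtain ⟨p, hp, hp'⟩ := exists_ne_zero_and_deriv_ne_zero f₁ hc₁
  obtain ⟨q, hq, hq'⟩ := exists_ne_zero_and_deriv_ne_zero f₂ hc₂
  -- The coefficient of `b` is `f₁ f₁'² f₂'`, nonzero by the choice of `p` and `q`.
  obtain ⟨b, hb, hper, hdet⟩ := exists_period_det_ne_zero f₁ hp
    (f₁ p * deriv (fun t : ℝ => f₁.deriv (t : Circ)) p * f₂ q - f₁.deriv p ^ 2 * f₂ q)
    (mul_ne_zero (mul_ne_zero hp (pow_ne_zero 2 hp')) hq')
  refine ⟨b + 2, by linarith, fun T hT R => ?_⟩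
  have hT0 : 0 < T := by linarith
  let x₀ : ChartDom f₁ f₂ := ⟨(q, p, 0), fun h => hp h.1⟩
  obtain ⟨ν, hν0, hν⟩ := exists_local_minorization x₀ hb hT
    (surjective_fderiv_chartWord f₁ f₂ hb.ne' hper hp hq hdet)
  obtain ⟨U, hUν, hU, hyU⟩ := mem_nhds_iff.1 hν
  -- The vertical shear fixes the vertical line, so the shifted base point is still a target of the
  -- reachability argument.
  have hline : (pShear₂ (-1) (chartPt x₀)).2 = lineOf 0 := by
    change lineMap (lower _) (lineOf 0) = _
    rw [lineMap_lower_lineOf (by simp)]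
    simp
  have := isMarkovKernel_projKernel (f₁ := f₁) (f₂ := f₂) hT0
  have : IsFiniteMeasure ν := isFiniteMeasure_of_le _ (hUν hyU)
  obtain ⟨n, hn, ν', h1, h2, h3⟩ := exists_minorization_of_isCompact hT0 hU
    (iUnion_reach_eq_univ hT0 hc₁ hline hq hq' (hU.mem_nhds hyU)) hν0 two_ne_zero
    (fun y hy => hUν hy) (isCompact_lyapunov_le R)
  exact ⟨n, hn, ν', h1, h2, h3⟩

theorem nonempty_pBundle (hc₁ : ¬ ∃ c : ℝ, ∀ z, f₁ z = c) : Nonempty (PBundle f₁ f₂) := by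
  obtain ⟨p, hp, -⟩ := exists_ne_zero_and_deriv_ne_zero f₁ hc₁
  exact ⟨⟨(0, p), fun h => hp h.1⟩, lineOf 0⟩

end HamiltonianShear

/-! ### Conclusion -/

theorem theorem4p1 (f₁ f₂ : HamiltonianShear.AnalyticFun)
    (hc₁ : ¬ ∃ c : ℝ, ∀ z, f₁ z = c) (hc₂ : ¬ ∃ c : ℝ, ∀ z, f₂ z = c)
    (hH₁ : f₁.NoDegenerateZero) (hH₂ : f₂.NoDegenerateZero) :
    ∃ β b : ℝ, 0 < β ∧ 0 < b ∧
      Continuous (HamiltonianShear.lyapunov f₁ f₂ β b) ∧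
      (∀ x, 1 ≤ HamiltonianShear.lyapunov f₁ f₂ β b x) ∧
      ∃ T₀ : ℝ, 0 < T₀ ∧ ∀ T : ℝ, T₀ ≤ T →
        HamiltonianShear.UniformlyGeometricallyErgodic
          (HamiltonianShear.projKernel f₁ f₂ T)
          (fun y : HamiltonianShear.PBundle f₁ f₂ =>
            HamiltonianShear.lyapunov f₁ f₂ β b y.1) := by
  -- The exponent `1/2` makes the singularity integrable in time, and `b = 1` gives `V ≥ 1`.
  refine ⟨1 / 2, 1, by norm_num, one_pos, HamiltonianShear.continuous_lyapunov,
    HamiltonianShear.one_le_lyapunov, ?_⟩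
  obtain ⟨T₁, hT₁, hdrift⟩ := HamiltonianShear.exists_drift_lyap hH₁ hH₂
  obtain ⟨T₂, -, hmin⟩ := HamiltonianShear.exists_minorization_of_lyapunov_le hc₁ hc₂
  refine ⟨max T₁ T₂, lt_max_of_lt_left hT₁, fun T hT => ?_⟩
  have hT0 : 0 < T := hT₁.trans_le ((le_max_left _ _).trans hT)
  obtain ⟨K, hK, hle⟩ := hdrift T ((le_max_left _ _).trans hT)
  have := HamiltonianShear.isMarkovKernel_projKernel (f₁ := f₁) (f₂ := f₂) hT0
  have := HamiltonianShear.nonempty_pBundle (f₂ := f₂) hc₁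
  exact HamiltonianShear.uniformlyGeometricallyErgodic_of_drift
    (HamiltonianShear.drift_projKernel hT0 hK hle)
    (HamiltonianShear.continuous_lyapunov.comp continuous_fst).measurable
    (fun y => HamiltonianShear.one_le_lyapunov y.1) (by norm_num) (by norm_num) (by positivity)
    (hmin T ((le_max_right _ _).trans hT))
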